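/- Let $V$ be a smooth real manifold of dimension $2n$ in Lagrange--Finsler variables. That is, $V$ is covered by charts $u=(u^\alpha)=(x^i,y^{n+i})$, $i=1,\dots,n$, each carrying a smooth real function $L(x,y)$ with $h_{ij}=\tfrac12\,\partial^2L/\partial y^i\partial y^j$ non-degenerate. Put $$2G^i=\tfrac12h^{ij}\Big(\frac{\partial^2L}{\partial y^j\partial x^k}y^k-\frac{\partial L}{\partial x^j}\Big),\quad N^a_i=\frac{\partial G^a}{\partial y^i},\quad e_i=\frac{\partial}{\partial x^i}-N^a_i\frac{\partial}{\partial y^a},\quad e_{n+i}=\frac{\partial}{\partial y^i},\quad e^i=dx^i,\quad e^{n+a}=dy^a+N^a_idx^i .$$ It is required that the pseudo-Riemannian metric $g=h_{ij}e^i\otimes e^j+h_{ij}e^{n+i}\otimes e^{n+j}$, the almost complex structure $J(e_i)=-e_{n+i}$, $J(e_{n+i})=e_i$, and the vertical distribution spanned by the $e_{n+i}$ are globally defined on $V$, i.e. agree on overlaps of charts. Let $\theta(X,Y)=g(JX,Y)$, $\theta^{\alpha\beta}=g^{\alpha\gamma}\theta_{\gamma\delta}g^{\delta\beta}$ and $\Lambda^{\alpha\beta}=\theta^{\alpha\beta}-i\,g^{\alpha\beta}$.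 Let $D$ be the normal d-connection, $D_{e_k}e_j=L^i_{jk}e_i$, $D_{e_k}e_{n+j}=L^i_{jk}e_{n+i}$, $D_{e_{n+k}}e_j=C^i_{jk}e_i$, $D_{e_{n+k}}e_{n+j}=C^i_{jk}e_{n+i}$, where $$L^i_{jk}=\tfrac12h^{im}(e_kh_{jm}+e_jh_{mk}-e_mh_{jk}),\qquad C^i_{jk}=\tfrac12h^{im}\Big(\frac{\partial h_{jm}}{\partial y^k}+\frac{\partial h_{mk}}{\partial y^j}-\frac{\partial h_{jk}}{\partial y^m}\Big).$$ In coordinates write $D_{\partial_\alpha}\partial_\beta=\Gamma^\gamma_{\beta\alpha}\partial_\gamma$, $T^\tau_{\alpha\beta}=\Gamma^\tau_{\alpha\beta}-\Gamma^\tau_{\beta\alpha}$, $R^\tau_{\varphi\alpha\beta}=\partial_\beta\Gamma^\tau_{\varphi\alpha}-\partial_\alpha\Gamma^\tau_{\varphi\beta}+\Gamma^m_{\varphi\alpha}\Gamma^\tau_{m\beta}-\Gamma^m_{\varphi\beta}\Gamma^\tau_{m\alpha}$. Let $\mathcal W$ be the space of smooth sections of the bundle of formal Wick algebras: formal series $\sum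 a_{r,m}(u)z^mv^r$ with complex coefficients in the fibre coordinates $z^\alpha$ of $T_uV$ and in $v$, with the fibrewise product $$(a\circ b)(z)=\exp\Big(\tfrac{iv}{2}\Lambda^{\alpha\beta}\frac{\partial^2}{\partial z^\alpha\partial z'^\beta}\Big)a(z)\,b(z')\Big|_{z'=z},$$ extended to $\mathcal W$-valued differential forms by means of the exterior product; let $ad_{Wick}$ be its graded commutator. Let $\deg_s$ be the degree in $z$, $\deg_a$ the form degree, and $Deg=2\deg_v+\deg_s$; $a^{(k)}$ is the component of $a$ with $Deg=k$. On $\mathcal W$-valued forms let $\delta=du^\alpha\wedge\partial/\partial z^\alpha$; let $\delta^{-1}a=\frac1{p+q}z^\alpha\,\iota(\partial_\alpha)a$ if $\deg_sa=p$, $\deg_aa=q$, $p+q>0$, and $\delta^{-1}a=0$ if $p=q=0$; and let $D(a\otimes\lambda)=(\partial_\alpha a-z^\beta\Gamma^\gamma_{\beta\alpha}\,\partial a/\partial z^\gamma)\otimes du^\alpha\wedge\lambda+a\otimes d\lambda$. Put $\mathcal T=\tfrac12z^\gamma\theta_{\gamma\tau}T^\tau_{\alpha\beta}\,du^\alpha\wedge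 du^\beta$ and $\mathcal R=\tfrac14z^\gamma z^\varphi\theta_{\gamma\tau}R^\tau_{\varphi\alpha\beta}\,du^\alpha\wedge du^\beta$. Define the $\mathcal W$-valued 1-form $r=\sum_kr^{(k)}$ by $r^{(0)}=r^{(1)}=0$, $r^{(2)}=\delta^{-1}\mathcal T$, $r^{(3)}=\delta^{-1}(\mathcal R+Dr^{(2)}-\frac iv\,r^{(2)}\circ r^{(2)})$ and $$r^{(k+3)}=\delta^{-1}\Big(Dr^{(k+2)}-\frac iv\sum_{l=0}^kr^{(l+2)}\circ r^{(k-l+2)}\Big)\quad(k\ge1),$$ and put $\widehat{\mathcal D}=-\delta+D-\frac iv\,ad_{Wick}(r)$ and $\mathcal W_{\widehat{\mathcal D}}=\{a\in\mathcal W:\widehat{\mathcal D}a=0\}$. Let $C^\infty(V)$ be the algebra of smooth complex-valued functions. **Theorem.** (1) The projection $\sigma:\mathcal W_{\widehat{\mathcal D}}\to C^\infty(V)[[v]]$ onto the part of $\deg_s$-degree zero is a bijection. (2) Its inverse $\tau$ is given on $f\in C^\infty(V)$ by $$\tau(f)^{(0)}=f,\qquad\tau(f)^{(k+1)}=\delta^{-1}\Big(D\tau(f)^{(k)}-\frac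 iv\sum_{l=0}^kad_{Wick}(r^{(l+2)})\big(\tau(f)^{(k-l)}\big)\Big)\quad(k\ge0),$$ and in general by $\tau(\sum_rf_rv^r)=\sum_r\tau(f_r)v^r$. (3) The formula $$f_1*f_2=\sigma\big(\tau(f_1)\circ\tau(f_2)\big)$$ defines a star product on $C^\infty(V)[[v]]$: it is associative with unit $1$, it is of the form $f*g=\sum_{r\ge0}B_r(f,g)v^r$ on $C^\infty(V)$ with $\mathbb C$-bilinear operators $B_r$ on $C^\infty(V)$, extended $v$-linearly and $v$-adically continuously to $C^\infty(V)[[v]]$, and $B_0(f,g)=fg$, $B_1(f,g)-B_1(g,f)=i\{f,g\}$ with the Poisson bracket $\{f,g\}=\theta^{\alpha\beta}\,\partial_\alpha f\,\partial_\beta g$. -/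

import Mathlib

open scoped ContDiff Manifold BigOperators Matrix

namespace LagrangeFedosov

/-! ### Coordinates and the canonical geometry of a regular Lagrangian -/

/-- Indices `α` of the `2n` coordinates `u^α = (x^i, y^{n+i})`: `Sum.inl i` is the horizontal index
`i` and `Sum.inr i` is the vertical index `n + i`. -/
abbrev Idx (n : ℕ) : Type := Fin n ⊕ Fin n

/-- The coordinate space `ℝ^{2n}` with points `u = (x, y)`. -/
abbrev Coord (n : ℕ) : Type := Idx n → ℝ

/-- The partial derivative `∂f/∂u^μ` at `w`. -/
noncomputable def pd {n : ℕ} {F : Type*} [NormedAddCommGroup F] [NormedSpace ℝ F] (μ : Idx n)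
    (f : Coord n → F) (w : Coord n) : F :=
  fderiv ℝ f w (Pi.single μ 1)

/-- `h_{ij} = (1/2) ∂²L/∂y^i∂y^j`. -/
noncomputable def hess {n : ℕ} (L : Coord n → ℝ) (w : Coord n) : Matrix (Fin n) (Fin n) ℝ :=
  Matrix.of fun i j => (1 / 2 : ℝ) * pd (Sum.inr i) (pd (Sum.inr j) L) w

/-- The semispray coefficients:
`2 G^i = (1/2) h^{ij} (∂²L/∂y^j∂x^k y^k - ∂L/∂x^j)`. -/
noncomputable def spray {n : ℕ} (L : Coord n → ℝ) (i : Fin n) (w : Coord n) : ℝ :=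
  (1 / 4 : ℝ) * ∑ j, (hess L w)⁻¹ i j *
    ((∑ k, pd (Sum.inr j) (pd (Sum.inl k) L) w * w (Sum.inr k)) - pd (Sum.inl j) L w)

/-- The canonical N-connection `N^a_i = ∂G^a/∂y^i`. -/
noncomputable def nconn {n : ℕ} (L : Coord n → ℝ) (a i : Fin n) (w : Coord n) : ℝ :=
  pd (Sum.inr i) (spray L a) w

/-- The N-adapted frame: the row `α` lists the coordinate components of `e_α`, where
`e_i = ∂/∂x^i - N^a_i ∂/∂y^a` and `e_{n+i} = ∂/∂y^i`. -/
noncomputable def frame {n : ℕ} (L : Coord n → ℝ) (w : Coord n) : Matrix (Idx n) (Idx n) ℝ :=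
  Matrix.fromBlocks 1 (Matrix.of fun i a => -nconn L a i w) 0 1

/-- The dual N-adapted coframe: the row `α` lists the coordinate components of `e^α`, where
`e^i = dx^i` and `e^{n+a} = dy^a + N^a_i dx^i`. -/
noncomputable def coframe {n : ℕ} (L : Coord n → ℝ) (w : Coord n) : Matrix (Idx n) (Idx n) ℝ :=
  Matrix.fromBlocks 1 0 (Matrix.of fun a i => nconn L a i w) 1

/-- The derivative `e_α(f)` along the N-adapted frame. -/
noncomputable def frameDeriv {n : ℕ} (L : Coord n → ℝ) (α : Idx n) (f : Coord n → ℝ)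
    (w : Coord n) : ℝ :=
  ∑ μ, frame L w α μ * pd μ f w

/-- `L^i_{jk} = (1/2) g^{im} (e_k g_{jm} + e_j g_{mk} - e_m g_{jk})`, with `g_{ij} = h_{ij}`. -/
noncomputable def hatL {n : ℕ} (L : Coord n → ℝ) (i j k : Fin n) (w : Coord n) : ℝ :=
  (1 / 2 : ℝ) * ∑ m, (hess L w)⁻¹ i m *
    (frameDeriv L (Sum.inl k) (fun u => hess L u j m) w
      + frameDeriv L (Sum.inl j) (fun u => hess L u m k) w
      - frameDeriv L (Sum.inl m) (fun u => hess L u j k) w)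

/-- `C^i_{jk} = (1/2) g^{im} (∂g_{jm}/∂y^k + ∂g_{mk}/∂y^j - ∂g_{jk}/∂y^m)`. -/
noncomputable def hatC {n : ℕ} (L : Coord n → ℝ) (i j k : Fin n) (w : Coord n) : ℝ :=
  (1 / 2 : ℝ) * ∑ m, (hess L w)⁻¹ i m *
    (pd (Sum.inr k) (fun u => hess L u j m) w
      + pd (Sum.inr j) (fun u => hess L u m k) w
      - pd (Sum.inr m) (fun u => hess L u j k) w)

/-- The coefficients of the normal d-connection in the N-adapted frame:
`D_{e_α} e_β = ∑_γ normalCoeff γ β α • e_γ`, that is `D_{e_k} e_j = L^i_{jk} e_i`,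
`D_{e_k} e_{n+j} = L^i_{jk} e_{n+i}`, `D_{e_{n+k}} e_j = C^i_{jk} e_i` and
`D_{e_{n+k}} e_{n+j} = C^i_{jk} e_{n+i}`. -/
noncomputable def normalCoeff {n : ℕ} (L : Coord n → ℝ) (w : Coord n) : Idx n → Idx n → Idx n → ℝ
  | Sum.inl i, Sum.inl j, Sum.inl k => hatL L i j k w
  | Sum.inr i, Sum.inr j, Sum.inl k => hatL L i j k w
  | Sum.inl i, Sum.inl j, Sum.inr k => hatC L i j k w
  | Sum.inr i, Sum.inr j, Sum.inr k => hatC L i j k w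
  | Sum.inl _, Sum.inr _, _ => 0
  | Sum.inr _, Sum.inl _, _ => 0

/-- The normal d-connection in the coordinate frame: `D_{∂_μ} ∂_ν = ∑_l conn l ν μ • ∂_l`,
computed from `∂_ν = ∑_γ (coframe γ ν) • e_γ` and the Leibniz rule. -/
noncomputable def conn {n : ℕ} (L : Coord n → ℝ) (l ν μ : Idx n) (w : Coord n) : ℝ :=
  ∑ γ, frame L w γ l * (pd μ (fun u => coframe L u γ ν) w
    + ∑ α, ∑ β, coframe L w α μ * coframe L w β ν * normalCoeff L w γ β α)

/-- The torsion `T^τ_{αβ} = Γ^τ_{αβ} - Γ^τ_{βα}` in the coordinate frame (the last lower index of `Γ`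
is the direction of differentiation). -/
noncomputable def torsion {n : ℕ} (L : Coord n → ℝ) (τ α β : Idx n) (w : Coord n) : ℝ :=
  conn L τ α β w - conn L τ β α w

/-- The curvature `R^τ_{φαβ} = ∂_β Γ^τ_{φα} - ∂_α Γ^τ_{φβ} + Γ^m_{φα} Γ^τ_{mβ} - Γ^m_{φβ} Γ^τ_{mα}`
in the coordinate frame. -/
noncomputable def curvature {n : ℕ} (L : Coord n → ℝ) (τ φ α β : Idx n) (w : Coord n) : ℝ :=
  pd β (conn L τ φ α) w - pd α (conn L τ φ β) w
    + ∑ m, (conn L m φ α w * conn L τ m β w - conn L m φ β w * conn L τ m α w)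

/-- Coordinate components of the metric
`g = h_{ij} e^i ⊗ e^j + h_{ij} e^{n+i} ⊗ e^{n+j}`. -/
noncomputable def metric {n : ℕ} (L : Coord n → ℝ) (w : Coord n) : Matrix (Idx n) (Idx n) ℝ :=
  (coframe L w)ᵀ * Matrix.fromBlocks (hess L w) 0 0 (hess L w) * coframe L w

/-- Coordinate components `J^l_μ` (row `l`, column `μ`) of the almost complex structure
`J(e_i) = -e_{n+i}`, `J(e_{n+i}) = e_i`. -/
noncomputable def acs {n : ℕ} (L : Coord n → ℝ) (w : Coord n) : Matrix (Idx n) (Idx n) ℝ :=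
  Matrix.of fun l μ => ∑ i : Fin n,
    (frame L w (Sum.inl i) l * coframe L w (Sum.inr i) μ
      - frame L w (Sum.inr i) l * coframe L w (Sum.inl i) μ)

/-- Coordinate components of the almost symplectic form `θ(X, Y) = g(J X, Y)`. -/
noncomputable def symp {n : ℕ} (L : Coord n → ℝ) (w : Coord n) : Matrix (Idx n) (Idx n) ℝ :=
  (acs L w)ᵀ * metric L w

/-- The form `θ` with upper indices, `θ^{αβ} = g^{αγ} θ_{γδ} g^{δβ}`. -/
noncomputable def sympUp {n : ℕ} (L : Coord n → ℝ) (w : Coord n) : Matrix (Idx n) (Idx n) ℝ :=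
  (metric L w)⁻¹ * symp L w * (metric L w)⁻¹

/-- The tensor `Λ^{αβ} = θ^{αβ} - i g^{αβ}`. -/
noncomputable def wickTensor {n : ℕ} (L : Coord n → ℝ) (w : Coord n) :
    Matrix (Idx n) (Idx n) ℂ :=
  Matrix.of fun α β => (sympUp L w α β : ℂ) - Complex.I * (((metric L w)⁻¹ α β : ℝ) : ℂ)

/-! ### The formal Wick algebra of one tangent space -/

/-- Formal series `∑ a_{r,m} z^m v^r`; `a r` is the coefficient of `v^r`, a formal power series in
the fibre coordinates `z^α`. -/
abbrev Wick (n : ℕ) : Type := ℕ → MvPowerSeries (Idx n) ℂ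

/-- `Λ^{α₁β₁} ⋯ Λ^{α_kβ_k} (∂_{α₁} ⋯ ∂_{α_k} f) (∂_{β₁} ⋯ ∂_{β_k} g)`, the derivatives being taken
with respect to `z`. -/
noncomputable def contract {n : ℕ} (Λ : Matrix (Idx n) (Idx n) ℂ) :
    ℕ → MvPowerSeries (Idx n) ℂ → MvPowerSeries (Idx n) ℂ → MvPowerSeries (Idx n) ℂ
  | 0, f, g => f * g
  | k + 1, f, g => ∑ α, ∑ β,
      Λ α β • contract Λ k (MvPowerSeries.pderiv ℂ α f) (MvPowerSeries.pderiv ℂ β g)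

/-- The formal Wick product
`(a ∘ b)(z) = exp((i v / 2) Λ^{αβ} ∂²/∂z^α∂z'^β) a(z) b(z') |_{z' = z}`. -/
noncomputable def wickMul {n : ℕ} (Λ : Matrix (Idx n) (Idx n) ℂ) (a b : Wick n) : Wick n :=
  fun r => ∑ k ∈ Finset.range (r + 1), ((Complex.I / 2) ^ k / (k.factorial : ℂ)) •
    ∑ p ∈ Finset.HasAntidiagonal.antidiagonal (r - k), contract Λ k (a p.1) (b p.2)

/-- Division by `v` of a series without `v^0` term. (It is applied below only to commutators and to
squares of odd elements, whose `v^0` term vanishes.) -/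
def divV {n : ℕ} (a : Wick n) : Wick n := fun r => a (r + 1)

/-- The component of total degree `Deg = 2 deg_v + deg_s` equal to `k`. -/
noncomputable def degPart {n : ℕ} (k : ℕ) (a : Wick n) : Wick n := fun r =>
  (fun m => if 2 * r + m.degree = k then MvPowerSeries.coeff m (a r) else 0 :
    (Idx n →₀ ℕ) → ℂ)

/-- A constant, as an element of the Wick algebra. -/
noncomputable def constW {n : ℕ} (c : ℂ) : Wick n := fun r => if r = 0 then MvPowerSeries.C c else 0

/-- Linear change of the fibre coordinates: substitution of `z^β = ∑_α (A β α) z'^α`. -/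
noncomputable def changeFrame {n : ℕ} (A : Matrix (Idx n) (Idx n) ℝ) (a : Wick n) : Wick n :=
  fun r => MvPowerSeries.subst
    (fun β => ∑ α, MvPowerSeries.C ((A β α : ℝ) : ℂ) * MvPowerSeries.X α :
      Idx n → MvPowerSeries (Idx n) ℂ) (a r)

/-! ### The Fedosov operators in a coordinate chart

A Wick-algebra-valued form of degree `0`, `1`, `2` on a chart is given by its components `a`, `b α`,
`c α β` with respect to the coordinate coframe: `a`, `∑ b_α du^α`, `(1/2) ∑ c_{αβ} du^α ∧ du^β`
with `c` antisymmetric. No form of higher degree is needed. -/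

/-- The covariant derivative `D_{∂_α} a = ∂a/∂u^α - z^β Γ^γ_{βα} ∂a/∂z^γ`; on forms of degree `0`,
`D a = ∑ (D_{∂_α} a) du^α`. -/
noncomputable def covD {n : ℕ} (L : Coord n → ℝ) (α : Idx n) (a : Coord n → Wick n)
    (w : Coord n) : Wick n := fun r =>
  (fun m => pd α (fun u => MvPowerSeries.coeff m (a u r)) w
      - ∑ β, ∑ γ, ((conn L γ β α w : ℝ) : ℂ) *
          MvPowerSeries.coeff m (MvPowerSeries.X β * MvPowerSeries.pderiv ℂ γ (a w r)) :
    (Idx n →₀ ℕ) → ℂ)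

/-- `D b` for a form `b` of degree `1`. -/
noncomputable def covD₁ {n : ℕ} (L : Coord n → ℝ) (b : Idx n → Coord n → Wick n) (α β : Idx n)
    (w : Coord n) : Wick n :=
  covD L α (b β) w - covD L β (b α) w

/-- `δ a = ∑ (∂a/∂z^α) du^α` for a form `a` of degree `0`. -/
noncomputable def delta {n : ℕ} (α : Idx n) (a : Wick n) : Wick n :=
  fun r => MvPowerSeries.pderiv ℂ α (a r)

/-- `δ⁻¹ b = (1/(p+1)) z^α b_α` for a form `b` of degree `1` and of `deg_s` degree `p`, extended
additively; the monomials of degree `p + 1 = |m|` in `z` receive the factor `1/|m|`. -/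
noncomputable def deltaInv₁ {n : ℕ} (b : Idx n → Wick n) : Wick n := fun r =>
  (fun m => ((m.degree : ℕ) : ℂ)⁻¹ *
      MvPowerSeries.coeff m (∑ α, MvPowerSeries.X α * b α r) : (Idx n →₀ ℕ) → ℂ)

/-- `δ⁻¹ c = (1/(p+2)) z^α c_{αβ} du^β` for a form `c` of degree `2` and of `deg_s` degree `p`,
extended additively; the monomials of degree `p + 1 = |m|` in `z` receive the factor
`1/(|m|+1)`. -/
noncomputable def deltaInv₂ {n : ℕ} (c : Idx n → Idx n → Wick n) (β : Idx n) : Wick n := fun r =>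
  (fun m => ((m.degree + 1 : ℕ) : ℂ)⁻¹ *
      MvPowerSeries.coeff m (∑ α, MvPowerSeries.X α * c α β r) : (Idx n →₀ ℕ) → ℂ)

/-- The product `b ∘ c` of two forms of degree `1`. -/
noncomputable def wickMul₁₁ {n : ℕ} (Λ : Matrix (Idx n) (Idx n) ℂ) (b c : Idx n → Wick n)
    (α β : Idx n) : Wick n :=
  wickMul Λ (b α) (c β) - wickMul Λ (b β) (c α)

/-- `ad_Wick(b)(a) = b ∘ a - a ∘ b` for a form `b` of degree `1` and `a` of degree `0`. -/
noncomputable def adWick {n : ℕ} (Λ : Matrix (Idx n) (Idx n) ℂ) (b : Idx n → Wick n)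
    (a : Wick n) (α : Idx n) : Wick n :=
  wickMul Λ (b α) a - wickMul Λ a (b α)

/-- Components of the torsion operator
`(z^γ/2) θ_{γτ} T^τ_{αβ} du^α ∧ du^β`. -/
noncomputable def torsionForm {n : ℕ} (L : Coord n → ℝ) (α β : Idx n) (w : Coord n) : Wick n :=
  fun r => if r = 0 then
    ∑ γ, ∑ τ, ((symp L w γ τ * torsion L τ α β w : ℝ) : ℂ) • MvPowerSeries.X γ
  else 0

/-- Components of the curvature operator
`(z^γ z^φ/4) θ_{γτ} R^τ_{φαβ} du^α ∧ du^β`. -/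
noncomputable def curvatureForm {n : ℕ} (L : Coord n → ℝ) (α β : Idx n) (w : Coord n) : Wick n :=
  fun r => if r = 0 then
    ∑ γ, ∑ φ, ∑ τ, ((1 / 2 * (symp L w γ τ * curvature L τ φ α β w) : ℝ) : ℂ) •
      (MvPowerSeries.X γ * MvPowerSeries.X φ)
  else 0

/-- The homogeneous components `r^{(k)}` of Fedosov's element `r`, a form of degree `1`:
`r^{(0)} = r^{(1)} = 0`, `r^{(2)} = δ⁻¹ T`, `r^{(3)} = δ⁻¹(R + D r^{(2)} - (i/v) r^{(2)} ∘ r^{(2)})`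
and `r^{(k+3)} = δ⁻¹(D r^{(k+2)} - (i/v) ∑_{l=0}^k r^{(l+2)} ∘ r^{(k-l+2)})` for `k ≥ 1`. -/
noncomputable def rDeg {n : ℕ} (L : Coord n → ℝ) : ℕ → Idx n → Coord n → Wick n
  | 0 => 0
  | 1 => 0
  | 2 => fun β w => deltaInv₂ (fun α α' => torsionForm L α α' w) β
  | k + 3 => fun β w => deltaInv₂ (fun α α' =>
      (if k = 0 then curvatureForm L α α' w else 0)
        + covD₁ L (rDeg L (k + 2)) α α' w
        - Complex.I • divV (∑ l : Fin (k + 1), wickMul₁₁ (wickTensor L w)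
            (fun μ => rDeg L ((l : ℕ) + 2) μ w) (fun μ => rDeg L (k - (l : ℕ) + 2) μ w) α α')) β
  termination_by k => k
  decreasing_by all_goals omega

/-- Fedosov's element `r = ∑_k r^{(k)}`. -/
noncomputable def rTotal {n : ℕ} (L : Coord n → ℝ) (β : Idx n) (w : Coord n) : Wick n := fun p =>
  (fun m => MvPowerSeries.coeff m (rDeg L (2 * p + m.degree) β w p) : (Idx n →₀ ℕ) → ℂ)

/-- The component `α` of `𝒟 a = -δ a + D a - (i/v) ad_Wick(r) a`, for `a` of form degree `0`. -/
noncomputable def fedosovD {n : ℕ} (L : Coord n → ℝ) (a : Coord n → Wick n) (α : Idx n)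
    (w : Coord n) : Wick n :=
  -delta α (a w) + covD L α a w
    - Complex.I • divV (adWick (wickTensor L w) (fun μ => rTotal L μ w) (a w) α)

/-- The right-hand side of the recursion for flat sections:
`δ⁻¹(D a^{(k)} - (i/v) ∑_{l=0}^k ad_Wick(r^{(l+2)})(a^{(k-l)}))`. -/
noncomputable def tauStep {n : ℕ} (L : Coord n → ℝ) (a : Coord n → Wick n) (k : ℕ)
    (w : Coord n) : Wick n :=
  deltaInv₁ fun α => covD L α (fun u => degPart k (a u)) w
    - Complex.I • divV (∑ l ∈ Finset.range (k + 1),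
        adWick (wickTensor L w) (fun μ => rDeg L (l + 2) μ w) (degPart (k - l) (a w)) α)

/-! ### Spaces in Lagrange–Finsler variables -/

/-- The Jacobian matrix of a map of `ℝ^{2n}`. -/
noncomputable def jac {n : ℕ} (f : Coord n → Coord n) (w : Coord n) :
    Matrix (Idx n) (Idx n) ℝ :=
  Matrix.of fun l μ => pd μ f w l

/-- A `2n`-dimensional pseudo-Riemannian manifold in Lagrange–Finsler variables. The charts of the
atlas are coordinates `(x, y)`, each with a smooth regular effective Lagrangian `L(x, y)`, and the
metric, the almost complex structure and the vertical distribution which the Lagrangians define are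
global objects on `V`: in two charts they have the components of the same tensors and the same
distribution. (The horizontal distribution, being the image under `J` of the vertical one, is then
global as well.) -/
structure LagrangeFinslerSpace (n : ℕ) (V : Type*) [TopologicalSpace V]
    [ChartedSpace (Coord n) V] where
  lagr : OpenPartialHomeomorph V (Coord n) → Coord n → ℝ
  smooth : ∀ φ ∈ atlas (Coord n) V, ContDiffOn ℝ ∞ (lagr φ) φ.target
  regular : ∀ φ ∈ atlas (Coord n) V, ∀ w ∈ φ.target, (hess (lagr φ) w).det ≠ 0
  metric_compat : ∀ φ ∈ atlas (Coord n) V, ∀ ψ ∈ atlas (Coord n) V, ∀ u ∈ φ.source ∩ ψ.source,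
    metric (lagr φ) (φ u) = (jac (ψ ∘ φ.symm) (φ u))ᵀ * metric (lagr ψ) (ψ u) *
      jac (ψ ∘ φ.symm) (φ u)
  acs_compat : ∀ φ ∈ atlas (Coord n) V, ∀ ψ ∈ atlas (Coord n) V, ∀ u ∈ φ.source ∩ ψ.source,
    jac (ψ ∘ φ.symm) (φ u) * acs (lagr φ) (φ u) = acs (lagr ψ) (ψ u) * jac (ψ ∘ φ.symm) (φ u)
  vertical_compat : ∀ φ ∈ atlas (Coord n) V, ∀ ψ ∈ atlas (Coord n) V,
    ∀ u ∈ φ.source ∩ ψ.source, ∀ i j : Fin n,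
      jac (ψ ∘ φ.symm) (φ u) (Sum.inl i) (Sum.inr j) = 0

/-- The algebra `C^∞(V)` of smooth complex-valued functions. -/
noncomputable def smoothFunctions (n : ℕ) (V : Type*) [TopologicalSpace V]
    [ChartedSpace (Coord n) V] : Subalgebra ℂ (V → ℂ) where
  carrier := {f | ContMDiff 𝓘(ℝ, Coord n) 𝓘(ℝ, ℂ) ∞ f}
  mul_mem' hf hg := (contDiff_mul (𝕜 := ℝ) (𝔸 := ℂ)).contMDiff.comp (hf.prodMk_space hg)
  add_mem' hf hg := ContMDiff.add hf hg
  algebraMap_mem' _ := contMDiff_const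

/-- The space `C^∞(V)[[v]]`. -/
abbrev FormalFunctions (n : ℕ) (V : Type*) [TopologicalSpace V] [ChartedSpace (Coord n) V] :
    Type _ := PowerSeries (smoothFunctions n V)

/-- The local representative in the chart `φ` of `a : ∀ u, 𝒲_u`. The value `a u` is written in the
fibre coordinates `z` of `T_u V` that are induced by the preferred chart at `u`; the representative
is written in the fibre coordinates that are induced by `φ`. -/
noncomputable def rep {n : ℕ} {V : Type*} [TopologicalSpace V] [ChartedSpace (Coord n) V]
    (φ : OpenPartialHomeomorph V (Coord n)) (a : V → Wick n) (w : Coord n) : Wick n :=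
  changeFrame (jac (chartAt (Coord n) (φ.symm w) ∘ φ.symm) w) (a (φ.symm w))

/-- Smooth sections of the bundle of formal Wick algebras. -/
structure WickSection (n : ℕ) (V : Type*) [TopologicalSpace V] [ChartedSpace (Coord n) V] where
  toFun : V → Wick n
  smooth : ∀ φ ∈ atlas (Coord n) V, ∀ (r : ℕ) (m : Idx n →₀ ℕ),
    ContDiffOn ℝ ∞ (fun w => MvPowerSeries.coeff m (rep φ toFun w r)) φ.target

theorem constantCoeff_changeFrame {n : ℕ} (A : Matrix (Idx n) (Idx n) ℝ) (a : Wick n) (r : ℕ) :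
    MvPowerSeries.constantCoeff (changeFrame A a r) = MvPowerSeries.constantCoeff (a r) := by
  have h0 : ∀ β : Idx n, MvPowerSeries.constantCoeff
      (∑ α, MvPowerSeries.C ((A β α : ℝ) : ℂ) * MvPowerSeries.X α :
        MvPowerSeries (Idx n) ℂ) = 0 := by
    intro β
    simp
  have hs : MvPowerSeries.HasSubst (fun β : Idx n =>
      (∑ α, MvPowerSeries.C ((A β α : ℝ) : ℂ) * MvPowerSeries.X α :
        MvPowerSeries (Idx n) ℂ)) :=
    MvPowerSeries.hasSubst_of_constantCoeff_zero h0
  have hd : a r = MvPowerSeries.C (MvPowerSeries.constantCoeff (a r)) +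
      (a r - MvPowerSeries.C (MvPowerSeries.constantCoeff (a r))) := by ring
  unfold changeFrame
  rw [hd, MvPowerSeries.subst_add hs, MvPowerSeries.subst_C, map_add,
    MvPowerSeries.constantCoeff_subst_eq_zero hs h0 (by simp)]
  simp

/-- The part of `deg_s` degree zero of a section is a formal series of smooth functions. -/
theorem WickSection.contMDiff_degZero {n : ℕ} {V : Type*} [TopologicalSpace V]
    [ChartedSpace (Coord n) V] [IsManifold 𝓘(ℝ, Coord n) ∞ V] (a : WickSection n V) (r : ℕ) :
    ContMDiff 𝓘(ℝ, Coord n) 𝓘(ℝ, ℂ) ∞ fun u => MvPowerSeries.constantCoeff (a.toFun u r) := by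
  intro u
  have h := (a.smooth (chartAt (Coord n) u) (chart_mem_atlas _ u) r 0).contMDiffOn
  have hc := (contMDiffOn_chart (I := 𝓘(ℝ, Coord n)) (n := ∞) (x := u))
  have hcomp := h.comp hc (fun x hx => (chartAt (Coord n) u).map_source hx)
  have hat := hcomp.contMDiffAt
    ((chartAt (Coord n) u).open_source.mem_nhds (mem_chart_source (Coord n) u))
  refine hat.congr_of_eventuallyEq ?_
  filter_upwards [(chartAt (Coord n) u).open_source.mem_nhds (mem_chart_source (Coord n) u)]
    with x hx
  simp only [Function.comp_apply, MvPowerSeries.coeff_zero_eq_constantCoeff, rep,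
    constantCoeff_changeFrame]
  rw [(chartAt (Coord n) u).left_inv hx]

/-- The projection `σ` of a section onto its part of `deg_s` degree zero. -/
noncomputable def sigma {n : ℕ} {V : Type*} [TopologicalSpace V] [ChartedSpace (Coord n) V]
    [IsManifold 𝓘(ℝ, Coord n) ∞ V] (a : WickSection n V) : FormalFunctions n V :=
  PowerSeries.mk fun r => ⟨fun u => MvPowerSeries.constantCoeff (a.toFun u r),
    a.contMDiff_degZero r⟩

/-- The section `a` is flat: `𝒟 a = 0`. -/
def LagrangeFinslerSpace.IsFlat {n : ℕ} {V : Type*} [TopologicalSpace V]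
    [ChartedSpace (Coord n) V] (S : LagrangeFinslerSpace n V) (a : WickSection n V) : Prop :=
  ∀ φ ∈ atlas (Coord n) V, ∀ w ∈ φ.target, ∀ α : Idx n,
    fedosovD (S.lagr φ) (rep φ a.toFun) α w = 0

/-- The space `𝒲_𝒟` of flat sections. -/
abbrev LagrangeFinslerSpace.FlatSection {n : ℕ} {V : Type*} [TopologicalSpace V]
    [ChartedSpace (Coord n) V] (S : LagrangeFinslerSpace n V) : Type _ :=
  {a : WickSection n V // S.IsFlat a}

/-- The Poisson bracket `{f, g} = θ^{αβ} ∂_α f ∂_β g`, in the chart `φ`. -/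
noncomputable def LagrangeFinslerSpace.poisson {n : ℕ} {V : Type*} [TopologicalSpace V]
    [ChartedSpace (Coord n) V] (S : LagrangeFinslerSpace n V)
    (φ : OpenPartialHomeomorph V (Coord n)) (f g : V → ℂ) (w : Coord n) : ℂ :=
  ∑ α, ∑ β, ((sympUp (S.lagr φ) w α β : ℝ) : ℂ) *
    pd α (fun u => f (φ.symm u)) w * pd β (fun u => g (φ.symm u)) w

/-- A star product: an associative product on `C^∞(V)[[v]]` with unit `1`, of the form
`f * g = ∑_r C_r(f, g) v^r` with bilinear operators `C_r` on `C^∞(V)`, extended `v`-linearly and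
`v`-adically continuously, such that `C_0(f, g) = f g` and
`C_1(f, g) - C_1(g, f) = i {f, g}`. -/
structure LagrangeFinslerSpace.IsStarProduct {n : ℕ} {V : Type*} [TopologicalSpace V]
    [ChartedSpace (Coord n) V] (S : LagrangeFinslerSpace n V)
    (star : FormalFunctions n V → FormalFunctions n V → FormalFunctions n V) : Prop where
  assoc : ∀ F G H, star (star F G) H = star F (star G H)
  one_star : ∀ F, star 1 F = F
  star_one : ∀ F, star F 1 = F
  expansion : ∃ B : ℕ → smoothFunctions n V →ₗ[ℂ] smoothFunctions n V →ₗ[ℂ] smoothFunctions n V,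
    (∀ F G k, PowerSeries.coeff k (star F G) = ∑ r ∈ Finset.range (k + 1),
      ∑ p ∈ Finset.HasAntidiagonal.antidiagonal (k - r),
        B r (PowerSeries.coeff p.1 F) (PowerSeries.coeff p.2 G)) ∧
    (∀ f g, B 0 f g = f * g) ∧
    (∀ f g, ∀ φ ∈ atlas (Coord n) V, ∀ w ∈ φ.target,
      (B 1 f g - B 1 g f : smoothFunctions n V).1 (φ.symm w) =
        Complex.I * S.poisson φ f.1 g.1 w)

end LagrangeFedosov

/-!
# Fedosov quantization of Lagrange–Finsler spaces

The proof separates algebra from analysis. Over a commutative `ℂ`-algebra `A` with commuting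
derivations, a `FedosovDatum` consists of a connection, a symmetric and an antisymmetric parallel
tensor, and the inverse of the latter, a closed form. Here Fedosov's construction is carried out
with power series over `A`. The Wick product is associative (`wmul_assoc`) because the two
bracketings have the same binomial expansion. Its commutators with the torsion and the curvature
operator are the commutators of `δ` and `D` (`I_smul_br_t`, `I_smul_br_ρ`), and an element without
part of `deg_s`-degree zero is determined by its commutators, so that the Bianchi identities follow
from the Jacobi identity. The element `r` is the unique solution of Fedosov's fixed point equation
(`num_r`, `r_unique`). The Weyl curvature of `𝒟` is annihilated by `δ⁻¹` and satisfies a Bianchi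
identity, and `δ⁻¹` raises the total degree; the homotopy formula for `δ`, `δ⁻¹` then shows that it
vanishes (`weylCurv_eq_zero`). The same argument shows that the recursion for `τ` yields flat
elements (`isFlat_τ`), and that flat elements are determined by their part of `deg_s`-degree zero
(`IsFlat.ext`). Flat elements form a subalgebra, which is transported to formal functions; the
first-order term of the commutator is the Poisson bracket (`star_sub_star`).

A regular Lagrangian defines such a datum (`LagrangeDatum.toFedosovDatum`): the normal
d-connection is metric and commutes with the almost complex structure, and `θ` is the differential
of `(1/2) ∂L/∂y^i dx^i` (`θ_eq`). A change of coordinates which preserves the metric, the almost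
complex structure and the vertical distribution relates the adapted frames by a block diagonal
matrix with two equal blocks (`LagrangeDatum.Change.Q_eq`), so that it also preserves the normal
d-connection (`LagrangeDatum.Change.Γ_law`). The pullback of `r` solves the equation which
determines `r` (`FedosovDatum.Change.r_law`), and therefore flat elements are mapped to flat
elements.

On a chart, `A` is the algebra `SF U` of smooth functions, and evaluation at a point turns the
algebraic objects into the given ones (`IsRegularOn.evW_fD`). Two flat elements over two charts
which come from the same formal function on `V` agree on the overlap, by uniqueness
(`LagrangeFinslerSpace.evW_chartτ`). Hence they define a global flat section, and the products of
flat elements in the charts define a global star product.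
-/

set_option linter.unusedSectionVars false


namespace LagrangeFedosov

open Finset

/-! ### Iterated contractions and the Wick product -/

section WickAlgebra

variable {ι A : Type*} [Fintype ι] [DecidableEq ι] [CommRing A] [Algebra ℂ A]

/-- The bidifferential operator
`f ⊗ g ↦ Λ^{α₁β₁} ⋯ Λ^{α_kβ_k} (∂_{α₁} ⋯ ∂_{α_k} f) (∂_{β₁} ⋯ ∂_{β_k} g)` on power series over an arbitrary commutative ring of coefficients. -/
noncomputable def bidiff (Λ : Matrix ι ι A) :
    ℕ → MvPowerSeries ι A →ₗ[A] MvPowerSeries ι A →ₗ[A] MvPowerSeries ι A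
  | 0 => LinearMap.mul A (MvPowerSeries ι A)
  | k + 1 => ∑ α, ∑ β, Λ α β • (bidiff Λ k).compl₁₂
      (MvPowerSeries.pderiv A α).toLinearMap (MvPowerSeries.pderiv A β).toLinearMap

@[simp] theorem bidiff_zero (Λ : Matrix ι ι A) (f g : MvPowerSeries ι A) :
    bidiff Λ 0 f g = f * g := rfl

theorem bidiff_succ (Λ : Matrix ι ι A) (k : ℕ) (f g : MvPowerSeries ι A) :
    bidiff Λ (k + 1) f g = ∑ α, ∑ β,
      Λ α β • bidiff Λ k (MvPowerSeries.pderiv A α f) (MvPowerSeries.pderiv A β g) := by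
  simp [bidiff, LinearMap.sum_apply]

theorem contract_eq_bidiff {n : ℕ} (Λ : Matrix (Idx n) (Idx n) ℂ) (k : ℕ) :
    ∀ f g, contract Λ k f g = bidiff Λ k f g := by
  induction k with
  | zero => intro f g; rfl
  | succ k ih => intro f g; simp only [contract, bidiff_succ, ih]

theorem pderiv_pderiv_comm {R : Type*} [CommRing R] (α β : ι) (f : MvPowerSeries ι R) :
    MvPowerSeries.pderiv R α (MvPowerSeries.pderiv R β f) =
      MvPowerSeries.pderiv R β (MvPowerSeries.pderiv R α f) := by
  by_cases h : α = β
  · rw [h]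
  ext m
  simp only [MvPowerSeries.coeff_pderiv, Finsupp.add_apply]
  rw [add_right_comm, Finsupp.single_eq_of_ne h, Finsupp.single_eq_of_ne (Ne.symm h)]
  push_cast
  ring

theorem pderiv_bidiff (Λ : Matrix ι ι A) (γ : ι) (k : ℕ) : ∀ f g : MvPowerSeries ι A,
    MvPowerSeries.pderiv A γ (bidiff Λ k f g) =
      bidiff Λ k (MvPowerSeries.pderiv A γ f) g + bidiff Λ k f (MvPowerSeries.pderiv A γ g) := by
  induction k with
  | zero =>
    intro f g
    simp only [bidiff_zero, Derivation.leibniz, smul_eq_mul]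
    ring
  | succ k ih =>
    intro f g
    simp only [bidiff_succ, map_sum, Derivation.map_smul, ih, smul_add, sum_add_distrib,
      pderiv_pderiv_comm γ]

/-- The trilinear analogue of `bidiff`, in which each pair of the three arguments is contracted. -/
noncomputable def tridiff (Λ : Matrix ι ι A) :
    ℕ → MvPowerSeries ι A → MvPowerSeries ι A → MvPowerSeries ι A → MvPowerSeries ι A
  | 0, f, g, h => f * g * h
  | k + 1, f, g, h => ∑ α, ∑ β, Λ α β •
      (tridiff Λ k (MvPowerSeries.pderiv A α f) (MvPowerSeries.pderiv A β g) h
        + tridiff Λ k (MvPowerSeries.pderiv A α f) g (MvPowerSeries.pderiv A β h)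
        + tridiff Λ k f (MvPowerSeries.pderiv A α g) (MvPowerSeries.pderiv A β h))

theorem sum_nsmul_sum_smul_comm (Λ : Matrix ι ι A) (s : Finset (ℕ × ℕ)) (c : ℕ × ℕ → ℕ)
    (F : ℕ × ℕ → ι → ι → MvPowerSeries ι A) :
    ∑ x ∈ s, c x • ∑ α, ∑ β, Λ α β • F x α β =
      ∑ α, ∑ β, Λ α β • ∑ x ∈ s, c x • F x α β := by
  simp only [smul_sum]
  rw [sum_comm]
  refine sum_congr rfl fun α _ => ?_
  rw [sum_comm]
  refine sum_congr rfl fun β _ => sum_congr rfl fun x _ => smul_comm _ _ _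

/-- By the Leibniz rule, the contractions with a product distribute over its two factors; the
binomial coefficients count the orders in which the contractions are performed. -/
theorem bidiff_bidiff_left (Λ : Matrix ι ι A) (m : ℕ) : ∀ f g h : MvPowerSeries ι A,
    ∑ x ∈ antidiagonal m, m.choose x.1 • bidiff Λ x.2 (bidiff Λ x.1 f g) h =
      tridiff Λ m f g h := by
  induction m with
  | zero => intro f g h; simp [tridiff]
  | succ m ih =>
    intro f g h
    rw [sum_antidiagonal_choose_succ_nsmul (fun i j => bidiff Λ j (bidiff Λ i f g) h)]
    have e : ∑ x ∈ antidiagonal m, m.choose x.2 • bidiff Λ x.2 (bidiff Λ (x.1 + 1) f g) h =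
        ∑ x ∈ antidiagonal m, m.choose x.1 • bidiff Λ x.2 (bidiff Λ (x.1 + 1) f g) h :=
      sum_congr rfl fun x hx => by
        rw [Nat.choose_symm_of_eq_add (HasAntidiagonal.mem_antidiagonal.1 hx).symm]
    rw [e]
    simp only [tridiff, ← ih, bidiff_succ, pderiv_bidiff, map_add, map_sum, map_smul,
      LinearMap.add_apply, LinearMap.sum_apply, LinearMap.smul_apply, smul_add, sum_add_distrib]
    simp only [sum_nsmul_sum_smul_comm]
    abel

/-- The other bracketing of three arguments has the same expansion as `bidiff_bidiff_left`. -/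
theorem bidiff_bidiff_right (Λ : Matrix ι ι A) (m : ℕ) : ∀ f g h : MvPowerSeries ι A,
    ∑ x ∈ antidiagonal m, m.choose x.1 • bidiff Λ x.2 f (bidiff Λ x.1 g h) =
      tridiff Λ m f g h := by
  induction m with
  | zero => intro f g h; simp [tridiff, mul_assoc]
  | succ m ih =>
    intro f g h
    rw [sum_antidiagonal_choose_succ_nsmul (fun i j => bidiff Λ j f (bidiff Λ i g h))]
    have e : ∑ x ∈ antidiagonal m, m.choose x.2 • bidiff Λ x.2 f (bidiff Λ (x.1 + 1) g h) =
        ∑ x ∈ antidiagonal m, m.choose x.1 • bidiff Λ x.2 f (bidiff Λ (x.1 + 1) g h) :=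
      sum_congr rfl fun x hx => by
        rw [Nat.choose_symm_of_eq_add (HasAntidiagonal.mem_antidiagonal.1 hx).symm]
    rw [e]
    simp only [tridiff, ← ih, bidiff_succ, pderiv_bidiff, map_add, map_sum, map_smul, smul_add,
      sum_add_distrib]
    simp only [sum_nsmul_sum_smul_comm]

/-- The coefficient of `v^k` in `exp (i v / 2)`. -/
noncomputable def expCoeff (k : ℕ) : ℂ := (Complex.I / 2) ^ k / (k.factorial : ℂ)

theorem expCoeff_mul (i j : ℕ) :
    expCoeff i * expCoeff j = expCoeff (i + j) * ((i + j).choose i : ℂ) := by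
  have h := Nat.add_choose_mul_factorial_mul_factorial i j
  rw [← Nat.choose_symm_add] at h
  have h' : (((i + j).choose i : ℂ)) * i.factorial * j.factorial = (i + j).factorial := by
    exact_mod_cast h
  have hi : (i.factorial : ℂ) ≠ 0 := by exact_mod_cast i.factorial_ne_zero
  have hj : (j.factorial : ℂ) ≠ 0 := by exact_mod_cast j.factorial_ne_zero
  have hij : ((i + j).factorial : ℂ) ≠ 0 := by exact_mod_cast (i + j).factorial_ne_zero
  unfold expCoeff
  rw [pow_add]
  field_simp
  rw [← h']
  ring

/-- The formal Wick product over an arbitrary ring of coefficients. -/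
noncomputable def wmul (Λ : Matrix ι ι A) (a b : ℕ → MvPowerSeries ι A) :
    ℕ → MvPowerSeries ι A := fun r =>
  ∑ x ∈ antidiagonal r, expCoeff x.1 • ∑ p ∈ antidiagonal x.2, bidiff Λ x.1 (a p.1) (b p.2)

theorem wickMul_eq_wmul {n : ℕ} (Λ : Matrix (Idx n) (Idx n) ℂ) (a b : Wick n) :
    wickMul Λ a b = wmul Λ a b := by
  funext r
  simp only [wickMul, wmul, contract_eq_bidiff, expCoeff]
  rw [Nat.sum_antidiagonal_eq_sum_range_succ_mk]

theorem sum_antidiagonal_assoc {X : Type*} [AddCommMonoid X] (F : ℕ → ℕ → ℕ → X) (r : ℕ) :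
    ∑ x ∈ antidiagonal r, ∑ y ∈ antidiagonal x.2, F x.1 y.1 y.2 =
      ∑ x ∈ antidiagonal r, ∑ y ∈ antidiagonal x.1, F y.1 y.2 x.2 := by
  rw [sum_sigma', sum_sigma']
  refine sum_nbij' (fun x => ⟨(x.1.1 + x.2.1, x.2.2), (x.1.1, x.2.1)⟩)
    (fun x => ⟨(x.2.1, x.2.2 + x.1.2), (x.2.2, x.1.2)⟩) ?_ ?_ ?_ ?_ ?_
  all_goals
    rintro ⟨⟨a, b⟩, ⟨c, d⟩⟩ h
    simp only [mem_sigma, HasAntidiagonal.mem_antidiagonal] at h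
    obtain ⟨rfl, rfl⟩ := h
    simp [add_assoc]

end WickAlgebra
end LagrangeFedosov

namespace LagrangeFedosov

open Finset

/-! ### The Wick algebra over a ring of coefficients -/

section WickAlgebra

variable {ι A : Type*} [Fintype ι] [DecidableEq ι] [CommRing A] [Algebra ℂ A]

/-- Reindexing of the sums in `(a ∘ b) ∘ c`: the orders of the two contractions are collected in
the first index, so that the binomial expansion applies to the innermost sum. -/
theorem sum_antidiagonal_five_left {X : Type*} [AddCommMonoid X] (F : ℕ → ℕ → ℕ → ℕ → ℕ → X)
    (r : ℕ) :
    ∑ x ∈ antidiagonal r, ∑ p ∈ antidiagonal x.2, ∑ y ∈ antidiagonal p.1,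
        ∑ q ∈ antidiagonal y.2, F x.1 y.1 q.1 q.2 p.2 =
      ∑ x ∈ antidiagonal r, ∑ p ∈ antidiagonal x.2, ∑ q ∈ antidiagonal p.2,
        ∑ y ∈ antidiagonal x.1, F y.2 y.1 p.1 q.1 q.2 := by
  simp only [sum_sigma']
  refine sum_nbij'
    (fun z => ⟨(z.2.2.1.1 + z.1.1, z.2.2.2.1 + (z.2.2.2.2 + z.2.1.2)),
      (z.2.2.2.1, z.2.2.2.2 + z.2.1.2), (z.2.2.2.2, z.2.1.2), (z.2.2.1.1, z.1.1)⟩)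
    (fun z => ⟨(z.2.2.2.2, z.2.2.2.1 + (z.2.1.1 + z.2.2.1.1) + z.2.2.1.2),
      (z.2.2.2.1 + (z.2.1.1 + z.2.2.1.1), z.2.2.1.2), (z.2.2.2.1, z.2.1.1 + z.2.2.1.1),
      (z.2.1.1, z.2.2.1.1)⟩) ?_ ?_ ?_ ?_ ?_
  all_goals
    rintro ⟨⟨a, b⟩, ⟨c, d⟩, ⟨e, f⟩, ⟨g, h⟩⟩ H
    simp only [mem_sigma, HasAntidiagonal.mem_antidiagonal] at H
    obtain ⟨rfl, rfl, rfl, rfl⟩ := H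
    simp [add_comm, add_left_comm]

/-- The reindexing which corresponds to `sum_antidiagonal_five_left` for `a ∘ (b ∘ c)`. -/
theorem sum_antidiagonal_five_right {X : Type*} [AddCommMonoid X] (F : ℕ → ℕ → ℕ → ℕ → ℕ → X)
    (r : ℕ) :
    ∑ x ∈ antidiagonal r, ∑ p ∈ antidiagonal x.2, ∑ y ∈ antidiagonal p.2,
        ∑ q ∈ antidiagonal y.2, F x.1 y.1 p.1 q.1 q.2 =
      ∑ x ∈ antidiagonal r, ∑ p ∈ antidiagonal x.2, ∑ q ∈ antidiagonal p.2,
        ∑ y ∈ antidiagonal x.1, F y.2 y.1 p.1 q.1 q.2 := by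
  simp only [sum_sigma']
  refine sum_nbij'
    (fun z => ⟨(z.2.2.1.1 + z.1.1, z.2.1.1 + (z.2.2.2.1 + z.2.2.2.2)),
      (z.2.1.1, z.2.2.2.1 + z.2.2.2.2), (z.2.2.2.1, z.2.2.2.2), (z.2.2.1.1, z.1.1)⟩)
    (fun z => ⟨(z.2.2.2.2, z.2.1.1 + (z.2.2.2.1 + (z.2.2.1.1 + z.2.2.1.2))),
      (z.2.1.1, z.2.2.2.1 + (z.2.2.1.1 + z.2.2.1.2)), (z.2.2.2.1, z.2.2.1.1 + z.2.2.1.2),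
      (z.2.2.1.1, z.2.2.1.2)⟩) ?_ ?_ ?_ ?_ ?_
  all_goals
    rintro ⟨⟨a, b⟩, ⟨c, d⟩, ⟨e, f⟩, ⟨g, h⟩⟩ H
    simp only [mem_sigma, HasAntidiagonal.mem_antidiagonal] at H
    obtain ⟨rfl, rfl, rfl, rfl⟩ := H
    simp [add_comm, add_left_comm]

theorem bidiff_smul_left (Λ : Matrix ι ι A) (k : ℕ) (c : ℂ) (f g : MvPowerSeries ι A) :
    bidiff Λ k (c • f) g = c • bidiff Λ k f g := by
  rw [← algebraMap_smul A c f, map_smul, LinearMap.smul_apply, algebraMap_smul]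

theorem bidiff_smul_right (Λ : Matrix ι ι A) (k : ℕ) (c : ℂ) (f g : MvPowerSeries ι A) :
    bidiff Λ k f (c • g) = c • bidiff Λ k f g := by
  rw [← algebraMap_smul A c g, map_smul, algebraMap_smul]

theorem sum_expCoeff_mul_smul (m : ℕ) (F : ℕ → ℕ → MvPowerSeries ι A) :
    ∑ y ∈ antidiagonal m, (expCoeff y.2 * expCoeff y.1) • F y.1 y.2 =
      expCoeff m • ∑ y ∈ antidiagonal m, m.choose y.1 • F y.1 y.2 := by
  rw [smul_sum]
  refine sum_congr rfl fun y hy => ?_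
  rw [mul_comm, expCoeff_mul, HasAntidiagonal.mem_antidiagonal.1 hy, mul_smul,
    Nat.cast_smul_eq_nsmul]

theorem wmul_assoc (Λ : Matrix ι ι A) (a b c : ℕ → MvPowerSeries ι A) :
    wmul Λ (wmul Λ a b) c = wmul Λ a (wmul Λ b c) := by
  funext r
  have h1 : wmul Λ (wmul Λ a b) c r = ∑ x ∈ antidiagonal r, ∑ p ∈ antidiagonal x.2,
      ∑ y ∈ antidiagonal p.1, ∑ q ∈ antidiagonal y.2,
        (expCoeff x.1 * expCoeff y.1) • bidiff Λ x.1 (bidiff Λ y.1 (a q.1) (b q.2)) (c p.2) := by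
    simp only [wmul, map_sum, bidiff_smul_left, LinearMap.sum_apply, smul_sum, mul_smul]
  have h2 : wmul Λ a (wmul Λ b c) r = ∑ x ∈ antidiagonal r, ∑ p ∈ antidiagonal x.2,
      ∑ y ∈ antidiagonal p.2, ∑ q ∈ antidiagonal y.2,
        (expCoeff x.1 * expCoeff y.1) • bidiff Λ x.1 (a p.1) (bidiff Λ y.1 (b q.1) (c q.2)) := by
    simp only [wmul, map_sum, bidiff_smul_right, smul_sum, mul_smul]
  rw [h1, h2, sum_antidiagonal_five_left (fun k j p q s =>
      (expCoeff k * expCoeff j) • bidiff Λ k (bidiff Λ j (a p) (b q)) (c s)),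
    sum_antidiagonal_five_right (fun k j p q s =>
      (expCoeff k * expCoeff j) • bidiff Λ k (a p) (bidiff Λ j (b q) (c s)))]
  refine sum_congr rfl fun x _ => sum_congr rfl fun p _ => sum_congr rfl fun q _ => ?_
  rw [sum_expCoeff_mul_smul x.1 (fun i j => bidiff Λ j (bidiff Λ i (a p.1) (b q.1)) (c q.2)),
    sum_expCoeff_mul_smul x.1 (fun i j => bidiff Λ j (a p.1) (bidiff Λ i (b q.1) (c q.2))),
    bidiff_bidiff_left, bidiff_bidiff_right]

/-- The algebra of formal series `∑ a_{r,m} z^m v^r` with coefficients in `A`, with the formal Wick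
product of the tensor `Λ`. As in `Wick`, `a r` is the coefficient of `v^r`. -/
def WickAlg (_Λ : Matrix ι ι A) : Type _ := ℕ → MvPowerSeries ι A

namespace WickAlg

variable {Λ : Matrix ι ι A}

noncomputable instance : AddCommGroup (WickAlg Λ) :=
  inferInstanceAs (AddCommGroup (ℕ → MvPowerSeries ι A))
noncomputable instance : Module A (WickAlg Λ) :=
  inferInstanceAs (Module A (ℕ → MvPowerSeries ι A))
noncomputable instance : Module ℂ (WickAlg Λ) :=
  inferInstanceAs (Module ℂ (ℕ → MvPowerSeries ι A))
instance : IsScalarTower ℂ A (WickAlg Λ) :=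
  inferInstanceAs (IsScalarTower ℂ A (ℕ → MvPowerSeries ι A))

@[ext] theorem ext {a b : WickAlg Λ} (h : ∀ r m, MvPowerSeries.coeff m (a r) =
    MvPowerSeries.coeff m (b r)) : a = b :=
  funext fun r => MvPowerSeries.ext (h r)

theorem ext_v {a b : WickAlg Λ} (h : ∀ r, a r = b r) : a = b := funext h

@[simp] theorem val_zero (r : ℕ) : (0 : WickAlg Λ) r = 0 := rfl
@[simp] theorem val_add (a b : WickAlg Λ) (r : ℕ) : (a + b) r = a r + b r := rfl
@[simp] theorem val_sub (a b : WickAlg Λ) (r : ℕ) : (a - b) r = a r - b r := rfl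
@[simp] theorem val_neg (a : WickAlg Λ) (r : ℕ) : (-a) r = -a r := rfl
@[simp] theorem val_smul (c : A) (a : WickAlg Λ) (r : ℕ) : (c • a) r = c • a r := rfl
@[simp] theorem val_csmul (c : ℂ) (a : WickAlg Λ) (r : ℕ) : (c • a) r = c • a r := rfl
@[simp] theorem val_sum {κ : Type*} (s : Finset κ) (a : κ → WickAlg Λ) (r : ℕ) :
    (∑ k ∈ s, a k) r = ∑ k ∈ s, a k r :=
  Finset.sum_apply r s a

noncomputable instance : Mul (WickAlg Λ) := ⟨wmul Λ⟩
noncomputable instance : One (WickAlg Λ) := ⟨fun r => if r = 0 then 1 else 0⟩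

theorem one_apply (r : ℕ) : (1 : WickAlg Λ) r = if r = 0 then 1 else 0 := rfl

theorem mul_apply (a b : WickAlg Λ) (r : ℕ) : (a * b) r =
    ∑ x ∈ antidiagonal r, expCoeff x.1 • ∑ p ∈ antidiagonal x.2, bidiff Λ x.1 (a p.1) (b p.2) :=
  rfl

theorem bidiff_C_left (c : A) (k : ℕ) (g : MvPowerSeries ι A) :
    bidiff Λ k (MvPowerSeries.C c) g = if k = 0 then c • g else 0 := by
  cases k with
  | zero => simp [MvPowerSeries.smul_eq_C_mul]
  | succ k => simp [bidiff_succ]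

theorem bidiff_C_right (c : A) (k : ℕ) (f : MvPowerSeries ι A) :
    bidiff Λ k f (MvPowerSeries.C c) = if k = 0 then c • f else 0 := by
  cases k with
  | zero => simp [MvPowerSeries.smul_eq_C_mul, mul_comm]
  | succ k => simp [bidiff_succ]

theorem bidiff_one_left (k : ℕ) (g : MvPowerSeries ι A) :
    bidiff Λ k 1 g = if k = 0 then g else 0 := by
  simpa using bidiff_C_left (Λ := Λ) 1 k g

theorem bidiff_one_right (k : ℕ) (f : MvPowerSeries ι A) :
    bidiff Λ k f 1 = if k = 0 then f else 0 := by
  simpa using bidiff_C_right (Λ := Λ) 1 k f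

@[simp] theorem expCoeff_zero : expCoeff 0 = 1 := by simp [expCoeff]

theorem expCoeff_one : expCoeff 1 = Complex.I / 2 := by simp [expCoeff]

/-- The Wick product of a series that is concentrated in `v`-degree `0`. -/
theorem wmul_of_left {f : MvPowerSeries ι A} {a b : WickAlg Λ}
    (ha : ∀ r, a r = if r = 0 then f else 0) (r : ℕ) :
    (a * b) r = ∑ x ∈ antidiagonal r, expCoeff x.1 • bidiff Λ x.1 f (b x.2) := by
  rw [mul_apply]
  refine sum_congr rfl fun x _ => ?_
  rw [sum_eq_single (0, x.2)]
  · simp [ha]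
  · rintro ⟨p, q⟩ h hne
    have : p ≠ 0 := by
      rintro rfl
      exact hne (by simpa using h)
    simp [ha, this]
  · simp

theorem wmul_of_right {f : MvPowerSeries ι A} {a b : WickAlg Λ}
    (ha : ∀ r, a r = if r = 0 then f else 0) (r : ℕ) :
    (b * a) r = ∑ x ∈ antidiagonal r, expCoeff x.1 • bidiff Λ x.1 (b x.2) f := by
  rw [mul_apply]
  refine sum_congr rfl fun x _ => ?_
  rw [sum_eq_single (x.2, 0)]
  · simp [ha]
  · rintro ⟨p, q⟩ h hne
    have : q ≠ 0 := by
      rintro rfl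
      exact hne (by simpa using h)
    simp [ha, this]
  · simp

noncomputable instance : Ring (WickAlg Λ) :=
  { (inferInstance : AddCommGroup (WickAlg Λ)), (inferInstance : Mul (WickAlg Λ)),
    (inferInstance : One (WickAlg Λ)) with
    left_distrib := fun a b c => by
      refine ext_v fun r => ?_
      simp only [mul_apply, val_add, map_add, sum_add_distrib, smul_add]
    right_distrib := fun a b c => by
      refine ext_v fun r => ?_
      simp only [mul_apply, val_add, map_add, LinearMap.add_apply, sum_add_distrib, smul_add]
    zero_mul := fun a => by
      refine ext_v fun r => ?_
      simp [mul_apply]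
    mul_zero := fun a => by
      refine ext_v fun r => ?_
      simp [mul_apply]
    mul_assoc := fun a b c => wmul_assoc Λ a b c
    one_mul := fun a => by
      refine ext_v fun r => ?_
      rw [wmul_of_left (f := 1) one_apply, sum_eq_single (0, r)]
      · simp
      · rintro ⟨p, q⟩ h hne
        have : p ≠ 0 := by
          rintro rfl
          exact hne (by simpa using h)
        simp [bidiff_one_left, this]
      · simp
    mul_one := fun a => by
      refine ext_v fun r => ?_
      rw [wmul_of_right (f := 1) one_apply, sum_eq_single (0, r)]
      · simp
      · rintro ⟨p, q⟩ h hne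
        have : p ≠ 0 := by
          rintro rfl
          exact hne (by simpa using h)
        simp [bidiff_one_right, this]
      · simp
    -- the multiples are those of the additive group, as for functions
    zsmul := fun n a => n • a
    zsmul_zero' := fun a => zero_smul ℤ a
    zsmul_succ' := fun n a => SubNegMonoid.zsmul_succ' n a
    zsmul_neg' := fun n a => SubNegMonoid.zsmul_neg' n a
    nsmul := fun n a => n • a
    nsmul_zero := fun a => zero_smul ℕ a
    nsmul_succ := fun n a => AddMonoid.nsmul_succ n a }

instance : IsScalarTower A (WickAlg Λ) (WickAlg Λ) :=
  ⟨fun c a b => by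
    refine ext_v fun r => ?_
    simp only [smul_eq_mul, mul_apply, val_smul, map_smul, LinearMap.smul_apply, smul_sum]
    simp only [smul_comm c]⟩

instance : SMulCommClass A (WickAlg Λ) (WickAlg Λ) :=
  ⟨fun c a b => by
    refine ext_v fun r => ?_
    simp only [smul_eq_mul, mul_apply, val_smul, map_smul, smul_sum]
    simp only [smul_comm c]⟩

instance : IsScalarTower ℂ (WickAlg Λ) (WickAlg Λ) :=
  ⟨fun c a b => by
    rw [← algebraMap_smul A c a, ← algebraMap_smul A c, smul_assoc]⟩

instance : SMulCommClass ℂ (WickAlg Λ) (WickAlg Λ) :=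
  ⟨fun c a b => by
    rw [← algebraMap_smul A c b, ← algebraMap_smul A c, smul_comm]⟩

end WickAlg
end WickAlgebra
end LagrangeFedosov

namespace LagrangeFedosov

open Finset

/-! ### Covariant derivatives of power series in the fibre coordinates -/

section PowerSeriesOperators

variable {ι A : Type*} [Fintype ι] [DecidableEq ι] [CommRing A] [Algebra ℂ A]

theorem coeff_csmul (c : ℂ) (m : ι →₀ ℕ) (f : MvPowerSeries ι A) :
    MvPowerSeries.coeff m (c • f) = c • MvPowerSeries.coeff m f := rfl

theorem pderiv_csmul (c : ℂ) (α : ι) (f : MvPowerSeries ι A) :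
    MvPowerSeries.pderiv A α (c • f) = c • MvPowerSeries.pderiv A α f := by
  rw [← algebraMap_smul A c f, Derivation.map_smul, algebraMap_smul]

theorem coeff_X_mul (α : ι) (m : ι →₀ ℕ) (f : MvPowerSeries ι A) :
    MvPowerSeries.coeff m (MvPowerSeries.X α * f) =
      if m α = 0 then 0 else MvPowerSeries.coeff (m - Finsupp.single α 1) f := by
  rw [MvPowerSeries.X, MvPowerSeries.coeff_monomial_mul]
  simp only [Finsupp.single_le_iff, one_mul]
  by_cases h : m α = 0
  · simp [h]
  · rw [if_pos (Nat.one_le_iff_ne_zero.2 h), if_neg h]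

theorem coeff_X_mul_pderiv_self (α : ι) (m : ι →₀ ℕ) (f : MvPowerSeries ι A) :
    MvPowerSeries.coeff m (MvPowerSeries.X α * MvPowerSeries.pderiv A α f) =
      (m α : A) * MvPowerSeries.coeff m f := by
  rw [coeff_X_mul]
  split_ifs with h
  · simp [h]
  · have h1 : Finsupp.single α 1 ≤ m := by
      rw [Finsupp.single_le_iff]; exact Nat.one_le_iff_ne_zero.2 h
    rw [MvPowerSeries.coeff_pderiv, tsub_add_cancel_of_le h1, mul_comm]
    congr 1
    rw [Finsupp.coe_tsub, Pi.sub_apply, Finsupp.single_eq_same]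
    have : m α = (m α - 1) + 1 := by omega
    rw [this]
    push_cast
    simp

/-- A derivation of the ring of coefficients, applied to each coefficient. -/
noncomputable def coeffDer (d : Derivation ℂ A A) :
    Derivation ℂ (MvPowerSeries ι A) (MvPowerSeries ι A) :=
  Derivation.mk'
    { toFun := fun f => (fun m => d (MvPowerSeries.coeff m f) : (ι →₀ ℕ) → A)
      map_add' := fun f g => by
        funext m
        exact map_add d _ _
      map_smul' := fun c f => by
        funext m
        exact d.map_smul c _ }
    (fun f g => by
      refine MvPowerSeries.ext fun m => ?_
      change d (MvPowerSeries.coeff m (f * g)) = _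
      rw [MvPowerSeries.coeff_mul, map_sum, smul_eq_mul, smul_eq_mul, mul_comm g, map_add,
        MvPowerSeries.coeff_mul, MvPowerSeries.coeff_mul, ← sum_add_distrib]
      refine sum_congr rfl fun x _ => ?_
      rw [Derivation.leibniz, smul_eq_mul, smul_eq_mul, mul_comm (MvPowerSeries.coeff x.2 g)]
      rfl)

theorem coeff_coeffDer (d : Derivation ℂ A A) (m : ι →₀ ℕ) (f : MvPowerSeries ι A) :
    MvPowerSeries.coeff m (coeffDer d f) = d (MvPowerSeries.coeff m f) := rfl

theorem coeffDer_C (d : Derivation ℂ A A) (c : A) :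
    coeffDer d (MvPowerSeries.C c : MvPowerSeries ι A) = MvPowerSeries.C (d c) := by
  refine MvPowerSeries.ext fun m => ?_
  rw [coeff_coeffDer, MvPowerSeries.coeff_C, MvPowerSeries.coeff_C]
  split_ifs <;> simp

theorem coeffDer_X (d : Derivation ℂ A A) (α : ι) :
    coeffDer d (MvPowerSeries.X α : MvPowerSeries ι A) = 0 := by
  refine MvPowerSeries.ext fun m => ?_
  rw [coeff_coeffDer, MvPowerSeries.coeff_X]
  split_ifs <;> simp

theorem coeffDer_smul (d : Derivation ℂ A A) (c : A) (f : MvPowerSeries ι A) :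
    coeffDer d (c • f) = d c • f + c • coeffDer d f := by
  rw [MvPowerSeries.smul_eq_C_mul, Derivation.leibniz, coeffDer_C]
  simp only [smul_eq_mul, MvPowerSeries.smul_eq_C_mul]
  ring

theorem coeffDer_pderiv (d : Derivation ℂ A A) (α : ι) (f : MvPowerSeries ι A) :
    coeffDer d (MvPowerSeries.pderiv A α f) = MvPowerSeries.pderiv A α (coeffDer d f) := by
  refine MvPowerSeries.ext fun m => ?_
  simp only [coeff_coeffDer, MvPowerSeries.coeff_pderiv, Derivation.leibniz, smul_eq_mul]
  have : d ((m α : A) + 1) = 0 := by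
    rw [map_add, Derivation.map_natCast, Derivation.map_one_eq_zero, add_zero]
  rw [this, mul_zero, zero_add, mul_comm]

theorem coeffDer_comm {d d' : Derivation ℂ A A} (h : ∀ a, d (d' a) = d' (d a))
    (f : MvPowerSeries ι A) : coeffDer d (coeffDer d' f) = coeffDer d' (coeffDer d f) :=
  MvPowerSeries.ext fun _ => h _

/-- The linear form `∑ β, G γ β z^β`. -/
noncomputable def rowForm (G : Matrix ι ι A) (γ : ι) : MvPowerSeries ι A :=
  ∑ β, G γ β • MvPowerSeries.X β

/-- The linear vector field `∑ G γ β z^β ∂/∂z^γ`. -/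
noncomputable def linField (G : Matrix ι ι A) :
    Derivation A (MvPowerSeries ι A) (MvPowerSeries ι A) :=
  ∑ γ, rowForm G γ • MvPowerSeries.pderiv A γ

theorem linField_apply (G : Matrix ι ι A) (f : MvPowerSeries ι A) :
    linField G f = ∑ γ, rowForm G γ * MvPowerSeries.pderiv A γ f := by
  change Derivation.coeFnAddMonoidHom (linField G) f = _
  rw [linField, map_sum, Finset.sum_apply]
  rfl

theorem pderiv_rowForm (G : Matrix ι ι A) (γ μ : ι) :
    MvPowerSeries.pderiv A μ (rowForm G γ) = MvPowerSeries.C (G γ μ) := by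
  simp only [rowForm, map_sum, Derivation.map_smul, MvPowerSeries.pderiv_X]
  rw [sum_eq_single μ]
  · simp [MvPowerSeries.smul_eq_C_mul]
  · intro b _ hb
    simp [Pi.single_eq_of_ne hb]
  · simp

theorem linField_X (G : Matrix ι ι A) (τ : ι) :
    linField G (MvPowerSeries.X τ) = rowForm G τ := by
  rw [linField_apply, sum_eq_single τ]
  · simp
  · intro b _ hb
    rw [MvPowerSeries.pderiv_X_of_ne hb.symm, mul_zero]
  · simp

theorem linField_rowForm (G G' : Matrix ι ι A) (δ : ι) :
    linField G (rowForm G' δ) = rowForm (G' * G) δ := by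
  simp only [rowForm, map_sum, Derivation.map_smul, linField_X, Matrix.mul_apply, sum_smul,
    smul_sum, mul_smul]
  exact sum_comm

theorem linField_linField (G G' : Matrix ι ι A) (f : MvPowerSeries ι A) :
    linField G (linField G' f) = linField (G' * G) f + ∑ δ, ∑ γ,
      rowForm G' δ * (rowForm G γ * MvPowerSeries.pderiv A γ (MvPowerSeries.pderiv A δ f)) := by
  rw [linField_apply G' f, linField_apply (G' * G), map_sum, ← sum_add_distrib]
  refine sum_congr rfl fun δ _ => ?_
  rw [Derivation.leibniz, linField_rowForm, linField_apply G (MvPowerSeries.pderiv A δ f),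
    smul_eq_mul, smul_eq_mul, mul_sum, add_comm, mul_comm (MvPowerSeries.pderiv A δ f)]

theorem linField_sub (G G' : Matrix ι ι A) (f : MvPowerSeries ι A) :
    linField (G - G') f = linField G f - linField G' f := by
  simp only [linField_apply, rowForm, Matrix.sub_apply, sub_smul, sum_sub_distrib, sub_mul]

theorem linField_add (G G' : Matrix ι ι A) (f : MvPowerSeries ι A) :
    linField (G + G') f = linField G f + linField G' f := by
  simp only [linField_apply, rowForm, Matrix.add_apply, add_smul, sum_add_distrib, add_mul]

theorem linField_comm (G G' : Matrix ι ι A) (f : MvPowerSeries ι A) :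
    linField G (linField G' f) - linField G' (linField G f) = linField (G' * G - G * G') f := by
  rw [linField_linField, linField_linField, linField_sub]
  have : ∑ δ, ∑ γ, rowForm G' δ * (rowForm G γ *
        MvPowerSeries.pderiv A γ (MvPowerSeries.pderiv A δ f)) =
      ∑ δ, ∑ γ, rowForm G δ * (rowForm G' γ *
        MvPowerSeries.pderiv A γ (MvPowerSeries.pderiv A δ f)) := by
    rw [sum_comm]
    refine sum_congr rfl fun γ _ => sum_congr rfl fun δ _ => ?_
    rw [pderiv_pderiv_comm γ δ]
    ring
  rw [this]
  abel

theorem pderiv_linField (G : Matrix ι ι A) (μ : ι) (f : MvPowerSeries ι A) :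
    MvPowerSeries.pderiv A μ (linField G f) = linField G (MvPowerSeries.pderiv A μ f) +
      ∑ γ, G γ μ • MvPowerSeries.pderiv A γ f := by
  rw [linField_apply, linField_apply, map_sum, ← sum_add_distrib]
  refine sum_congr rfl fun γ _ => ?_
  rw [Derivation.leibniz, pderiv_rowForm, smul_eq_mul, smul_eq_mul, pderiv_pderiv_comm μ γ,
    mul_comm (MvPowerSeries.pderiv A γ f), MvPowerSeries.smul_eq_C_mul]

theorem coeffDer_linField (d : Derivation ℂ A A) (G : Matrix ι ι A) (f : MvPowerSeries ι A) :
    coeffDer d (linField G f) = linField G (coeffDer d f) + linField (G.map d) f := by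
  simp only [linField_apply, map_sum, ← sum_add_distrib]
  refine sum_congr rfl fun γ _ => ?_
  rw [Derivation.leibniz, coeffDer_pderiv]
  have : coeffDer d (rowForm G γ) = rowForm (G.map d) γ := by
    simp [rowForm, coeffDer_smul, coeffDer_X]
  rw [this, smul_eq_mul, smul_eq_mul, mul_comm (MvPowerSeries.pderiv A γ f)]

/-- The covariant derivative `d - z^β G^γ_β ∂/∂z^γ` of power series in the fibre coordinates, for a
derivation `d` of the coefficients and the matrix `G` of connection coefficients in its
direction. -/
noncomputable def covDer (d : Derivation ℂ A A) (G : Matrix ι ι A) :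
    Derivation ℂ (MvPowerSeries ι A) (MvPowerSeries ι A) :=
  coeffDer d - (linField G).restrictScalars ℂ

theorem covDer_apply (d : Derivation ℂ A A) (G : Matrix ι ι A) (f : MvPowerSeries ι A) :
    covDer d G f = coeffDer d f - linField G f := rfl

theorem covDer_smul (d : Derivation ℂ A A) (G : Matrix ι ι A) (c : A) (f : MvPowerSeries ι A) :
    covDer d G (c • f) = d c • f + c • covDer d G f := by
  rw [covDer_apply, coeffDer_smul, Derivation.map_smul, covDer_apply, smul_sub]
  abel

theorem pderiv_covDer (d : Derivation ℂ A A) (G : Matrix ι ι A) (μ : ι) (f : MvPowerSeries ι A) :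
    MvPowerSeries.pderiv A μ (covDer d G f) = covDer d G (MvPowerSeries.pderiv A μ f) -
      ∑ γ, G γ μ • MvPowerSeries.pderiv A γ f := by
  rw [covDer_apply, covDer_apply, map_sub, pderiv_linField, coeffDer_pderiv]
  abel

theorem covDer_comm {d d' : Derivation ℂ A A} (h : ∀ a, d (d' a) = d' (d a)) (G G' : Matrix ι ι A)
    (f : MvPowerSeries ι A) :
    covDer d G (covDer d' G' f) - covDer d' G' (covDer d G f) =
      linField (G.map d' - G'.map d + (G' * G - G * G')) f := by
  have e := linField_comm G G' f
  simp only [covDer_apply, map_sub, coeffDer_linField, linField_add, linField_sub,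
    coeffDer_comm h] at e ⊢
  linear_combination e

/-- The condition that the tensor `Λ` is covariantly constant in the direction of `d`. -/
def IsParallel (d : Derivation ℂ A A) (G Λ : Matrix ι ι A) : Prop :=
  Λ.map d + G * Λ + Λ * Gᵀ = 0

/-- A covariant derivative for which `Λ` is parallel is a derivation of all contractions
with `Λ`. -/
theorem covDer_bidiff {d : Derivation ℂ A A} {G Λ : Matrix ι ι A} (hΛ : IsParallel d G Λ)
    (k : ℕ) : ∀ f g : MvPowerSeries ι A, covDer d G (bidiff Λ k f g) =
      bidiff Λ k (covDer d G f) g + bidiff Λ k f (covDer d G g) := by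
  induction k with
  | zero =>
    intro f g
    simp only [bidiff_zero, Derivation.leibniz, smul_eq_mul]
    ring
  | succ k ih =>
    intro f g
    set B : ι → ι → MvPowerSeries ι A := fun α β =>
      bidiff Λ k (MvPowerSeries.pderiv A α f) (MvPowerSeries.pderiv A β g) with hB
    have hp : ∀ α β, d (Λ α β) = -(∑ ρ, G α ρ * Λ ρ β) - ∑ ρ, Λ α ρ * G β ρ := by
      intro α β
      have h := congrFun (congrFun hΛ α) β
      simp only [Matrix.add_apply, Matrix.map_apply, Matrix.mul_apply, Matrix.zero_apply,
        Matrix.transpose_apply] at h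
      linear_combination h
    have e1 : ∀ α β, bidiff Λ k (MvPowerSeries.pderiv A α (covDer d G f))
        (MvPowerSeries.pderiv A β g) = bidiff Λ k (covDer d G (MvPowerSeries.pderiv A α f))
        (MvPowerSeries.pderiv A β g) - ∑ γ, G γ α • B γ β := by
      intro α β
      simp only [pderiv_covDer, map_sub, map_sum, map_smul, LinearMap.sub_apply,
        LinearMap.sum_apply, LinearMap.smul_apply, hB]
    have e2 : ∀ α β, bidiff Λ k (MvPowerSeries.pderiv A α f)
        (MvPowerSeries.pderiv A β (covDer d G g)) = bidiff Λ k (MvPowerSeries.pderiv A α f)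
        (covDer d G (MvPowerSeries.pderiv A β g)) - ∑ γ, G γ β • B α γ := by
      intro α β
      simp only [pderiv_covDer, map_sub, map_sum, map_smul, hB]
    -- the connection terms `s1`, `s2` cancel against the derivative `hp` of `Λ`
    have s1 : ∑ α, ∑ β, Λ α β • ∑ γ, G γ α • B γ β =
        ∑ α, ∑ β, (∑ ρ, G α ρ * Λ ρ β) • B α β := by
      simp only [smul_sum, sum_smul, smul_smul]
      calc _ = ∑ β, ∑ α, ∑ γ, (Λ α β * G γ α) • B γ β := sum_comm
        _ = ∑ β, ∑ γ, ∑ α, (Λ α β * G γ α) • B γ β := sum_congr rfl fun β _ => sum_comm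
        _ = ∑ γ, ∑ β, ∑ α, (Λ α β * G γ α) • B γ β := sum_comm
        _ = _ := by simp only [mul_comm]
    have s2 : ∑ α, ∑ β, Λ α β • ∑ γ, G γ β • B α γ =
        ∑ α, ∑ β, (∑ ρ, Λ α ρ * G β ρ) • B α β := by
      simp only [smul_sum, sum_smul, smul_smul]
      exact sum_congr rfl fun α _ => sum_comm
    simp only [hB] at e1 e2 s1 s2
    simp only [bidiff_succ, map_sum, covDer_smul, ih, e1, e2, smul_sub, sum_sub_distrib,
      smul_add, sum_add_distrib, s1, s2, hp, sub_smul, neg_smul, sum_neg_distrib]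
    abel

/-- A `k`-fold contraction lowers the degree in `z` by `2 k`. -/
theorem coeff_bidiff_eq_zero (Λ : Matrix ι ι A) (k : ℕ) : ∀ (f g : MvPowerSeries ι A) (m : ι →₀ ℕ),
    (∀ m₁ m₂ : ι →₀ ℕ, m₁.degree + m₂.degree = m.degree + 2 * k →
      MvPowerSeries.coeff m₁ f = 0 ∨ MvPowerSeries.coeff m₂ g = 0) →
    MvPowerSeries.coeff m (bidiff Λ k f g) = 0 := by
  induction k with
  | zero =>
    intro f g m h
    rw [bidiff_zero, MvPowerSeries.coeff_mul]
    refine sum_eq_zero fun x hx => ?_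
    have hx' := HasAntidiagonal.mem_antidiagonal.1 hx
    rcases h x.1 x.2 (by rw [← hx', map_add]; rfl) with h | h <;> simp [h]
  | succ k ih =>
    intro f g m h
    simp only [bidiff_succ, map_sum, MvPowerSeries.coeff_smul]
    refine sum_eq_zero fun α _ => sum_eq_zero fun β _ => ?_
    rw [ih, mul_zero]
    intro m₁ m₂ hm
    rw [MvPowerSeries.coeff_pderiv, MvPowerSeries.coeff_pderiv]
    rcases h (m₁ + Finsupp.single α 1) (m₂ + Finsupp.single β 1) (by
      simp only [map_add, Finsupp.degree_single]; omega) with h | h <;> simp [h]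

end PowerSeriesOperators
end LagrangeFedosov

namespace LagrangeFedosov

open Finset

/-! ### Operators on the Wick algebra -/

namespace WickAlg

variable {ι A : Type*} [Fintype ι] [DecidableEq ι] [CommRing A] [Algebra ℂ A] {Λ : Matrix ι ι A}

/-- A linear operator on power series in the fibre coordinates, applied to each power of `v`. -/
noncomputable def lift (T : MvPowerSeries ι A →ₗ[ℂ] MvPowerSeries ι A) :
    WickAlg Λ →ₗ[ℂ] WickAlg Λ where
  toFun a := fun r => T (a r)
  map_add' a b := funext fun r => map_add T (a r) (b r)
  map_smul' c a := funext fun r => map_smul T c (a r)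

theorem lift_apply (T : MvPowerSeries ι A →ₗ[ℂ] MvPowerSeries ι A) (a : WickAlg Λ) (r : ℕ) :
    lift T a r = T (a r) := rfl

/-- The fibre derivative `∂/∂z^α`. -/
noncomputable def del (α : ι) : WickAlg Λ →ₗ[ℂ] WickAlg Λ :=
  lift ((MvPowerSeries.pderiv A α).toLinearMap.restrictScalars ℂ)

theorem del_apply (α : ι) (a : WickAlg Λ) (r : ℕ) :
    del α a r = MvPowerSeries.pderiv A α (a r) := rfl

/-- The covariant derivative in the direction of `d`, with matrix `G` of connection coefficients. -/
noncomputable def cov (d : Derivation ℂ A A) (G : Matrix ι ι A) : WickAlg Λ →ₗ[ℂ] WickAlg Λ :=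
  lift (covDer d G).toLinearMap

theorem cov_apply (d : Derivation ℂ A A) (G : Matrix ι ι A) (a : WickAlg Λ) (r : ℕ) :
    cov d G a r = covDer d G (a r) := rfl

/-- Pointwise (commutative) multiplication by the fibre coordinate `z^α`. -/
noncomputable def mulX (α : ι) : WickAlg Λ →ₗ[ℂ] WickAlg Λ :=
  lift (LinearMap.mulLeft ℂ (MvPowerSeries.X α))

theorem mulX_apply (α : ι) (a : WickAlg Λ) (r : ℕ) : mulX α a r = MvPowerSeries.X α * a r := rfl

/-- The operator `deg_s + c`. -/
noncomputable def num (c : ℕ) : WickAlg Λ →ₗ[ℂ] WickAlg Λ :=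
  lift
    { toFun := fun f => (fun m => ((m.degree + c : ℕ) : A) * MvPowerSeries.coeff m f :
        (ι →₀ ℕ) → A)
      map_add' := fun f g => by
        funext m
        exact mul_add _ _ _
      map_smul' := fun c' f => by
        funext m
        exact mul_smul_comm c' _ _ }

theorem coeff_num (c : ℕ) (a : WickAlg Λ) (r : ℕ) (m : ι →₀ ℕ) :
    MvPowerSeries.coeff m (num c a r) =
      ((m.degree + c : ℕ) : A) * MvPowerSeries.coeff m (a r) := rfl

/-- The component of total degree `Deg = k`. -/
noncomputable def dp (k : ℕ) : WickAlg Λ →ₗ[A] WickAlg Λ where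
  toFun a := fun r => (fun m => if 2 * r + m.degree = k then MvPowerSeries.coeff m (a r) else 0 :
    (ι →₀ ℕ) → A)
  map_add' a b := by
    funext r m
    change (if _ then MvPowerSeries.coeff m (a r + b r) else 0) = (if _ then _ else 0) +
      (if _ then _ else 0)
    split_ifs <;> simp
  map_smul' c a := by
    funext r m
    change (if _ then MvPowerSeries.coeff m (c • a r) else 0) = c • (if _ then _ else 0)
    split_ifs <;> simp

theorem coeff_dp (k : ℕ) (a : WickAlg Λ) (r : ℕ) (m : ι →₀ ℕ) :
    MvPowerSeries.coeff m (dp k a r) =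
      if 2 * r + m.degree = k then MvPowerSeries.coeff m (a r) else 0 := rfl

theorem ext_dp {a b : WickAlg Λ} (h : ∀ k, dp k a = dp k b) : a = b := by
  ext r m
  have := congrArg (fun c : WickAlg Λ => MvPowerSeries.coeff m (c r)) (h (2 * r + m.degree))
  simpa [coeff_dp] using this

theorem dp_dp (j k : ℕ) (a : WickAlg Λ) : dp j (dp k a) = if j = k then dp k a else 0 := by
  ext r m
  rw [coeff_dp, coeff_dp]
  split_ifs <;> simp_all [coeff_dp]

/-! ### Sections assembled from their homogeneous components -/

/-- The sum `∑_k x_k` of a sequence whose `k`-th term has total degree `k`. -/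
noncomputable def total (x : ℕ → WickAlg Λ) : WickAlg Λ := fun r =>
  (fun m => MvPowerSeries.coeff m (x (2 * r + m.degree) r) : (ι →₀ ℕ) → A)

theorem coeff_total (x : ℕ → WickAlg Λ) (r : ℕ) (m : ι →₀ ℕ) :
    MvPowerSeries.coeff m (total x r) = MvPowerSeries.coeff m (x (2 * r + m.degree) r) := rfl

theorem dp_total (x : ℕ → WickAlg Λ) (k : ℕ) : dp k (total x) = dp k (x k) := by
  ext r m
  rw [coeff_dp, coeff_dp]
  split_ifs with h
  · rw [coeff_total, h]
  · rfl

/-! ### Multiplication by `v`, and the commutator divided by `v` -/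

/-- Multiplication by `v`. -/
noncomputable def sh : WickAlg Λ →ₗ[A] WickAlg Λ where
  toFun a := fun r => match r with
    | 0 => 0
    | r + 1 => a r
  map_add' a b := by
    funext r
    cases r
    · exact (add_zero (0 : MvPowerSeries ι A)).symm
    · rfl
  map_smul' c a := by
    funext r
    cases r
    · exact (smul_zero c).symm
    · rfl

@[simp] theorem sh_zero (a : WickAlg Λ) : sh a 0 = 0 := rfl
@[simp] theorem sh_succ (a : WickAlg Λ) (r : ℕ) : sh a (r + 1) = a r := rfl

theorem sh_injective : Function.Injective (sh : WickAlg Λ → WickAlg Λ) := fun _ _ h =>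
  ext_v fun r => congrFun h (r + 1)

theorem sh_mul (a b : WickAlg Λ) : sh a * b = sh (a * b) := by
  refine ext_v fun r => ?_
  cases r with
  | zero => simp [mul_apply]
  | succ r =>
    rw [sh_succ, mul_apply, mul_apply, Nat.sum_antidiagonal_succ']
    simp [Nat.sum_antidiagonal_succ]

theorem mul_sh (a b : WickAlg Λ) : a * sh b = sh (a * b) := by
  refine ext_v fun r => ?_
  cases r with
  | zero => simp [mul_apply]
  | succ r =>
    rw [sh_succ, mul_apply, mul_apply, Nat.sum_antidiagonal_succ']
    simp [Nat.sum_antidiagonal_succ']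

/-- The commutator of the Wick product, divided by `v`. -/
noncomputable def br : WickAlg Λ →ₗ[A] WickAlg Λ →ₗ[A] WickAlg Λ :=
  LinearMap.mk₂ A (fun a b r => (a * b - b * a) (r + 1))
    (fun a a' b => by
      rw [add_mul, mul_add]
      funext r
      change (_ + _ - (_ + _) : MvPowerSeries ι A) = (_ - _) + (_ - _)
      abel)
    (fun c a b => by
      rw [smul_mul_assoc, mul_smul_comm, ← smul_sub]
      rfl)
    (fun a b b' => by
      rw [add_mul, mul_add]
      funext r
      change (_ + _ - (_ + _) : MvPowerSeries ι A) = (_ - _) + (_ - _)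
      abel)
    (fun c a b => by
      rw [smul_mul_assoc, mul_smul_comm, ← smul_sub]
      rfl)

theorem br_apply (a b : WickAlg Λ) (r : ℕ) : br a b r = (a * b - b * a) (r + 1) := rfl

theorem mul_apply_zero (a b : WickAlg Λ) : (a * b) 0 = a 0 * b 0 := by
  simp [mul_apply]

theorem sh_br (a b : WickAlg Λ) : sh (br a b) = a * b - b * a := by
  refine ext_v fun r => ?_
  cases r with
  | zero => simp [mul_apply_zero, mul_comm]
  | succ r => rfl

theorem br_csmul_left (c : ℂ) (a b : WickAlg Λ) : br (c • a) b = c • br a b := by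
  rw [LinearMap.map_smul_of_tower, LinearMap.smul_apply]

theorem br_csmul_right (c : ℂ) (a b : WickAlg Λ) : br a (c • b) = c • br a b :=
  LinearMap.map_smul_of_tower _ _ _

theorem br_antisymm (a b : WickAlg Λ) : br a b = -br b a := by
  apply sh_injective
  rw [map_neg, sh_br, sh_br, neg_sub]

theorem br_mul (a b c : WickAlg Λ) : br a (b * c) = br a b * c + b * br a c := by
  apply sh_injective
  rw [map_add, ← sh_mul, ← mul_sh, sh_br, sh_br, sh_br]
  noncomm_ring

theorem br_br (a b c : WickAlg Λ) : br (br a b) c = br a (br b c) - br b (br a c) := by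
  apply sh_injective
  apply sh_injective
  rw [map_sub, map_sub, sh_br, sh_br, sh_br, map_sub, map_sub, map_sub, ← sh_mul (br a b) c,
    ← mul_sh c (br a b), ← mul_sh a (br b c), ← sh_mul (br b c) a, ← mul_sh b (br a c),
    ← sh_mul (br a c) b, sh_br, sh_br, sh_br]
  noncomm_ring

theorem cov_sh (d : Derivation ℂ A A) (G : Matrix ι ι A) (a : WickAlg Λ) :
    cov d G (sh a) = sh (cov d G a) := by
  refine ext_v fun r => ?_
  cases r with
  | zero => simp [cov_apply]
  | succ r => rfl

theorem del_sh (α : ι) (a : WickAlg Λ) : del α (sh a) = sh (del α a) := by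
  refine ext_v fun r => ?_
  cases r with
  | zero => simp [del_apply]
  | succ r => rfl

theorem del_mul (α : ι) (a b : WickAlg Λ) : del α (a * b) = del α a * b + a * del α b := by
  refine ext_v fun r => ?_
  simp only [del_apply, mul_apply, val_add, map_sum, pderiv_csmul, pderiv_bidiff,
    sum_add_distrib, smul_add]

theorem cov_mul {d : Derivation ℂ A A} {G : Matrix ι ι A} (h : IsParallel d G Λ)
    (a b : WickAlg Λ) : cov d G (a * b) = cov d G a * b + a * cov d G b := by
  refine ext_v fun r => ?_
  simp only [cov_apply, mul_apply, val_add, map_sum, Derivation.map_smul, covDer_bidiff h,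
    sum_add_distrib, smul_add]

theorem del_br (α : ι) (a b : WickAlg Λ) : del α (br a b) = br (del α a) b + br a (del α b) := by
  apply sh_injective
  rw [← del_sh, sh_br, map_sub, del_mul, del_mul, map_add, sh_br, sh_br]
  abel

theorem cov_br {d : Derivation ℂ A A} {G : Matrix ι ι A} (h : IsParallel d G Λ)
    (a b : WickAlg Λ) : cov d G (br a b) = br (cov d G a) b + br a (cov d G b) := by
  apply sh_injective
  rw [← cov_sh, sh_br, map_sub, cov_mul h, cov_mul h, map_add, sh_br, sh_br]
  abel

theorem cov_smul (d : Derivation ℂ A A) (G : Matrix ι ι A) (c : A) (a : WickAlg Λ) :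
    cov d G (c • a) = d c • a + c • cov d G a :=
  ext_v fun r => covDer_smul d G c (a r)

theorem del_smul (α : ι) (c : A) (a : WickAlg Λ) : del α (c • a) = c • del α a :=
  ext_v fun r => (MvPowerSeries.pderiv A α).map_smul c (a r)

theorem del_cov (d : Derivation ℂ A A) (G : Matrix ι ι A) (μ : ι) (a : WickAlg Λ) :
    del μ (cov d G a) = cov d G (del μ a) - ∑ γ, G γ μ • del γ a :=
  ext_v fun r => by
    simp only [del_apply, cov_apply, pderiv_covDer, val_sub, val_sum, val_smul]

theorem del_del (α β : ι) (a : WickAlg Λ) : del α (del β a) = del β (del α a) :=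
  ext_v fun r => pderiv_pderiv_comm α β (a r)

/-! ### Grading -/

/-- The Wick product respects the total degree, since `v` has degree `2`. -/
theorem coeff_mul_eq_zero (a b : WickAlg Λ) (r : ℕ) (m : ι →₀ ℕ)
    (h : ∀ r₁ m₁ r₂ m₂, 2 * r₁ + Finsupp.degree m₁ + (2 * r₂ + Finsupp.degree m₂) =
      2 * r + m.degree → MvPowerSeries.coeff m₁ (a r₁) = 0 ∨ MvPowerSeries.coeff m₂ (b r₂) = 0) :
    MvPowerSeries.coeff m ((a * b) r) = 0 := by
  rw [mul_apply, map_sum]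
  refine sum_eq_zero fun x hx => ?_
  rw [coeff_csmul, map_sum, sum_eq_zero, smul_zero]
  intro p hp
  refine coeff_bidiff_eq_zero Λ x.1 _ _ m fun m₁ m₂ hm => h _ _ _ _ ?_
  have h1 := HasAntidiagonal.mem_antidiagonal.1 hx
  have h2 := HasAntidiagonal.mem_antidiagonal.1 hp
  omega

/-- The total degree is a grading of the Wick algebra. -/
theorem dp_mul (K : ℕ) (a b : WickAlg Λ) :
    dp K (a * b) = ∑ x ∈ antidiagonal K, dp x.1 a * dp x.2 b := by
  ext r m
  rw [coeff_dp, val_sum, map_sum]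
  split_ifs with hK
  -- the components of degree above `K` do not contribute, so both factors may be truncated
  · set aT : WickAlg Λ := ∑ i ∈ range (K + 1), dp i a with haT
    set bT : WickAlg Λ := ∑ i ∈ range (K + 1), dp i b with hbT
    have ht : ∀ c : WickAlg Λ, ∀ r' m', 2 * r' + Finsupp.degree m' ≤ K →
        MvPowerSeries.coeff m' ((c - ∑ i ∈ range (K + 1), dp i c : WickAlg Λ) r') = 0 := by
      intro c r' m' hle
      rw [val_sub, val_sum, map_sub, map_sum, sum_eq_single (2 * r' + m'.degree)]
      · simp [coeff_dp]
      · intro i _ hi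
        rw [coeff_dp, if_neg (Ne.symm hi)]
      · intro hi
        exact absurd (mem_range.2 (Nat.lt_succ_of_le hle)) hi
    have e : a * b = (a - aT) * b + aT * (b - bT) + aT * bT := by noncomm_ring
    have z1 : MvPowerSeries.coeff m (((a - aT) * b) r) = 0 :=
      coeff_mul_eq_zero _ _ _ _ fun r₁ m₁ r₂ m₂ h => Or.inl (ht a _ _ (by omega))
    have z2 : MvPowerSeries.coeff m ((aT * (b - bT)) r) = 0 :=
      coeff_mul_eq_zero _ _ _ _ fun r₁ m₁ r₂ m₂ h => Or.inr (ht b _ _ (by omega))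
    rw [e, val_add, val_add, map_add, map_add, z1, z2, zero_add, zero_add, haT, hbT,
      Finset.sum_mul_sum, val_sum, map_sum]
    simp only [val_sum, map_sum]
    rw [← sum_product']
    symm
    refine sum_subset ?_ ?_
    · intro x hx
      have := HasAntidiagonal.mem_antidiagonal.1 hx
      simp only [mem_product, mem_range]
      omega
    · intro x _ hx
      refine coeff_mul_eq_zero _ _ _ _ fun r₁ m₁ r₂ m₂ h => ?_
      rw [coeff_dp, coeff_dp]
      by_contra hne
      push Not at hne
      have h1 := of_not_not fun h' => hne.1 (if_neg h')
      have h2 := of_not_not fun h' => hne.2 (if_neg h')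
      exact hx (HasAntidiagonal.mem_antidiagonal.2 (by omega))
  · symm
    refine sum_eq_zero fun x hx => ?_
    refine coeff_mul_eq_zero _ _ _ _ fun r₁ m₁ r₂ m₂ h => ?_
    have hx' := HasAntidiagonal.mem_antidiagonal.1 hx
    rw [coeff_dp, coeff_dp]
    by_contra hne
    push Not at hne
    have h1 := of_not_not fun h' => hne.1 (if_neg h')
    have h2 := of_not_not fun h' => hne.2 (if_neg h')
    omega

theorem dp_sh (k : ℕ) (a : WickAlg Λ) : dp (k + 2) (sh a) = sh (dp k a) := by
  ext r m
  cases r with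
  | zero => simp [coeff_dp]
  | succ r =>
    rw [sh_succ, coeff_dp, coeff_dp, sh_succ]
    exact if_congr (by omega) rfl rfl

theorem dp_br (K : ℕ) (a b : WickAlg Λ) :
    dp K (br a b) = ∑ x ∈ antidiagonal (K + 2), br (dp x.1 a) (dp x.2 b) := by
  apply sh_injective
  rw [← dp_sh, sh_br, map_sub, dp_mul, dp_mul, map_sum]
  simp only [sh_br, sum_sub_distrib]
  rw [← Nat.sum_antidiagonal_swap (f := fun x => dp x.1 b * dp x.2 a)]
  rfl

theorem dp_num (k c : ℕ) (a : WickAlg Λ) : dp k (num c a) = num c (dp k a) := by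
  ext r m
  rw [coeff_dp, coeff_num, coeff_num, coeff_dp]
  split_ifs <;> simp

theorem dp_mulX_succ (k : ℕ) (α : ι) (a : WickAlg Λ) :
    dp (k + 1) (mulX α a) = mulX α (dp k a) := by
  ext r m
  rw [coeff_dp, mulX_apply, mulX_apply, coeff_X_mul, coeff_X_mul]
  split_ifs with h1 h2 h2
  · rfl
  · rw [coeff_dp, if_pos]
    have h3 : Finsupp.single α 1 ≤ m := by
      rw [Finsupp.single_le_iff]; exact Nat.one_le_iff_ne_zero.2 h2
    have h4 := congrArg Finsupp.degree (tsub_add_cancel_of_le h3)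
    rw [map_add, Finsupp.degree_single] at h4
    omega
  · rfl
  · rw [coeff_dp, if_neg]
    have h3 : Finsupp.single α 1 ≤ m := by
      rw [Finsupp.single_le_iff]; exact Nat.one_le_iff_ne_zero.2 h2
    have h4 := congrArg Finsupp.degree (tsub_add_cancel_of_le h3)
    rw [map_add, Finsupp.degree_single] at h4
    omega

theorem dp_mulX_zero (α : ι) (a : WickAlg Λ) : dp 0 (mulX α a) = 0 := by
  ext r m
  rw [coeff_dp, mulX_apply, coeff_X_mul]
  split_ifs with h1 h2
  · rfl
  · have : m = 0 := by
      rw [← Finsupp.degree_eq_zero_iff]; omega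
    simp [this] at h2
  · rfl

theorem dp_del (k : ℕ) (α : ι) (a : WickAlg Λ) : dp k (del α a) = del α (dp (k + 1) a) := by
  ext r m
  rw [coeff_dp, del_apply, del_apply, MvPowerSeries.coeff_pderiv, MvPowerSeries.coeff_pderiv,
    coeff_dp, map_add, Finsupp.degree_single]
  split_ifs with h1 h2 h2
  · rfl
  · omega
  · omega
  · simp

theorem del_dp_zero (α : ι) (a : WickAlg Λ) : del α (dp 0 a) = 0 := by
  ext r m
  rw [del_apply, MvPowerSeries.coeff_pderiv, coeff_dp, map_add, Finsupp.degree_single, if_neg]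
  · simp
  · omega

theorem cov_eq (d : Derivation ℂ A A) (G : Matrix ι ι A) (a : WickAlg Λ) :
    cov d G a = lift (coeffDer d).toLinearMap a - ∑ γ, ∑ β, G γ β • mulX β (del γ a) := by
  refine ext_v fun r => ?_
  simp only [cov_apply, covDer_apply, val_sub, lift_apply, val_sum, val_smul, mulX_apply,
    del_apply, linField_apply, rowForm, sum_mul, smul_mul_assoc]
  rfl

theorem dp_cov (k : ℕ) (d : Derivation ℂ A A) (G : Matrix ι ι A) (a : WickAlg Λ) :
    dp k (cov d G a) = cov d G (dp k a) := by
  rw [cov_eq, cov_eq, map_sub, map_sum]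
  congr 1
  · ext r m
    rw [coeff_dp, lift_apply, lift_apply]
    change (if _ then d _ else 0) = d (MvPowerSeries.coeff m (dp k a r))
    rw [coeff_dp]
    split_ifs <;> simp
  · refine sum_congr rfl fun γ _ => ?_
    rw [map_sum]
    refine sum_congr rfl fun β _ => ?_
    rw [map_smul]
    cases k with
    | zero => rw [dp_mulX_zero, del_dp_zero, map_zero]
    | succ k => rw [dp_mulX_succ, dp_del]

/-! ### Euler's identity and the operators `δ`, `δ⁻¹` -/

theorem num_add (c c' : ℕ) (a : WickAlg Λ) : num (c + c') a = num c a + (c' : A) • a := by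
  ext r m
  rw [coeff_num, val_add, map_add, coeff_num, val_smul, MvPowerSeries.coeff_smul]
  push_cast
  ring

theorem sum_mulX_del (a : WickAlg Λ) : ∑ α, mulX α (del α a) = num 0 a := by
  ext r m
  rw [val_sum, map_sum, coeff_num]
  simp only [mulX_apply, del_apply, coeff_X_mul_pderiv_self]
  rw [← sum_mul, ← Nat.cast_sum, add_zero, Finsupp.degree_eq_sum]

theorem del_mulX (α β : ι) (a : WickAlg Λ) :
    del β (mulX α a) = mulX α (del β a) + if α = β then a else 0 := by
  refine ext_v fun r => ?_
  rw [del_apply, mulX_apply, Derivation.leibniz, val_add, mulX_apply, del_apply, smul_eq_mul,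
    smul_eq_mul]
  split_ifs with h
  · rw [h, MvPowerSeries.pderiv_X_self, mul_one]
  · rw [MvPowerSeries.pderiv_X_of_ne h, mul_zero]; rfl

theorem mulX_mulX (α β : ι) (a : WickAlg Λ) : mulX α (mulX β a) = mulX β (mulX α a) :=
  ext_v fun r => by simp only [mulX_apply]; ring

theorem mulX_smul (α : ι) (c : A) (a : WickAlg Λ) : mulX α (c • a) = c • mulX α a :=
  ext_v fun r => by simp only [mulX_apply, val_smul, mul_smul_comm]

theorem natCast_mul_cancel {k : ℕ} (hk : k ≠ 0) {x : A} (h : (k : A) * x = 0) : x = 0 := by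
  have hk' : (k : ℂ) ≠ 0 := by exact_mod_cast hk
  have h2 : (k : A) = algebraMap ℂ A (k : ℂ) := by simp
  rw [h2, ← Algebra.smul_def] at h
  have h3 := congrArg (fun y => (k : ℂ)⁻¹ • y) h
  simpa [smul_smul, hk'] using h3

theorem num_succ_injective (c : ℕ) {a : WickAlg Λ} (h : num (c + 1) a = 0) : a = 0 := by
  ext r m
  have h1 := congrArg (fun b : WickAlg Λ => MvPowerSeries.coeff m (b r)) h
  exact natCast_mul_cancel (by omega) h1

theorem eq_zero_of_num_zero {a : WickAlg Λ} (h : num 0 a = 0)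
    (h0 : ∀ r, MvPowerSeries.constantCoeff (a r) = 0) : a = 0 := by
  ext r m
  by_cases hm : m = 0
  · rw [hm]; exact h0 r
  · have h1 := congrArg (fun b : WickAlg Λ => MvPowerSeries.coeff m (b r)) h
    have h2 : m.degree ≠ 0 := fun h => hm ((Finsupp.degree_eq_zero_iff m).1 h)
    exact natCast_mul_cancel (by omega) h1

/-- Homotopy formula for forms of degree `1` that are annihilated by `δ⁻¹`. -/
theorem homotopy_one {x : ι → WickAlg Λ} (h : ∑ α, mulX α (x α) = 0) (β : ι) :
    num 1 (x β) = ∑ α, mulX α (del α (x β) - del β (x α)) := by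
  have h1 := congrArg (del β) h
  rw [map_zero, map_sum] at h1
  simp only [del_mulX, sum_add_distrib, sum_ite_eq', mem_univ, if_true] at h1
  have h2 := num_add 0 1 (x β)
  rw [zero_add] at h2
  simp only [map_sub, sum_sub_distrib, sum_mulX_del, h2, Nat.cast_one, one_smul]
  rw [eq_neg_of_add_eq_zero_left h1]
  abel

/-- Homotopy formula for forms of degree `2` that are annihilated by `δ⁻¹`. -/
theorem homotopy_two {x : ι → ι → WickAlg Λ} (hx : ∀ α β, x α β = -x β α)
    (h : ∀ β, ∑ α, mulX α (x α β) = 0) (β γ : ι) :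
    num 2 (x β γ) = ∑ α, mulX α (del α (x β γ) + del β (x γ α) + del γ (x α β)) := by
  have key : ∀ μ ν, ∑ α, mulX α (del μ (x α ν)) = -x μ ν := by
    intro μ ν
    have h1 := congrArg (del μ) (h ν)
    rw [map_zero, map_sum] at h1
    simp only [del_mulX, sum_add_distrib, sum_ite_eq', mem_univ, if_true] at h1
    exact eq_neg_of_add_eq_zero_left h1
  have h2 := num_add 0 2 (x β γ)
  rw [zero_add] at h2
  have h3 : ∑ α, mulX α (del β (x γ α)) = x β γ := by
    have := key β γ
    rw [← neg_eq_iff_eq_neg, ← sum_neg_distrib] at this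
    rw [← this]
    refine sum_congr rfl fun α _ => ?_
    rw [hx γ α, map_neg, map_neg]
  simp only [map_add, sum_add_distrib, sum_mulX_del, h2, h3, key, hx γ β, neg_neg]
  rw [add_assoc, ← two_smul A (x β γ)]
  norm_num

/-- An induction principle for operators that raise the total degree. -/
theorem eq_zero_of_dp {κ : Type*} {x : κ → WickAlg Λ}
    (h : ∀ k, (∀ j < k, ∀ i, dp j (x i) = 0) → ∀ i, dp k (x i) = 0) (i : κ) : x i = 0 := by
  refine ext_dp fun k => ?_
  rw [map_zero]
  induction k using Nat.strong_induction_on generalizing i with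
  | _ k ih => exact h k (fun j hj i => ih j hj i) i

/-! ### Brackets with linear and quadratic elements -/

/-- A power series in the fibre coordinates, as an element that does not involve `v`. -/
noncomputable def ofM : MvPowerSeries ι A →ₗ[A] WickAlg Λ where
  toFun f := fun r => if r = 0 then f else 0
  map_add' f g := by
    funext r
    change (if _ then f + g else 0) = (if _ then f else 0) + (if _ then g else 0)
    split_ifs <;> simp
  map_smul' c f := by
    funext r
    change (if _ then c • f else 0) = c • (if _ then f else 0)
    split_ifs <;> simp

theorem ofM_apply (f : MvPowerSeries ι A) (r : ℕ) :
    (ofM f : WickAlg Λ) r = if r = 0 then f else 0 := rfl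

/-- The commutator with an element whose second order contractions are symmetric and whose higher
contractions vanish is the Poisson bracket: only the first order of the Wick product contributes. -/
theorem br_ofM {f : MvPowerSeries ι A}
    (h2 : ∀ g, bidiff Λ 2 f g = bidiff Λ 2 g f)
    (h3 : ∀ k g, 3 ≤ k → bidiff Λ k f g = 0 ∧ bidiff Λ k g f = 0) (a : WickAlg Λ) (r : ℕ) :
    br (ofM f) a r = (Complex.I / 2) • ∑ α, ∑ β, (Λ α β - Λ β α) •
      (MvPowerSeries.pderiv A α f * MvPowerSeries.pderiv A β (a r)) := by
  rw [br_apply, val_sub, wmul_of_left (f := f) (ofM_apply f), wmul_of_right (f := f) (ofM_apply f),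
    ← sum_sub_distrib]
  simp only [← smul_sub]
  have hs : ∀ x ∈ antidiagonal (r + 1), x ≠ (1, r) →
      expCoeff x.1 • (bidiff Λ x.1 f (a x.2) - bidiff Λ x.1 (a x.2) f) = 0 := by
    rintro ⟨k, s⟩ hx hne
    have hx' : k + s = r + 1 := HasAntidiagonal.mem_antidiagonal.1 hx
    rcases k with _ | _ | _ | k
    · simp [mul_comm]
    · obtain rfl : s = r := by omega
      exact absurd rfl hne
    · simp [h2]
    · rw [(h3 (k + 1 + 1 + 1) (a s) (by omega)).1, (h3 (k + 1 + 1 + 1) (a s) (by omega)).2]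
      simp
  rw [sum_eq_single (1, r) hs (fun h => absurd
    (HasAntidiagonal.mem_antidiagonal.2 (add_comm 1 r)) h)]
  rw [expCoeff_one, bidiff_succ, bidiff_succ]
  simp only [bidiff_zero, sub_smul, sum_sub_distrib]
  congr 2
  rw [sum_comm]
  simp only [mul_comm]

theorem bidiff_eq_zero_left {f : MvPowerSeries ι A}
    (hf : ∀ α β, MvPowerSeries.pderiv A α (MvPowerSeries.pderiv A β f) = 0) :
    ∀ k g, 2 ≤ k → bidiff Λ k f g = 0 ∧ bidiff Λ k g f = 0 := by
  intro k g hk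
  obtain ⟨k, rfl⟩ := Nat.exists_eq_add_of_le' hk
  constructor <;> simp [bidiff_succ, hf]

theorem br_ofM_linear {f : MvPowerSeries ι A}
    (hf : ∀ α β, MvPowerSeries.pderiv A α (MvPowerSeries.pderiv A β f) = 0)
    (a : WickAlg Λ) (r : ℕ) :
    br (ofM f) a r = (Complex.I / 2) • ∑ α, ∑ β, (Λ α β - Λ β α) •
      (MvPowerSeries.pderiv A α f * MvPowerSeries.pderiv A β (a r)) :=
  br_ofM (fun g => by
      rw [(bidiff_eq_zero_left hf 2 g le_rfl).1, (bidiff_eq_zero_left hf 2 g le_rfl).2])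
    (fun k g hk => bidiff_eq_zero_left hf k g (by omega)) a r

end WickAlg
end LagrangeFedosov

namespace LagrangeFedosov

open Finset

/-! ### Fedosov data and their curvature -/

section

variable {ι A : Type*} [Fintype ι] [DecidableEq ι] [CommRing A] [Algebra ℂ A]

theorem Matrix_map_derivation_mul (d : Derivation ℂ A A) (P Q : Matrix ι ι A) :
    (P * Q).map d = P.map d * Q + P * Q.map d := by
  ext i j
  simp only [Matrix.map_apply, Matrix.mul_apply, Matrix.add_apply, map_sum, Derivation.leibniz,
    smul_eq_mul, ← sum_add_distrib]
  exact sum_congr rfl fun k _ => by ring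

theorem Matrix_map_derivation_one (d : Derivation ℂ A A) : (1 : Matrix ι ι A).map d = 0 := by
  ext i j
  rw [Matrix.map_apply, Matrix.one_apply]
  split_ifs <;> simp

theorem Matrix_map_derivation_neg (d : Derivation ℂ A A) (P : Matrix ι ι A) :
    (-P).map d = -P.map d := by
  ext i j
  simp

theorem rowForm_one (γ : ι) : rowForm (1 : Matrix ι ι A) γ = MvPowerSeries.X γ := by
  rw [rowForm, sum_eq_single γ]
  · simp
  · intro b _ hb
    simp [Matrix.one_apply_ne hb.symm]
  · simp

theorem bidiff_one_rowForm (Λ P Q : Matrix ι ι A) (μ ν : ι) :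
    bidiff Λ 1 (rowForm P μ) (rowForm Q ν) = MvPowerSeries.C ((P * Λ * Qᵀ) μ ν) := by
  rw [bidiff_succ]
  simp only [bidiff_zero, pderiv_rowForm, ← map_mul, Matrix.mul_apply, Matrix.transpose_apply,
    MvPowerSeries.smul_eq_C_mul, map_sum, sum_mul]
  rw [sum_comm]
  exact sum_congr rfl fun α _ => sum_congr rfl fun β _ => by
    congr 1; ring

end

/-- The algebraic data from which Fedosov's construction starts, over a commutative algebra `A`
with commuting derivations `pdv α`: coefficients `Γ μ l ν = Γ^l_{νμ}` of a connection, for which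
the tensors `θ^{αβ}` and `g^{αβ}` are covariantly constant, and the inverse `θ_{αβ}` of the first
tensor, which is a closed form, normalised by `θ^{γα} θ_{γβ} = δ^α_β`. -/
structure FedosovDatum (ι A : Type*) [Fintype ι] [DecidableEq ι] [CommRing A] [Algebra ℂ A] where
  pdv : ι → Derivation ℂ A A
  pdv_comm : ∀ α β a, pdv α (pdv β a) = pdv β (pdv α a)
  Γ : ι → Matrix ι ι A
  θ : Matrix ι ι A
  θup : Matrix ι ι A
  gup : Matrix ι ι A
  gup_symm : gupᵀ = gup
  θup_antisymm : θupᵀ = -θup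
  θup_mul_θ : θupᵀ * θ = 1
  parallel_θup : ∀ μ, IsParallel (pdv μ) (Γ μ) θup
  parallel_gup : ∀ μ, IsParallel (pdv μ) (Γ μ) gup
  closed : ∀ α β γ, pdv α (θ β γ) + pdv β (θ γ α) + pdv γ (θ α β) = 0

namespace FedosovDatum

open WickAlg

variable {ι A : Type*} [Fintype ι] [DecidableEq ι] [CommRing A] [Algebra ℂ A]
  (S : FedosovDatum ι A)

/-- The tensor `Λ^{αβ} = θ^{αβ} - i g^{αβ}`. -/
noncomputable def Λ : Matrix ι ι A := S.θup - Complex.I • S.gup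

/-- The Wick algebra of the datum. -/
abbrev W : Type _ := WickAlg S.Λ

/-- The covariant derivative in the direction of the coordinate `α`. -/
noncomputable def D (α : ι) : S.W →ₗ[ℂ] S.W := cov (S.pdv α) (S.Γ α)

/-- The torsion `T^τ_{αβ} = Γ^τ_{αβ} - Γ^τ_{βα}`. -/
def T (τ α β : ι) : A := S.Γ β τ α - S.Γ α τ β

/-- The matrix `R^τ_φ` of the curvature in the plane `αβ`. -/
noncomputable def R (α β : ι) : Matrix ι ι A :=
  (S.Γ α).map (S.pdv β) - (S.Γ β).map (S.pdv α) + (S.Γ β * S.Γ α - S.Γ α * S.Γ β)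

/-- The component `αβ` of the torsion operator `z^γ θ_{γτ} T^τ_{αβ}`, as a power series. -/
noncomputable def tM (α β : ι) : MvPowerSeries ι A :=
  ∑ γ, ∑ τ, (S.θ γ τ * S.T τ α β) • MvPowerSeries.X γ

/-- The component `αβ` of the curvature operator `(1/2) z^γ z^φ θ_{γτ} R^τ_{φαβ}`, as a power
series. -/
noncomputable def ρM (α β : ι) : MvPowerSeries ι A :=
  ∑ γ, ∑ φ, ∑ τ, ((1 / 2 : ℂ) • (S.θ γ τ * S.R α β τ φ)) •
    (MvPowerSeries.X γ * MvPowerSeries.X φ)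

/-- The torsion operator. -/
noncomputable def t (α β : ι) : S.W := ofM (S.tM α β)

/-- The curvature operator. -/
noncomputable def ρ (α β : ι) : S.W := ofM (S.ρM α β)

theorem θup_mul_θ' : S.θup * S.θ = -1 := by
  have h := S.θup_mul_θ
  rw [S.θup_antisymm, neg_mul] at h
  rw [← h, neg_neg]

theorem θ_mul_θup' : S.θ * S.θup = -1 := by
  have h : -S.θup * S.θ = 1 := by rw [neg_mul, S.θup_mul_θ', neg_neg]
  have h2 := mul_eq_one_comm.1 h
  rw [mul_neg] at h2
  rw [← h2, neg_neg]

theorem θ_antisymm : S.θᵀ = -S.θ := by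
  have h : S.θᵀ * S.θup = 1 := by
    have := congrArg Matrix.transpose S.θup_mul_θ
    rwa [Matrix.transpose_mul, Matrix.transpose_transpose, Matrix.transpose_one] at this
  calc S.θᵀ = S.θᵀ * (S.θup * -S.θ) := by rw [mul_neg, S.θup_mul_θ', neg_neg, mul_one]
    _ = -S.θ := by rw [← mul_assoc, h, one_mul]

theorem Λ_transpose : S.Λᵀ = -S.θup - Complex.I • S.gup := by
  rw [Λ, Matrix.transpose_sub, Matrix.transpose_smul, S.gup_symm, S.θup_antisymm]

theorem Λ_sub_transpose (α β : ι) : S.Λ α β - S.Λ β α = (2 : ℂ) • S.θup α β := by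
  have h := congrFun (congrFun S.Λ_transpose α) β
  rw [Matrix.transpose_apply] at h
  rw [h, Λ, Matrix.sub_apply, Matrix.sub_apply, Matrix.neg_apply, two_smul]
  abel

theorem parallel_Λ (μ : ι) : IsParallel (S.pdv μ) (S.Γ μ) S.Λ := by
  have h1 := S.parallel_θup μ
  have h2 := S.parallel_gup μ
  unfold IsParallel at *
  have e : (S.Λ).map (S.pdv μ) = S.θup.map (S.pdv μ) - Complex.I • S.gup.map (S.pdv μ) := by
    ext i j
    simp [Λ]
  rw [e, Λ, mul_sub, sub_mul, mul_smul_comm, smul_mul_assoc]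
  calc _ = (S.θup.map (S.pdv μ) + S.Γ μ * S.θup + S.θup * (S.Γ μ)ᵀ) -
        Complex.I • (S.gup.map (S.pdv μ) + S.Γ μ * S.gup + S.gup * (S.Γ μ)ᵀ) := by
        simp only [smul_add]; abel
    _ = 0 := by rw [h1, h2, smul_zero, sub_zero]

theorem D_mul (α : ι) (a b : S.W) : S.D α (a * b) = S.D α a * b + a * S.D α b :=
  cov_mul (S.parallel_Λ α) a b

theorem D_br (α : ι) (a b : S.W) : S.D α (br a b) = br (S.D α a) b + br a (S.D α b) :=
  cov_br (S.parallel_Λ α) a b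

theorem covDer_comm_R (α β : ι) (f : MvPowerSeries ι A) :
    covDer (S.pdv α) (S.Γ α) (covDer (S.pdv β) (S.Γ β) f) -
      covDer (S.pdv β) (S.Γ β) (covDer (S.pdv α) (S.Γ α) f) = linField (S.R α β) f :=
  covDer_comm (S.pdv_comm α β) _ _ f

theorem T_antisymm (τ α β : ι) : S.T τ α β = -S.T τ β α := by
  simp [T]

theorem R_antisymm (α β : ι) : S.R α β = -S.R β α := by
  simp only [R]; abel

/-- The curvature annihilates the parallel tensor `Λ`: the commutator of two covariant derivatives
is a derivation of the Wick product, and is applied here to `z^μ ∘ z^ν`. -/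
theorem R_mul_Λ (α β : ι) : S.R α β * S.Λ + S.Λ * (S.R α β)ᵀ = 0 := by
  ext μ ν
  have h : ∀ f g : MvPowerSeries ι A, linField (S.R α β) (bidiff S.Λ 1 f g) =
      bidiff S.Λ 1 (linField (S.R α β) f) g + bidiff S.Λ 1 f (linField (S.R α β) g) := by
    intro f g
    simp only [← covDer_comm_R, covDer_bidiff (S.parallel_Λ α), covDer_bidiff (S.parallel_Λ β),
      map_add, map_sub, LinearMap.sub_apply]
    abel
  have h1 := h (rowForm 1 μ) (rowForm 1 ν)
  rw [linField_rowForm, linField_rowForm, bidiff_one_rowForm, bidiff_one_rowForm,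
    bidiff_one_rowForm, linField_apply] at h1
  simp only [MvPowerSeries.pderiv_C, mul_zero, sum_const_zero, one_mul, Matrix.transpose_one,
    mul_one, ← map_add] at h1
  have h2 := congrArg (MvPowerSeries.constantCoeff) h1
  simpa using h2.symm

/-- The curvature annihilates `θ` and `g` separately: these are the antisymmetric and the symmetric
part of `Λ`. -/
theorem R_mul_θup_gup (α β : ι) : S.R α β * S.θup + S.θup * (S.R α β)ᵀ = 0 ∧
    S.R α β * S.gup + S.gup * (S.R α β)ᵀ = 0 := by
  have h := S.R_mul_Λ α β
  have h' : S.R α β * S.Λᵀ + S.Λᵀ * (S.R α β)ᵀ = 0 := by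
    have := congrArg Matrix.transpose h
    rw [Matrix.transpose_add, Matrix.transpose_mul, Matrix.transpose_mul,
      Matrix.transpose_transpose, Matrix.transpose_zero, add_comm] at this
    exact this
  rw [Λ_transpose] at h'
  rw [Λ] at h
  simp only [mul_sub, sub_mul, mul_neg, neg_mul, mul_smul_comm, smul_mul_assoc] at h h'
  constructor
  · have e : (2 : ℂ) • (S.R α β * S.θup + S.θup * (S.R α β)ᵀ) = 0 := by
      linear_combination (norm := module) (1 : ℂ) • h - (1 : ℂ) • h'
    exact (smul_eq_zero_iff_right (by norm_num)).1 e
  · have e : (-2 * Complex.I) • (S.R α β * S.gup + S.gup * (S.R α β)ᵀ) = 0 := by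
      linear_combination (norm := module) (1 : ℂ) • h + (1 : ℂ) • h'
    exact (smul_eq_zero_iff_right (by simp)).1 e

/-- The curvature with lowered index is symmetric. -/
theorem θ_mul_R_symm (α β : ι) : (S.θ * S.R α β)ᵀ = S.θ * S.R α β := by
  have h := (S.R_mul_θup_gup α β).1
  have h2 : S.θ * (S.R α β * S.θup + S.θup * (S.R α β)ᵀ) * S.θ = 0 := by rw [h]; simp
  have h3 : S.θ * (S.R α β * S.θup + S.θup * (S.R α β)ᵀ) * S.θ =
      S.θ * S.R α β * (S.θup * S.θ) + S.θ * S.θup * ((S.R α β)ᵀ * S.θ) := by noncomm_ring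
  rw [h3, S.θup_mul_θ', S.θ_mul_θup'] at h2
  rw [Matrix.transpose_mul, S.θ_antisymm, mul_neg]
  rw [mul_neg, mul_one, neg_mul, one_mul] at h2
  rw [← sub_eq_zero]
  rw [← h2]
  abel

end FedosovDatum
end LagrangeFedosov

namespace LagrangeFedosov

open Finset

namespace FedosovDatum

open WickAlg

variable {ι A : Type*} [Fintype ι] [DecidableEq ι] [CommRing A] [Algebra ℂ A]
  (S : FedosovDatum ι A)

/-! ### The torsion and curvature operators generate the commutators of `δ` and `D` -/

theorem pderiv_tM (α β ν : ι) : MvPowerSeries.pderiv A ν (S.tM α β) =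
    MvPowerSeries.C (∑ τ, S.θ ν τ * S.T τ α β) := by
  have : S.tM α β = ∑ γ, (∑ τ, S.θ γ τ * S.T τ α β) • MvPowerSeries.X γ := by
    simp only [tM, sum_smul]
  rw [this, map_sum]
  simp only [Derivation.map_smul, MvPowerSeries.pderiv_X]
  rw [sum_eq_single ν]
  · simp [MvPowerSeries.smul_eq_C_mul]
  · intro b _ hb
    simp [Pi.single_eq_of_ne hb]
  · simp

theorem ρM_eq (α β : ι) : S.ρM α β =
    (1 / 2 : ℂ) • ∑ γ, MvPowerSeries.X γ * rowForm (S.θ * S.R α β) γ := by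
  simp only [ρM, rowForm, Matrix.mul_apply, sum_smul, smul_sum, mul_sum, mul_smul_comm, smul_assoc]

theorem pderiv_ρM (α β ν : ι) : MvPowerSeries.pderiv A ν (S.ρM α β) =
    rowForm (S.θ * S.R α β) ν := by
  rw [ρM_eq, pderiv_csmul, map_sum]
  simp only [Derivation.leibniz, pderiv_rowForm, MvPowerSeries.pderiv_X, smul_eq_mul,
    sum_add_distrib]
  have h1 : ∑ γ, MvPowerSeries.X γ * MvPowerSeries.C ((S.θ * S.R α β) γ ν) =
      rowForm (S.θ * S.R α β) ν := by
    rw [rowForm]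
    refine sum_congr rfl fun γ _ => ?_
    rw [MvPowerSeries.smul_eq_C_mul, mul_comm, ← S.θ_mul_R_symm α β, Matrix.transpose_apply,
      S.θ_mul_R_symm α β]
  have h2 : ∑ γ, rowForm (S.θ * S.R α β) γ * Pi.single (M := fun _ => MvPowerSeries ι A) ν 1 γ =
      rowForm (S.θ * S.R α β) ν := by
    rw [sum_eq_single ν]
    · simp
    · intro b _ hb
      simp [Pi.single_eq_of_ne hb]
    · simp
  rw [h1, h2, ← two_smul ℂ, smul_smul]
  norm_num

theorem sum_Λ_sub (u w : ι → MvPowerSeries ι A) :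
    (Complex.I / 2) • ∑ α, ∑ β, (S.Λ α β - S.Λ β α) • (u α * w β) =
      Complex.I • ∑ β, (∑ α, S.θup α β • u α) * w β := by
  rw [sum_comm, smul_sum, smul_sum]
  simp only [smul_sum, sum_mul, Λ_sub_transpose]
  refine sum_congr rfl fun β _ => sum_congr rfl fun α _ => ?_
  rw [smul_assoc, smul_smul, smul_mul_assoc]
  congr 1
  ring

theorem br_t_apply (α β : ι) (a : S.W) (r : ℕ) :
    br (S.t α β) a r = Complex.I • ∑ τ, S.T τ α β • del τ a r := by
  rw [t, br_ofM_linear (fun μ ν => by rw [pderiv_tM, MvPowerSeries.pderiv_C]),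
    S.sum_Λ_sub (fun ν => MvPowerSeries.pderiv A ν (S.tM α β))]
  congr 1
  refine sum_congr rfl fun τ _ => ?_
  have h : ∑ ν, S.θup ν τ * ∑ σ, S.θ ν σ * S.T σ α β = S.T τ α β := by
    have h1 : ∀ σ, ∑ ν, S.θup ν τ * S.θ ν σ = (1 : Matrix ι ι A) τ σ := fun σ =>
      congrFun (congrFun S.θup_mul_θ τ) σ
    simp only [mul_sum, ← mul_assoc]
    rw [sum_comm]
    simp only [← sum_mul, h1, Matrix.one_apply, ite_mul, one_mul, zero_mul, sum_ite_eq, mem_univ,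
      if_true]
  simp only [pderiv_tM, MvPowerSeries.smul_eq_C_mul, ← map_mul, ← map_sum, h, del_apply]

theorem T_eq (τ α β : ι) : S.T τ α β = S.Γ β τ α - S.Γ α τ β := rfl

/-- The torsion operator generates the commutator of `δ` and `D`. -/
theorem I_smul_br_t (α β : ι) (a : S.W) : Complex.I • br (S.t α β) a =
    S.D α (del β a) - del β (S.D α a) - (S.D β (del α a) - del α (S.D β a)) := by
  refine ext_v fun r => ?_
  rw [val_csmul, br_t_apply, smul_smul, Complex.I_mul_I]
  simp only [D, del_cov, val_sub, val_sum, val_smul, T_eq, sub_smul, sum_sub_distrib,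
    neg_smul, one_smul]
  abel

/-- The contraction of the curvature with two tensors `Λ` is symmetric, so that it does not
contribute to commutators with the curvature operator. -/
theorem θ_mul_R_mul (α β : ι) :
    S.Λᵀ * (S.θ * S.R α β) * S.Λ = S.Λ * (S.θ * S.R α β) * S.Λᵀ := by
  obtain ⟨h1, h2⟩ := S.R_mul_θup_gup α β
  have e1 : S.θup * (S.θ * S.R α β) * S.gup = S.gup * (S.θ * S.R α β) * S.θup := by
    have a1 : S.R α β * S.θup = -(S.θup * (S.R α β)ᵀ) := eq_neg_of_add_eq_zero_left h1
    have a2 : S.R α β * S.gup = -(S.gup * (S.R α β)ᵀ) := eq_neg_of_add_eq_zero_left h2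
    rw [← mul_assoc, S.θup_mul_θ', neg_mul, one_mul, neg_mul, a2, neg_neg, mul_assoc S.gup,
      mul_assoc S.θ, a1, mul_neg, ← mul_assoc S.θ, S.θ_mul_θup', neg_mul, one_mul, neg_neg]
  rw [Λ_transpose, Λ]
  simp only [sub_mul, mul_sub, neg_mul, mul_neg, smul_mul_assoc, mul_smul_comm, e1, smul_sub,
    smul_neg]
  abel

theorem bidiff_two_ρM (α β : ι) (g : MvPowerSeries ι A) :
    bidiff S.Λ 2 (S.ρM α β) g = bidiff S.Λ 2 g (S.ρM α β) := by
  have h := S.θ_mul_R_mul α β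
  set Q := S.θ * S.R α β with hQ
  have hQs : Qᵀ = Q := S.θ_mul_R_symm α β
  have d2 : ∀ μ ν, MvPowerSeries.pderiv A μ (MvPowerSeries.pderiv A ν (S.ρM α β)) =
      MvPowerSeries.C (Q ν μ) := fun μ ν => by rw [pderiv_ρM, pderiv_rowForm]
  have l : bidiff S.Λ 2 (S.ρM α β) g = ∑ b, ∑ b', (S.Λᵀ * Q * S.Λ) b b' •
      MvPowerSeries.pderiv A b' (MvPowerSeries.pderiv A b g) := by
    simp only [bidiff_succ, bidiff_zero, d2, Matrix.mul_apply, Matrix.transpose_apply, sum_smul,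
      smul_sum, sum_mul, ← MvPowerSeries.smul_eq_C_mul, smul_smul]
    rw [sum_comm]
    refine sum_congr rfl fun b _ => ?_
    calc _ = ∑ a, ∑ b', ∑ a', (S.Λ a b * (S.Λ a' b' * Q a a')) •
          MvPowerSeries.pderiv A b' (MvPowerSeries.pderiv A b g) :=
          sum_congr rfl fun a _ => sum_comm
      _ = ∑ b', ∑ a, ∑ a', (S.Λ a b * (S.Λ a' b' * Q a a')) •
          MvPowerSeries.pderiv A b' (MvPowerSeries.pderiv A b g) := sum_comm
      _ = _ := by
          refine sum_congr rfl fun b' _ => ?_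
          rw [sum_comm]
          refine sum_congr rfl fun a' _ => sum_congr rfl fun a _ => ?_
          congr 1; ring
  have r : bidiff S.Λ 2 g (S.ρM α β) = ∑ b, ∑ b', (S.Λ * Q * S.Λᵀ) b b' •
      MvPowerSeries.pderiv A b' (MvPowerSeries.pderiv A b g) := by
    simp only [bidiff_succ, bidiff_zero, d2, Matrix.mul_apply, Matrix.transpose_apply, sum_smul,
      smul_sum, sum_mul, mul_comm _ (MvPowerSeries.C _), ← MvPowerSeries.smul_eq_C_mul, smul_smul]
    refine sum_congr rfl fun b _ => ?_
    rw [sum_comm]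
    refine sum_congr rfl fun b' _ => ?_
    rw [sum_comm]
    refine sum_congr rfl fun a' _ => sum_congr rfl fun a _ => ?_
    congr 1; ring
  rw [l, r, h]

theorem bidiff_ρM_eq_zero (α β : ι) (k : ℕ) (g : MvPowerSeries ι A) (hk : 3 ≤ k) :
    bidiff S.Λ k (S.ρM α β) g = 0 ∧ bidiff S.Λ k g (S.ρM α β) = 0 := by
  obtain ⟨k, rfl⟩ := Nat.exists_eq_add_of_le' hk
  constructor <;> simp [bidiff_succ, pderiv_ρM, pderiv_rowForm]

/-- The curvature operator generates the square of `D`. -/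
theorem I_smul_br_ρ (α β : ι) (a : S.W) : Complex.I • br (S.ρ α β) a =
    -(S.D α (S.D β a) - S.D β (S.D α a)) := by
  refine ext_v fun r => ?_
  rw [val_csmul, ρ, br_ofM (S.bidiff_two_ρM α β) (S.bidiff_ρM_eq_zero α β),
    S.sum_Λ_sub (fun ν => MvPowerSeries.pderiv A ν (S.ρM α β)), smul_smul, Complex.I_mul_I,
    neg_smul, one_smul, val_neg, val_sub]
  simp only [D, cov_apply]
  rw [covDer_comm_R, linField_apply]
  congr 1
  refine sum_congr rfl fun τ _ => ?_
  congr 1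
  have h1 : ∀ σ, ∑ ν, S.θup ν τ * (S.θ * S.R α β) ν σ = S.R α β τ σ := fun σ => by
    have := congrArg (fun P : Matrix ι ι A => (P * S.R α β) τ σ) S.θup_mul_θ
    simp only [Matrix.mul_assoc, Matrix.one_mul] at this
    exact this
  simp only [pderiv_ρM, rowForm, smul_sum, smul_smul]
  rw [sum_comm]
  simp only [← sum_smul, h1]

/-- An element whose commutators all vanish, and which has no part of `z`-degree zero, vanishes. -/
theorem eq_zero_of_br {q : S.W} (h : ∀ μ, br q (ofM (MvPowerSeries.X μ)) = 0)
    (h0 : ∀ r, MvPowerSeries.constantCoeff (q r) = 0) : q = 0 := by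
  have h1 : ∀ μ r, ∑ β, S.θup μ β • del β q r = 0 := by
    intro μ r
    have hz : ∀ α β, MvPowerSeries.pderiv A α (MvPowerSeries.pderiv A β
        (MvPowerSeries.X μ : MvPowerSeries ι A)) = 0 := by
      intro α β
      rw [← rowForm_one, pderiv_rowForm, MvPowerSeries.pderiv_C]
    have e := congrFun (h μ) r
    rw [br_antisymm, val_neg, br_ofM_linear hz,
      S.sum_Λ_sub (fun ν => MvPowerSeries.pderiv A ν (MvPowerSeries.X μ))] at e
    simp only [← rowForm_one μ, pderiv_rowForm, MvPowerSeries.smul_eq_C_mul, ← map_mul,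
      ← map_sum, Matrix.one_apply, mul_ite, mul_one, mul_zero, sum_ite_eq, mem_univ, if_true] at e
    have e2 : Complex.I • ∑ β, MvPowerSeries.C (S.θup μ β) *
        MvPowerSeries.pderiv A β (q r) = 0 := neg_eq_zero.1 e
    have e3 := (smul_eq_zero_iff_right Complex.I_ne_zero).1 e2
    simpa only [MvPowerSeries.smul_eq_C_mul, del_apply] using e3
  have h2 : ∀ ν, del ν q = 0 := by
    intro ν
    refine ext_v fun r => ?_
    have e : ∑ μ, S.θ ν μ • ∑ β, S.θup μ β • del β q r = 0 :=
      sum_eq_zero fun μ _ => by rw [h1 μ r, smul_zero]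
    simp only [smul_sum, smul_smul] at e
    rw [sum_comm] at e
    have h3 : ∀ β, ∑ μ, S.θ ν μ * S.θup μ β = (-1 : Matrix ι ι A) ν β := fun β =>
      congrFun (congrFun S.θ_mul_θup' ν) β
    simp only [← sum_smul, h3, Matrix.neg_apply, Matrix.one_apply, neg_smul, ite_smul, one_smul,
      zero_smul, sum_neg_distrib, sum_ite_eq, mem_univ, if_true] at e
    exact neg_eq_zero.1 e
  refine eq_zero_of_num_zero ?_ h0
  rw [← sum_mulX_del]
  exact sum_eq_zero fun α _ => by rw [h2, map_zero]

/-! ### Bianchi identities -/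

theorem constantCoeff_cov (α : ι) (a : S.W) (r : ℕ) :
    MvPowerSeries.constantCoeff (S.D α a r) =
      S.pdv α (MvPowerSeries.constantCoeff (a r)) := by
  rw [D, cov_apply, covDer_apply, linField_apply, map_sub, map_sum]
  have : ∀ γ, MvPowerSeries.constantCoeff
      (rowForm (S.Γ α) γ * MvPowerSeries.pderiv A γ (a r)) = 0 := by
    intro γ
    simp [rowForm]
  simp only [this, sum_const_zero, sub_zero]
  rfl

theorem constantCoeff_tM (α β : ι) : MvPowerSeries.constantCoeff (S.tM α β) = 0 := by
  simp [tM]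

theorem constantCoeff_ρM (α β : ι) : MvPowerSeries.constantCoeff (S.ρM α β) = 0 := by
  rw [ρM_eq, ← algebraMap_smul A]
  simp [rowForm]

theorem constantCoeff_ofM {f : MvPowerSeries ι A} (hf : MvPowerSeries.constantCoeff f = 0)
    (r : ℕ) : MvPowerSeries.constantCoeff ((ofM f : S.W) r) = 0 := by
  rw [ofM_apply]
  split_ifs <;> simp [hf]

/-- The second Bianchi identity `D R = 0`: the commutators with `D R` vanish by the Jacobi identity
for covariant derivatives. -/
theorem bianchi_D_ρ (α β γ : ι) :
    S.D α (S.ρ β γ) + S.D β (S.ρ γ α) + S.D γ (S.ρ α β) = 0 := by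
  refine S.eq_zero_of_br (fun μ => ?_) fun r => ?_
  · generalize (ofM (MvPowerSeries.X μ) : S.W) = a
    have key : ∀ α β γ, Complex.I • br (S.D α (S.ρ β γ)) a =
        -(S.D α (S.D β (S.D γ a)) - S.D α (S.D γ (S.D β a))) +
          (S.D β (S.D γ (S.D α a)) - S.D γ (S.D β (S.D α a))) := by
      intro α β γ
      have h1 := congrArg (S.D α) (S.I_smul_br_ρ β γ a)
      rw [map_smul, D_br, smul_add, I_smul_br_ρ, map_neg, map_sub] at h1
      rw [eq_sub_of_add_eq h1]
      abel
    have : Complex.I • br (S.D α (S.ρ β γ) + S.D β (S.ρ γ α) + S.D γ (S.ρ α β)) a = 0 := by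
      simp only [map_add, LinearMap.add_apply, smul_add, key]
      abel
    exact (smul_eq_zero_iff_right Complex.I_ne_zero).1 this
  · simp [ρ, constantCoeff_cov, constantCoeff_ofM, constantCoeff_ρM]

/-- The first Bianchi identity `δ R = D T`: both sides generate the same commutators. -/
theorem bianchi_del_ρ (α β γ : ι) :
    del α (S.ρ β γ) + del β (S.ρ γ α) + del γ (S.ρ α β) =
      S.D α (S.t β γ) + S.D β (S.t γ α) + S.D γ (S.t α β) := by
  rw [← sub_eq_zero]
  refine S.eq_zero_of_br (fun μ => ?_) fun r => ?_
  · generalize (ofM (MvPowerSeries.X μ) : S.W) = a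
    have key : ∀ α β γ, Complex.I • br (del α (S.ρ β γ)) a =
        -(del α (S.D β (S.D γ a)) - del α (S.D γ (S.D β a))) +
          (S.D β (S.D γ (del α a)) - S.D γ (S.D β (del α a))) := by
      intro α β γ
      have h1 := congrArg (del α) (S.I_smul_br_ρ β γ a)
      rw [map_smul, del_br, smul_add, I_smul_br_ρ, map_neg, map_sub] at h1
      rw [eq_sub_of_add_eq h1]
      abel
    have key2 : ∀ α β γ, Complex.I • br (S.D α (S.t β γ)) a =
        S.D α (S.D β (del γ a)) - S.D α (del γ (S.D β a)) -
          (S.D α (S.D γ (del β a)) - S.D α (del β (S.D γ a))) -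
        (S.D β (del γ (S.D α a)) - del γ (S.D β (S.D α a)) -
          (S.D γ (del β (S.D α a)) - del β (S.D γ (S.D α a)))) := by
      intro α β γ
      have h1 := congrArg (S.D α) (S.I_smul_br_t β γ a)
      rw [map_smul, D_br, smul_add, I_smul_br_t, map_sub, map_sub, map_sub] at h1
      rw [eq_sub_of_add_eq h1]
    have : Complex.I • br (del α (S.ρ β γ) + del β (S.ρ γ α) + del γ (S.ρ α β) -
        (S.D α (S.t β γ) + S.D β (S.t γ α) + S.D γ (S.t α β))) a = 0 := by
      simp only [map_add, map_sub, LinearMap.add_apply, LinearMap.sub_apply, smul_add, smul_sub,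
        key, key2]
      abel
    exact (smul_eq_zero_iff_right Complex.I_ne_zero).1 this
  · have h : ∀ α β γ, MvPowerSeries.constantCoeff (del α (S.ρ β γ) r) = 0 := by
      intro α β γ
      rw [del_apply, ρ, ofM_apply]
      split_ifs
      · rw [pderiv_ρM]; simp [rowForm]
      · simp
    simp [t, constantCoeff_cov, constantCoeff_ofM, constantCoeff_tM, h]

theorem pdv_θ (μ β γ : ι) : S.pdv μ (S.θ β γ) =
    ∑ τ, (S.θ β τ * S.Γ μ τ γ + S.Γ μ τ β * S.θ τ γ) := by
  have h : S.θ.map (S.pdv μ) = S.θ * S.Γ μ + (S.Γ μ)ᵀ * S.θ := by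
    have h1 := congrArg (fun P : Matrix ι ι A => P.map (S.pdv μ)) S.θup_mul_θ'
    rw [Matrix_map_derivation_mul, Matrix_map_derivation_neg, Matrix_map_derivation_one,
      neg_zero] at h1
    have h2 := S.parallel_θup μ
    unfold IsParallel at h2
    have h3 : S.θup.map (S.pdv μ) = -(S.Γ μ * S.θup) - S.θup * (S.Γ μ)ᵀ := by
      rw [← sub_eq_zero, ← h2]; abel
    have h4 := congrArg (fun P => S.θ * P) h1
    simp only [mul_add, mul_zero] at h4
    rw [← mul_assoc S.θ S.θup, S.θ_mul_θup', h3] at h4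
    have h5 : S.θ * ((-(S.Γ μ * S.θup) - S.θup * (S.Γ μ)ᵀ) * S.θ) =
        -(S.θ * S.Γ μ * (S.θup * S.θ)) - S.θ * S.θup * (S.Γ μ)ᵀ * S.θ := by noncomm_ring
    rw [h5, S.θup_mul_θ', S.θ_mul_θup'] at h4
    rw [← sub_eq_zero, ← neg_eq_zero, ← h4]
    noncomm_ring
  have h2 := congrFun (congrFun h β) γ
  simpa [Matrix.mul_apply, sum_add_distrib] using h2

/-- `δ T = 0`, a consequence of `dθ = 0` and `D θ = 0`. -/
theorem del_t_cyclic (α β γ : ι) :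
    del α (S.t β γ) + del β (S.t γ α) + del γ (S.t α β) = 0 := by
  have h : ∀ α β γ, (del α (S.t β γ) : S.W) =
      ofM (MvPowerSeries.C (∑ τ, S.θ α τ * S.T τ β γ)) := by
    intro α β γ
    refine ext_v fun r => ?_
    rw [del_apply, t, ofM_apply, ofM_apply]
    split_ifs
    · rw [pderiv_tM]
    · simp
  rw [h, h, h, ← map_add, ← map_add, ← map_add, ← map_add, ← sum_add_distrib, ← sum_add_distrib]
  have h2 := S.closed α β γ
  rw [pdv_θ, pdv_θ, pdv_θ, ← sum_add_distrib, ← sum_add_distrib] at h2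
  have anti : ∀ α β, S.θ α β = -S.θ β α := fun α β => congrFun (congrFun S.θ_antisymm β) α
  have : ∑ τ, (S.θ α τ * S.T τ β γ + S.θ β τ * S.T τ γ α + S.θ γ τ * S.T τ α β) = 0 := by
    rw [← h2]
    refine sum_congr rfl fun τ _ => ?_
    rw [anti τ γ, anti τ α, anti τ β]
    simp only [T]
    ring
  rw [this, map_zero, map_zero]

end FedosovDatum
end LagrangeFedosov

namespace LagrangeFedosov

open Finset

/-! ### The element of Fedosov -/

namespace WickAlg

variable {ι A : Type*} [Fintype ι] [DecidableEq ι] [CommRing A] [Algebra ℂ A] {Λ : Matrix ι ι A}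

/-- The operator `δ⁻¹` on forms of degree `1`. -/
noncomputable def dinv₁ (b : ι → WickAlg Λ) : WickAlg Λ := fun r =>
  (fun m => ((m.degree : ℕ) : ℂ)⁻¹ •
      MvPowerSeries.coeff m (∑ α, MvPowerSeries.X α * b α r) : (ι →₀ ℕ) → A)

/-- The operator `δ⁻¹` on forms of degree `2`. -/
noncomputable def dinv₂ (c : ι → ι → WickAlg Λ) (β : ι) : WickAlg Λ := fun r =>
  (fun m => ((m.degree + 1 : ℕ) : ℂ)⁻¹ •
      MvPowerSeries.coeff m (∑ α, MvPowerSeries.X α * c α β r) : (ι →₀ ℕ) → A)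

/-- Division by `v`, with the term of `v`-degree zero dropped. -/
def unshift (a : WickAlg Λ) : WickAlg Λ := fun r => a (r + 1)

theorem natCast_mul_inv_smul {k : ℕ} (hk : k ≠ 0) (x : A) : (k : A) * ((k : ℂ)⁻¹ • x) = x := by
  have hk' : (k : ℂ) ≠ 0 := by exact_mod_cast hk
  have h2 : (k : A) = algebraMap ℂ A (k : ℂ) := by simp
  rw [h2, ← Algebra.smul_def, smul_smul, mul_inv_cancel₀ hk', one_smul]

theorem num_dinv₁ (b : ι → WickAlg Λ) : num 0 (dinv₁ b) = ∑ α, mulX α (b α) := by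
  ext r m
  rw [coeff_num, val_sum]
  simp only [mulX_apply]
  change _ * ((m.degree : ℂ)⁻¹ • MvPowerSeries.coeff m (∑ α, MvPowerSeries.X α * b α r)) = _
  by_cases hm : m = 0
  · simp [hm]
  · exact natCast_mul_inv_smul (fun h => hm ((Finsupp.degree_eq_zero_iff m).1 h)) _

theorem constantCoeff_dinv₁ (b : ι → WickAlg Λ) (r : ℕ) :
    MvPowerSeries.constantCoeff (dinv₁ b r) = 0 := by
  change ((Finsupp.degree 0 : ℕ) : ℂ)⁻¹ •
    MvPowerSeries.coeff 0 (∑ α, MvPowerSeries.X α * b α r) = 0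
  simp

theorem num_dinv₂ (c : ι → ι → WickAlg Λ) (β : ι) :
    num 1 (dinv₂ c β) = ∑ α, mulX α (c α β) := by
  ext r m
  rw [coeff_num, val_sum]
  simp only [mulX_apply]
  exact natCast_mul_inv_smul (Nat.succ_ne_zero _) _

theorem num_mulX (c : ℕ) (α : ι) (a : WickAlg Λ) :
    num c (mulX α a) = mulX α (num (c + 1) a) := by
  ext r m
  rw [coeff_num, mulX_apply, mulX_apply, coeff_X_mul, coeff_X_mul]
  split_ifs with h
  · simp
  · rw [coeff_num]
    have h3 : Finsupp.single α 1 ≤ m := by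
      rw [Finsupp.single_le_iff]; exact Nat.one_le_iff_ne_zero.2 h
    have h4 := congrArg Finsupp.degree (tsub_add_cancel_of_le h3)
    rw [map_add, Finsupp.degree_single] at h4
    rw [← h4]
    push_cast
    ring

/-- `δ⁻¹ δ⁻¹ = 0`. -/
theorem sum_mulX_dinv₂ {c : ι → ι → WickAlg Λ} (hc : ∀ α β, c α β = -c β α) :
    ∑ β, mulX β (dinv₂ c β) = 0 := by
  refine eq_zero_of_num_zero ?_ fun r => ?_
  · have h : ∑ β, ∑ α, mulX β (mulX α (c α β)) = 0 := by
      have e : ∑ β, ∑ α, mulX β (mulX α (c α β)) = -∑ β, ∑ α, mulX β (mulX α (c α β)) := by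
        conv_lhs => rw [sum_comm]
        rw [← sum_neg_distrib]
        refine sum_congr rfl fun α _ => ?_
        rw [← sum_neg_distrib]
        refine sum_congr rfl fun β _ => ?_
        rw [mulX_mulX, hc α β, map_neg, map_neg]
      have e2 : (2 : ℂ) • ∑ β, ∑ α, mulX β (mulX α (c α β)) = 0 := by
        rw [two_smul]
        nth_rewrite 1 [e]
        exact neg_add_cancel _
      exact (smul_eq_zero_iff_right (by norm_num)).1 e2
    simpa only [map_sum, num_mulX, zero_add, num_dinv₂] using h
  · simp [mulX_apply]

/-- Homogeneous elements of total degree `k`. -/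
def IsPure (k : ℕ) (a : WickAlg Λ) : Prop := dp k a = a

theorem IsPure.dp_of_ne {j k : ℕ} {a : WickAlg Λ} (h : IsPure k a) (hjk : j ≠ k) : dp j a = 0 := by
  rw [← h, dp_dp, if_neg hjk]

theorem isPure_zero (k : ℕ) : IsPure k (0 : WickAlg Λ) := map_zero _

theorem IsPure.add {k : ℕ} {a b : WickAlg Λ} (ha : IsPure k a) (hb : IsPure k b) :
    IsPure k (a + b) := by
  rw [IsPure, map_add, ha, hb]

theorem IsPure.sub {k : ℕ} {a b : WickAlg Λ} (ha : IsPure k a) (hb : IsPure k b) :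
    IsPure k (a - b) := by
  rw [IsPure, map_sub, ha, hb]

theorem dp_csmul (k : ℕ) (c : ℂ) (a : WickAlg Λ) : dp k (c • a) = c • dp k a :=
  LinearMap.map_smul_of_tower _ _ _

theorem IsPure.csmul {k : ℕ} {a : WickAlg Λ} (c : ℂ) (ha : IsPure k a) : IsPure k (c • a) := by
  rw [IsPure, dp_csmul, ha]

theorem IsPure.smul {k : ℕ} {a : WickAlg Λ} (c : A) (ha : IsPure k a) : IsPure k (c • a) := by
  rw [IsPure, map_smul, ha]

theorem isPure_sum {κ : Type*} {s : Finset κ} {k : ℕ} {a : κ → WickAlg Λ}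
    (ha : ∀ i ∈ s, IsPure k (a i)) : IsPure k (∑ i ∈ s, a i) := by
  rw [IsPure, map_sum]
  exact sum_congr rfl ha

theorem IsPure.mulX {k : ℕ} {a : WickAlg Λ} (ha : IsPure k a) (α : ι) :
    IsPure (k + 1) (mulX α a) := by
  rw [IsPure, dp_mulX_succ, ha]

theorem IsPure.cov {k : ℕ} {a : WickAlg Λ} (ha : IsPure k a) (d : Derivation ℂ A A)
    (G : Matrix ι ι A) : IsPure k (cov d G a) := by
  rw [IsPure, dp_cov, ha]

theorem IsPure.br {i j k : ℕ} {a b : WickAlg Λ} (ha : IsPure i a) (hb : IsPure j b)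
    (h : i + j = k + 2) : IsPure k (br a b) := by
  rw [IsPure, dp_br, sum_eq_single (i, j)]
  · rw [ha, hb]
  · rintro ⟨x, y⟩ hxy hne
    have hxy' := HasAntidiagonal.mem_antidiagonal.1 hxy
    by_cases hx : x = i
    · exact absurd (Prod.ext hx (by dsimp only at hxy' ⊢; omega)) hne
    · simp [ha.dp_of_ne hx]
  · exact fun h' => absurd (HasAntidiagonal.mem_antidiagonal.2 h) h'

theorem isPure_dinv₂ {k : ℕ} {c : ι → ι → WickAlg Λ} (hc : ∀ α β, IsPure k (c α β)) (β : ι) :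
    IsPure (k + 1) (dinv₂ c β) := by
  rw [IsPure, ← sub_eq_zero]
  apply num_succ_injective 0
  rw [map_sub, ← dp_num, num_dinv₂, sub_eq_zero]
  exact isPure_sum fun α _ => (hc α β).mulX α

theorem isPure_dinv₁ {k : ℕ} {b : ι → WickAlg Λ} (hb : ∀ α, IsPure k (b α)) :
    IsPure (k + 1) (dinv₁ b) := by
  rw [IsPure, ← sub_eq_zero]
  refine eq_zero_of_num_zero ?_ fun r => ?_
  · rw [map_sub, ← dp_num, num_dinv₁, sub_eq_zero]
    exact isPure_sum fun α _ => (hb α).mulX α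
  · rw [val_sub, map_sub, constantCoeff_dinv₁, sub_zero]
    change (if _ then MvPowerSeries.constantCoeff (dinv₁ b r) else 0) = 0
    rw [constantCoeff_dinv₁, ite_self]

theorem isPure_one : IsPure 0 (1 : WickAlg Λ) := by
  refine WickAlg.ext fun r m => ?_
  rw [coeff_dp, one_apply]
  split_ifs with h1 h2 h2
  · rfl
  · rfl
  · rw [MvPowerSeries.coeff_one, if_neg]
    rintro rfl
    simp [h2] at h1
  · simp

theorem ofM_X (α : ι) : (ofM (MvPowerSeries.X α) : WickAlg Λ) = mulX α 1 :=
  ext_v fun r => by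
    rw [ofM_apply, mulX_apply, one_apply]
    split_ifs <;> simp

theorem ofM_X_mul_X (α β : ι) :
    (ofM (MvPowerSeries.X α * MvPowerSeries.X β) : WickAlg Λ) = mulX α (mulX β 1) :=
  ext_v fun r => by
    rw [ofM_apply, mulX_apply, mulX_apply, one_apply]
    split_ifs <;> simp

theorem unshift_sum_comm {κ : Type*} (s : Finset κ) (a b : κ → WickAlg Λ) :
    unshift (∑ i ∈ s, (a i * b i - b i * a i)) = ∑ i ∈ s, br (a i) (b i) := by
  refine ext_v fun r => ?_
  rw [val_sum]
  change (∑ i ∈ s, (a i * b i - b i * a i)) (r + 1) = _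
  rw [val_sum]
  rfl

theorem dp_br_eq_zero {a b : WickAlg Λ} {k : ℕ} (ha : ∀ j < 2, dp j a = 0)
    (hb : ∀ j ≤ k, dp j b = 0) : dp k (br a b) = 0 := by
  rw [dp_br]
  refine sum_eq_zero fun x hx => ?_
  have hx' := HasAntidiagonal.mem_antidiagonal.1 hx
  by_cases h : x.1 < 2
  · simp [ha _ h]
  · simp [hb x.2 (by omega)]

end WickAlg

namespace FedosovDatum

open WickAlg

variable {ι A : Type*} [Fintype ι] [DecidableEq ι] [CommRing A] [Algebra ℂ A]
  (S : FedosovDatum ι A)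

theorem isPure_t (α β : ι) : IsPure 1 (S.t α β) := by
  rw [t, tM, map_sum]
  refine isPure_sum fun γ _ => ?_
  rw [map_sum]
  refine isPure_sum fun τ _ => ?_
  rw [map_smul, ofM_X]
  exact (isPure_one.mulX γ).smul _

theorem isPure_ρ (α β : ι) : IsPure 2 (S.ρ α β) := by
  rw [ρ, ρM, map_sum]
  refine isPure_sum fun γ _ => ?_
  rw [map_sum]
  refine isPure_sum fun φ _ => ?_
  rw [map_sum]
  refine isPure_sum fun τ _ => ?_
  rw [map_smul, ofM_X_mul_X]
  exact ((isPure_one.mulX φ).mulX γ).smul _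

theorem t_antisymm (α β : ι) : S.t α β = -S.t β α := by
  rw [t, t, ← map_neg, tM, tM, ← sum_neg_distrib]
  congr 1
  refine sum_congr rfl fun γ _ => ?_
  rw [← sum_neg_distrib]
  refine sum_congr rfl fun τ _ => ?_
  rw [T_antisymm, mul_neg, neg_smul]

theorem ρ_antisymm (α β : ι) : S.ρ α β = -S.ρ β α := by
  rw [ρ, ρ, ← map_neg, ρM, ρM, ← sum_neg_distrib]
  congr 1
  refine sum_congr rfl fun γ _ => ?_
  rw [← sum_neg_distrib]
  refine sum_congr rfl fun φ _ => ?_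
  rw [← sum_neg_distrib]
  refine sum_congr rfl fun τ _ => ?_
  rw [R_antisymm, Matrix.neg_apply, mul_neg, smul_neg, neg_smul]

/-- The homogeneous components of Fedosov's element. -/
noncomputable def rDeg : ℕ → ι → S.W
  | 0 => 0
  | 1 => 0
  | 2 => dinv₂ S.t
  | k + 3 => dinv₂ fun α α' =>
      (if k = 0 then S.ρ α α' else 0)
        + (S.D α (rDeg (k + 2) α') - S.D α' (rDeg (k + 2) α))
        - Complex.I • unshift (∑ l : Fin (k + 1),
            (rDeg ((l : ℕ) + 2) α * rDeg (k - (l : ℕ) + 2) α' -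
              rDeg ((l : ℕ) + 2) α' * rDeg (k - (l : ℕ) + 2) α))
  termination_by k => k
  decreasing_by all_goals omega

theorem rDeg_succ (k : ℕ) : S.rDeg (k + 3) = dinv₂ fun α α' =>
    (if k = 0 then S.ρ α α' else 0)
      + (S.D α (S.rDeg (k + 2) α') - S.D α' (S.rDeg (k + 2) α))
      - Complex.I • ∑ x ∈ antidiagonal k, br (S.rDeg (x.1 + 2) α) (S.rDeg (x.2 + 2) α') := by
  rw [rDeg]
  congr 1
  funext α α'
  congr 2
  have h1 : ∀ a b : ι, ∑ l : Fin (k + 1), S.rDeg ((l : ℕ) + 2) a * S.rDeg (k - (l : ℕ) + 2) b =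
      ∑ x ∈ antidiagonal k, S.rDeg (x.1 + 2) a * S.rDeg (x.2 + 2) b := fun a b => by
    rw [Nat.sum_antidiagonal_eq_sum_range_succ_mk, ← Fin.sum_univ_eq_sum_range
      (fun l => S.rDeg (l + 2) a * S.rDeg (k - l + 2) b)]
  rw [← unshift_sum_comm, sum_sub_distrib, sum_sub_distrib, h1, h1,
    ← Nat.sum_antidiagonal_swap (f := fun x => S.rDeg (x.2 + 2) α' * S.rDeg (x.1 + 2) α)]
  rfl

theorem isPure_rDeg (k : ℕ) : ∀ β, IsPure k (S.rDeg k β) := by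
  induction k using Nat.strong_induction_on with
  | _ k ih =>
    rcases k with _ | _ | _ | k
    · intro β; rw [rDeg]; exact isPure_zero _
    · intro β; rw [rDeg]; exact isPure_zero _
    · intro β; rw [rDeg]; exact isPure_dinv₂ S.isPure_t β
    · intro β
      change IsPure (k + 3) (S.rDeg (k + 3) β)
      rw [rDeg_succ]
      refine isPure_dinv₂ (fun α α' => ?_) β
      refine IsPure.sub (IsPure.add ?_ (IsPure.sub ?_ ?_)) (IsPure.csmul _ (isPure_sum ?_))
      · split_ifs with h
        · rw [h]; exact S.isPure_ρ α α'
        · exact isPure_zero _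
      · exact (ih (k + 2) (by omega) α').cov _ _
      · exact (ih (k + 2) (by omega) α).cov _ _
      · intro x hx
        have hx' := HasAntidiagonal.mem_antidiagonal.1 hx
        exact (ih (x.1 + 2) (by omega) α).br (ih (x.2 + 2) (by omega) α') (by omega)

/-- Fedosov's element. -/
noncomputable def r (β : ι) : S.W := total fun k => S.rDeg k β

theorem dp_r (k : ℕ) (β : ι) : dp k (S.r β) = S.rDeg k β := by
  rw [r, dp_total]
  exact S.isPure_rDeg k β

theorem dp_r_of_lt (β : ι) (j : ℕ) (hj : j < 2) : dp j (S.r β) = 0 := by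
  rw [dp_r]
  interval_cases j <;> rw [rDeg] <;> rfl

/-- The normalisation `δ⁻¹ r = 0`. -/
theorem sum_mulX_r : ∑ β, mulX β (S.r β) = 0 := by
  refine ext_dp fun k => ?_
  rw [map_zero, map_sum]
  cases k with
  | zero => exact sum_eq_zero fun β _ => dp_mulX_zero _ _
  | succ k =>
    simp only [dp_mulX_succ, dp_r]
    rcases k with _ | _ | _ | k
    · exact sum_eq_zero fun β _ => by rw [rDeg]; simp
    · exact sum_eq_zero fun β _ => by rw [rDeg]; simp
    · rw [rDeg]; exact sum_mulX_dinv₂ S.t_antisymm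
    · change ∑ β, mulX β (S.rDeg (k + 3) β) = 0
      rw [rDeg_succ]
      refine sum_mulX_dinv₂ fun α β => ?_
      have h : ∑ x ∈ antidiagonal k, br (S.rDeg (x.1 + 2) α) (S.rDeg (x.2 + 2) β) =
          -∑ x ∈ antidiagonal k, br (S.rDeg (x.1 + 2) β) (S.rDeg (x.2 + 2) α) := by
        rw [← Nat.sum_antidiagonal_swap, ← sum_neg_distrib]
        exact sum_congr rfl fun x _ => br_antisymm _ _
      have h2 : (if k = 0 then S.ρ α β else 0) = -(if k = 0 then S.ρ β α else 0) := by
        split_ifs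
        · exact S.ρ_antisymm α β
        · simp
      rw [h, h2, smul_neg]
      abel

/-- Fedosov's fixed point equation `r = δ⁻¹ (T + R + D r - (i/v) r ∘ r)`. -/
theorem num_r (β : ι) : num 1 (S.r β) = ∑ α, mulX α (S.t α β + S.ρ α β +
    (S.D α (S.r β) - S.D β (S.r α)) - Complex.I • br (S.r α) (S.r β)) := by
  refine ext_dp fun k => ?_
  rw [dp_num, dp_r, map_sum]
  cases k with
  | zero =>
    rw [rDeg]
    simp [dp_mulX_zero]
  | succ k =>
    simp only [dp_mulX_succ, map_add, map_sub, dp_csmul, dp_br, dp_r]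
    simp only [D, dp_cov, dp_r]
    -- the components of degree `1`, `2` and at least `3`, which the recursion treats separately
    rcases k with _ | _ | k
    · have z : S.rDeg (0 + 1) β = 0 := by rw [rDeg]; rfl
      have z0 : ∀ γ, S.rDeg 0 γ = 0 := fun γ => by rw [rDeg]; rfl
      have z1 : ∀ γ, S.rDeg 1 γ = 0 := fun γ => by rw [rDeg]; rfl
      simp [z, z0, z1, (S.isPure_t _ _).dp_of_ne, (S.isPure_ρ _ _).dp_of_ne,
        Nat.sum_antidiagonal_succ]
    · have z0 : ∀ γ, S.rDeg 0 γ = 0 := fun γ => by rw [rDeg]; rfl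
      have z1 : ∀ γ, S.rDeg 1 γ = 0 := fun γ => by rw [rDeg]; rfl
      have z2 : S.rDeg (0 + 1 + 1) β = dinv₂ S.t β := by rw [rDeg]
      rw [z2, num_dinv₂]
      have e : ∀ α, dp (0 + 1) (S.t α β) = S.t α β := fun α => S.isPure_t α β
      simp [e, z0, z1, (S.isPure_ρ _ _).dp_of_ne, Nat.sum_antidiagonal_succ]
    · have z0 : ∀ γ, S.rDeg 0 γ = 0 := fun γ => by rw [rDeg]; rfl
      have z1 : ∀ γ, S.rDeg 1 γ = 0 := fun γ => by rw [rDeg]; rfl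
      rw [show k + 1 + 1 + 1 = k + 3 from rfl, rDeg_succ, num_dinv₂]
      refine sum_congr rfl fun α _ => ?_
      have e1 : dp (k + 1 + 1) (S.t α β) = 0 := (S.isPure_t α β).dp_of_ne (by omega)
      have e2 : dp (k + 1 + 1) (S.ρ α β) = if k = 0 then S.ρ α β else 0 := by
        split_ifs with h
        · rw [h]; exact S.isPure_ρ α β
        · exact (S.isPure_ρ α β).dp_of_ne (by omega)
      have e3 : ∑ x ∈ antidiagonal (k + 1 + 1 + 2), br (S.rDeg x.1 α) (S.rDeg x.2 β) =
          ∑ x ∈ antidiagonal k, br (S.rDeg (x.1 + 2) α) (S.rDeg (x.2 + 2) β) := by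
        rw [Nat.sum_antidiagonal_succ, Nat.sum_antidiagonal_succ, Nat.sum_antidiagonal_succ',
          Nat.sum_antidiagonal_succ']
        simp [z0, z1]
      rw [e1, e2, e3]
      simp only [map_add, map_sub, map_zero, zero_add]
      rfl

/-- Fedosov's equation has only one solution of total degree at least `2`: since `δ⁻¹` raises the
total degree, the difference of two solutions has no component of lowest degree. -/
theorem r_unique {r' : ι → S.W} (h0 : ∀ β, ∀ j < 2, dp j (r' β) = 0)
    (h : ∀ β, num 1 (r' β) = ∑ α, mulX α (S.t α β + S.ρ α β +
      (S.D α (r' β) - S.D β (r' α)) - Complex.I • br (r' α) (r' β))) (β : ι) : r' β = S.r β := by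
  rw [← sub_eq_zero]
  refine eq_zero_of_dp (x := fun β => r' β - S.r β) (fun k ih β => ?_) β
  cases k with
  | zero => rw [map_sub, h0 _ _ (by omega), S.dp_r_of_lt _ _ (by omega), sub_zero]
  | succ k =>
    apply num_succ_injective 0
    rw [← dp_num, map_sub, h, num_r, ← sum_sub_distrib, map_sum]
    refine sum_eq_zero fun α _ => ?_
    rw [← map_sub, dp_mulX_succ]
    have e : S.t α β + S.ρ α β + (S.D α (r' β) - S.D β (r' α)) - Complex.I • br (r' α) (r' β) -
        (S.t α β + S.ρ α β + (S.D α (S.r β) - S.D β (S.r α)) -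
          Complex.I • br (S.r α) (S.r β)) =
        S.D α (r' β - S.r β) - S.D β (r' α - S.r α) -
          Complex.I • (br (r' α) (r' β - S.r β) - br (S.r β) (r' α - S.r α)) := by
      simp only [map_sub, smul_sub]
      rw [br_antisymm (S.r β) (r' α), br_antisymm (S.r β) (S.r α)]
      simp only [smul_neg]
      abel
    have hk : ∀ γ, ∀ j ≤ k, dp j (r' γ - S.r γ) = 0 := fun γ j hj => ih j (by omega) γ
    rw [e]
    rw [map_sub (dp k), map_sub (dp k), dp_csmul, map_sub (dp k)]
    simp only [D, dp_cov]
    rw [hk β k le_rfl, hk α k le_rfl, dp_br_eq_zero (h0 α) (hk β),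
      dp_br_eq_zero (S.dp_r_of_lt β) (hk α)]
    simp

end FedosovDatum
end LagrangeFedosov

namespace LagrangeFedosov

open Finset

/-! ### The flat connection and its flat elements -/

namespace FedosovDatum

open WickAlg

variable {ι A : Type*} [Fintype ι] [DecidableEq ι] [CommRing A] [Algebra ℂ A]
  (S : FedosovDatum ι A)

/-- The operator `-δ + D` in the direction `α`. -/
noncomputable def nab (α : ι) : S.W →ₗ[ℂ] S.W := S.D α - del α

theorem nab_apply (α : ι) (a : S.W) : S.nab α a = S.D α a - del α a := rfl

theorem nab_br (α : ι) (a b : S.W) : S.nab α (br a b) = br (S.nab α a) b + br a (S.nab α b) := by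
  simp only [nab_apply, D_br, del_br, map_sub, LinearMap.sub_apply]
  abel

theorem nab_mul (α : ι) (a b : S.W) : S.nab α (a * b) = S.nab α a * b + a * S.nab α b := by
  simp only [nab_apply, D_mul, del_mul]
  noncomm_ring

/-- The square of `-δ + D` is the inner derivation by `-(i/v) (T + R)`. -/
theorem nab_comm (α β : ι) (a : S.W) : S.nab α (S.nab β a) - S.nab β (S.nab α a) =
    -(Complex.I • br (S.t α β + S.ρ α β) a) := by
  rw [map_add, LinearMap.add_apply, smul_add, I_smul_br_t, I_smul_br_ρ]
  simp only [nab_apply, map_sub]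
  rw [del_del α β]
  abel

theorem nab_cyclic (α β γ : ι) : S.nab α (S.t β γ + S.ρ β γ) + S.nab β (S.t γ α + S.ρ γ α) +
    S.nab γ (S.t α β + S.ρ α β) = 0 := by
  have h1 := S.del_t_cyclic α β γ
  have h2 := S.bianchi_del_ρ α β γ
  have h3 := S.bianchi_D_ρ α β γ
  simp only [nab_apply, map_add]
  linear_combination (norm := module) h3 - h1 - h2

/-- The Weyl curvature of Fedosov's connection, normalised so that `𝒟²` is the inner derivation
by `(i/v)` times it. -/
noncomputable def weylCurv (α β : ι) : S.W :=
  -(S.t α β + S.ρ α β) - (S.nab α (S.r β) - S.nab β (S.r α)) + Complex.I • br (S.r α) (S.r β)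

theorem weylCurv_antisymm (α β : ι) : S.weylCurv α β = -S.weylCurv β α := by
  unfold weylCurv
  rw [S.t_antisymm α β, S.ρ_antisymm α β, br_antisymm (S.r α), smul_neg]
  abel

theorem weylCurv_eq (α β : ι) : S.weylCurv α β = (del α (S.r β) - del β (S.r α)) -
    (S.t α β + S.ρ α β + (S.D α (S.r β) - S.D β (S.r α)) - Complex.I • br (S.r α) (S.r β)) := by
  unfold weylCurv
  simp only [nab_apply]
  abel

/-- By the fixed point equation for `r`, the operator `δ⁻¹` annihilates the Weyl curvature. -/
theorem sum_mulX_weylCurv (β : ι) : ∑ α, mulX α (S.weylCurv α β) = 0 := by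
  simp only [weylCurv_eq]
  simp only [map_sub (mulX _) (del _ _ - del _ _)]
  rw [sum_sub_distrib, ← num_r, ← homotopy_one S.sum_mulX_r, sub_self]

/-- The Bianchi identity for the Weyl curvature. -/
theorem weylCurv_cyclic (α β γ : ι) :
    (S.nab α (S.weylCurv β γ) - Complex.I • br (S.r α) (S.weylCurv β γ)) +
    (S.nab β (S.weylCurv γ α) - Complex.I • br (S.r β) (S.weylCurv γ α)) +
    (S.nab γ (S.weylCurv α β) - Complex.I • br (S.r γ) (S.weylCurv α β)) = 0 := by
  have hs := S.nab_cyclic α β γ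
  have c1 := S.nab_comm α β (S.r γ)
  have c2 := S.nab_comm β γ (S.r α)
  have c3 := S.nab_comm γ α (S.r β)
  -- the Jacobi identity for the cubic terms
  have J : br (S.r α) (br (S.r β) (S.r γ)) + br (S.r β) (br (S.r γ) (S.r α)) +
      br (S.r γ) (br (S.r α) (S.r β)) = 0 := by
    rw [br_antisymm (S.r γ) (br (S.r α) (S.r β)), br_br, br_antisymm (S.r γ) (S.r α), map_neg]
    abel
  have J' := congrArg (fun x => (Complex.I * Complex.I) • x) J
  simp only [smul_zero] at J'
  unfold weylCurv
  rw [br_antisymm (S.t α β + S.ρ α β) (S.r γ)] at c1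
  rw [br_antisymm (S.t β γ + S.ρ β γ) (S.r α)] at c2
  rw [br_antisymm (S.t γ α + S.ρ γ α) (S.r β)] at c3
  rw [map_add, map_add, map_add] at hs
  simp only [map_add, map_sub, map_neg, map_smul, nab_br, br_csmul_right, smul_add, smul_sub,
    smul_neg] at c1 c2 c3 hs ⊢
  rw [br_antisymm (S.nab α (S.r β)), br_antisymm (S.nab β (S.r γ)),
    br_antisymm (S.nab γ (S.r α))]
  linear_combination (norm := module) -hs - c1 - c2 - c3 - J'

theorem sh_csmul (c : ℂ) (a : S.W) : sh (c • a) = c • sh a :=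
  LinearMap.map_smul_of_tower _ _ _

theorem dp_D_eq_zero {k : ℕ} {a : S.W} (h : dp k a = 0) (α : ι) : dp k (S.D α a) = 0 := by
  rw [D, dp_cov, h, map_zero]

/-- Fedosov's connection is flat: by the Bianchi identity and the homotopy formula, a component of
lowest degree of the Weyl curvature would vanish. -/
theorem weylCurv_eq_zero (α β : ι) : S.weylCurv α β = 0 := by
  refine eq_zero_of_dp (x := fun i : ι × ι => S.weylCurv i.1 i.2) (fun k ih i => ?_) (α, β)
  apply num_succ_injective 1
  rw [← dp_num, homotopy_two S.weylCurv_antisymm S.sum_mulX_weylCurv, map_sum]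
  refine sum_eq_zero fun α _ => ?_
  cases k with
  | zero => exact dp_mulX_zero _ _
  | succ k =>
    have hk : ∀ β γ, ∀ j ≤ k, dp j (S.weylCurv β γ) = 0 := fun β γ j hj => ih j (by omega) (β, γ)
    have key : ∀ α β γ, dp k (S.D α (S.weylCurv β γ) - Complex.I • br (S.r α) (S.weylCurv β γ)) =
        0 := fun α β γ => by
      rw [map_sub, dp_csmul, S.dp_D_eq_zero (hk β γ k le_rfl),
        dp_br_eq_zero (S.dp_r_of_lt α) (hk β γ), smul_zero, sub_zero]
    have e : del α (S.weylCurv i.1 i.2) + del i.1 (S.weylCurv i.2 α) +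
        del i.2 (S.weylCurv α i.1) =
        (S.D α (S.weylCurv i.1 i.2) - Complex.I • br (S.r α) (S.weylCurv i.1 i.2)) +
        (S.D i.1 (S.weylCurv i.2 α) - Complex.I • br (S.r i.1) (S.weylCurv i.2 α)) +
        (S.D i.2 (S.weylCurv α i.1) - Complex.I • br (S.r i.2) (S.weylCurv α i.1)) := by
      have h := S.weylCurv_cyclic α i.1 i.2
      simp only [nab_apply] at h
      linear_combination (norm := module) -h
    rw [dp_mulX_succ, e, map_add (dp k), map_add (dp k), key, key, key, add_zero, add_zero,
      map_zero]

/-- Fedosov's connection `𝒟 = -δ + D - (i/v) ad(r)` in the direction `α`. -/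
noncomputable def fD (α : ι) (a : S.W) : S.W :=
  -del α a + S.D α a - Complex.I • br (S.r α) a

theorem fD_eq (α : ι) (a : S.W) : S.fD α a = S.nab α a - Complex.I • br (S.r α) a := by
  rw [fD, nab_apply]
  abel

theorem fD_add (α : ι) (a b : S.W) : S.fD α (a + b) = S.fD α a + S.fD α b := by
  simp only [fD, map_add, smul_add]
  abel

theorem fD_mul (α : ι) (a b : S.W) : S.fD α (a * b) = S.fD α a * b + a * S.fD α b := by
  simp only [fD_eq, nab_mul, br_mul, smul_add, sub_mul, mul_sub, smul_mul_assoc, mul_smul_comm]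
  abel

theorem fD_sh (α : ι) (a : S.W) : S.fD α (sh a) = sh (S.fD α a) := by
  have h : br (S.r α) (sh a) = sh (br (S.r α) a) := by
    apply sh_injective
    rw [sh_br, sh_mul, mul_sh, ← map_sub, sh_br]
  simp only [fD, del_sh, D, cov_sh, h, map_sub, map_add, map_neg]
  rw [sh_csmul]

theorem fD_comm (α β : ι) (a : S.W) : S.fD α (S.fD β a) = S.fD β (S.fD α a) := by
  have c := S.nab_comm α β a
  have h : Complex.I • br (S.weylCurv α β) a = 0 := by
    rw [weylCurv_eq_zero, map_zero, LinearMap.zero_apply, smul_zero]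
  simp only [weylCurv, map_add, map_sub, map_neg, LinearMap.add_apply, LinearMap.sub_apply,
    LinearMap.neg_apply, smul_add, smul_sub, smul_neg,
    br_csmul_left, br_br] at c h
  simp only [fD_eq, map_sub, nab_br, map_smul, smul_add, smul_sub, br_csmul_right]
  linear_combination (norm := module) c + h

/-- Flat elements. -/
def IsFlat (a : S.W) : Prop := ∀ α, S.fD α a = 0

theorem IsFlat.num {a : S.W} (h : S.IsFlat a) :
    num 0 a = ∑ α, mulX α (S.D α a - Complex.I • br (S.r α) a) := by
  rw [← sum_mulX_del]
  refine sum_congr rfl fun α _ => ?_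
  congr 1
  have := h α
  rw [fD] at this
  linear_combination (norm := module) -this

/-- A flat element is determined by its part of `deg_s`-degree zero. -/
theorem IsFlat.eq_zero {a : S.W} (h : S.IsFlat a)
    (h0 : ∀ r, MvPowerSeries.constantCoeff (a r) = 0) : a = 0 := by
  refine eq_zero_of_dp (x := fun _ : Unit => a) (fun k ih _ => ?_) ()
  refine eq_zero_of_num_zero ?_ fun r => ?_
  · rw [← dp_num, h.num, map_sum]
    refine sum_eq_zero fun α _ => ?_
    cases k with
    | zero => exact dp_mulX_zero _ _
    | succ k =>
      have hk : ∀ j ≤ k, dp j a = 0 := fun j hj => ih j (by omega) ()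
      rw [dp_mulX_succ, map_sub, dp_csmul, S.dp_D_eq_zero (hk k le_rfl),
        dp_br_eq_zero (S.dp_r_of_lt α) hk, smul_zero, sub_zero, map_zero]
  · rw [← MvPowerSeries.coeff_zero_eq_constantCoeff_apply, coeff_dp,
      MvPowerSeries.coeff_zero_eq_constantCoeff_apply, h0, ite_self]

theorem IsFlat.sub {a b : S.W} (ha : S.IsFlat a) (hb : S.IsFlat b) : S.IsFlat (a - b) := by
  intro α
  have h := S.fD_add α (a - b) b
  rw [sub_add_cancel, ha, hb, add_zero] at h
  exact h.symm

theorem IsFlat.add {a b : S.W} (ha : S.IsFlat a) (hb : S.IsFlat b) : S.IsFlat (a + b) :=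
  fun α => by rw [fD_add, ha, hb, add_zero]

theorem IsFlat.mul {a b : S.W} (ha : S.IsFlat a) (hb : S.IsFlat b) : S.IsFlat (a * b) :=
  fun α => by rw [fD_mul, ha, hb, zero_mul, mul_zero, add_zero]

theorem IsFlat.sh {a : S.W} (ha : S.IsFlat a) : S.IsFlat (sh a) :=
  fun α => by rw [fD_sh, ha, map_zero]

theorem IsFlat.ext {a b : S.W} (ha : S.IsFlat a) (hb : S.IsFlat b)
    (h : ∀ r, MvPowerSeries.constantCoeff (a r) = MvPowerSeries.constantCoeff (b r)) : a = b :=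
  sub_eq_zero.1 ((ha.sub S hb).eq_zero S fun r => by rw [val_sub, map_sub, h, sub_self])

/-- A formal series of scalars, as an element of the Wick algebra. -/
noncomputable def con (F : ℕ → A) : S.W := fun r => MvPowerSeries.C (F r)

/-- The homogeneous components of the flat element with the part `F` of `deg_s`-degree zero. -/
noncomputable def τDeg (F : ℕ → A) : ℕ → S.W
  | 0 => dp 0 (S.con F)
  | k + 1 => dp (k + 1) (S.con F) + dinv₁ fun α => S.D α (τDeg F k) -
      Complex.I • ∑ l : Fin (k + 1), br (S.rDeg ((l : ℕ) + 2) α) (τDeg F (k - (l : ℕ)))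
  termination_by k => k
  decreasing_by all_goals omega

theorem τDeg_succ (F : ℕ → A) (k : ℕ) : S.τDeg F (k + 1) = dp (k + 1) (S.con F) +
    dinv₁ fun α => S.D α (S.τDeg F k) -
      Complex.I • ∑ l ∈ range (k + 1), br (S.rDeg (l + 2) α) (S.τDeg F (k - l)) := by
  rw [τDeg]
  simp only [← Fin.sum_univ_eq_sum_range (fun l => br (S.rDeg (l + 2) _) (S.τDeg F (k - l)))]

theorem isPure_τDeg (F : ℕ → A) (k : ℕ) : IsPure k (S.τDeg F k) := by
  induction k using Nat.strong_induction_on with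
  | _ k ih =>
    have h : IsPure k (dp k (S.con F)) := by rw [IsPure, dp_dp, if_pos rfl]
    cases k with
    | zero => rwa [τDeg]
    | succ k =>
      rw [τDeg_succ]
      refine h.add (isPure_dinv₁ fun α => ((ih k (by omega)).cov _ _).sub
        (IsPure.csmul _ (isPure_sum fun l hl => ?_)))
      have := mem_range.1 hl
      exact (S.isPure_rDeg _ α).br (ih (k - l) (by omega)) (by omega)

/-- The flat element with the part `F` of `deg_s`-degree zero. -/
noncomputable def τ (F : ℕ → A) : S.W := total (S.τDeg F)

theorem dp_τ (F : ℕ → A) (k : ℕ) : dp k (S.τ F) = S.τDeg F k := by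
  rw [τ, dp_total]
  exact S.isPure_τDeg F k

theorem constantCoeff_τ (F : ℕ → A) (r : ℕ) : MvPowerSeries.constantCoeff (S.τ F r) = F r := by
  rw [τ, ← MvPowerSeries.coeff_zero_eq_constantCoeff_apply, coeff_total,
    MvPowerSeries.coeff_zero_eq_constantCoeff_apply, map_zero, add_zero]
  have h0 : MvPowerSeries.constantCoeff (dp (2 * r) (S.con F) r) = F r := by
    rw [← MvPowerSeries.coeff_zero_eq_constantCoeff_apply, coeff_dp, if_pos (by simp), con,
      MvPowerSeries.coeff_zero_C]
  cases h : 2 * r with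
  | zero => rw [τDeg, ← h, h0]
  | succ k => rw [τDeg_succ, val_add, map_add, constantCoeff_dinv₁, add_zero, ← h, h0]

theorem num_con (F : ℕ → A) : num 0 (S.con F) = 0 := by
  refine WickAlg.ext fun r m => ?_
  rw [coeff_num, con, MvPowerSeries.coeff_C]
  split_ifs with h
  · simp [h]
  · simp

/-- The fixed point equation `deg_s τ = z^α (D_α τ - (i/v) ad(r_α) τ)` of the flat element. -/
theorem num_τ (F : ℕ → A) :
    num 0 (S.τ F) = ∑ α, mulX α (S.D α (S.τ F) - Complex.I • br (S.r α) (S.τ F)) := by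
  refine ext_dp fun k => ?_
  rw [dp_num, dp_τ, map_sum]
  cases k with
  | zero => simp only [dp_mulX_zero, sum_const_zero, τDeg, ← dp_num, num_con, map_zero]
  | succ k =>
    rw [τDeg_succ, map_add, num_dinv₁, ← dp_num, num_con, map_zero, zero_add]
    refine sum_congr rfl fun α _ => ?_
    have z0 : ∀ γ, S.rDeg 0 γ = 0 := fun γ => by rw [rDeg]; rfl
    have z1 : ∀ γ, S.rDeg 1 γ = 0 := fun γ => by rw [rDeg]; rfl
    have e : dp k (br (S.r α) (S.τ F)) =
        ∑ l ∈ range (k + 1), br (S.rDeg (l + 2) α) (S.τDeg F (k - l)) := by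
      rw [dp_br, Nat.sum_antidiagonal_succ, Nat.sum_antidiagonal_succ,
        ← Nat.sum_antidiagonal_eq_sum_range_succ
          (fun i j => br (S.rDeg (i + 2) α) (S.τDeg F j))]
      simp only [dp_r, dp_τ, z0, z1, map_zero, LinearMap.zero_apply, zero_add]
    rw [dp_mulX_succ, map_sub (dp k), dp_csmul, e]
    congr 2
    rw [D, dp_cov, dp_τ]

/-- The derivative `𝒟 τ` is annihilated by `δ⁻¹`, and `𝒟 𝒟 τ = 0`; hence `𝒟 τ` vanishes by the
homotopy formula and induction on the total degree. -/
theorem isFlat_τ (F : ℕ → A) : S.IsFlat (S.τ F) := by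
  have hx : ∑ α, mulX α (S.fD α (S.τ F)) = 0 := by
    have h := S.num_τ F
    rw [← sum_mulX_del, ← sub_eq_zero, ← sum_sub_distrib] at h
    rw [← neg_eq_zero, ← h, ← sum_neg_distrib]
    refine sum_congr rfl fun α _ => ?_
    rw [← map_neg, ← map_sub]
    congr 1
    rw [fD]
    abel
  refine eq_zero_of_dp (fun k ih β => ?_)
  apply num_succ_injective 0
  rw [← dp_num, homotopy_one hx, map_sum]
  refine sum_eq_zero fun α _ => ?_
  cases k with
  | zero => exact dp_mulX_zero _ _
  | succ k =>
    have hk : ∀ γ, ∀ j ≤ k, dp j (S.fD γ (S.τ F)) = 0 := fun γ j hj => ih j (by omega) γ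
    have key : ∀ α β, dp k (S.D α (S.fD β (S.τ F)) - Complex.I • br (S.r α) (S.fD β (S.τ F))) =
        0 := fun α β => by
      rw [map_sub, dp_csmul, S.dp_D_eq_zero (hk β k le_rfl),
        dp_br_eq_zero (S.dp_r_of_lt α) (hk β), smul_zero, sub_zero]
    have e : del α (S.fD β (S.τ F)) - del β (S.fD α (S.τ F)) =
        (S.D α (S.fD β (S.τ F)) - Complex.I • br (S.r α) (S.fD β (S.τ F))) -
        (S.D β (S.fD α (S.τ F)) - Complex.I • br (S.r β) (S.fD α (S.τ F))) := by
      have h := S.fD_comm α β (S.τ F)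
      rw [fD_eq, fD_eq S β (S.fD α _)] at h
      simp only [nab_apply] at h
      linear_combination (norm := module) -h
    rw [dp_mulX_succ, e, map_sub, key, key, sub_zero, map_zero]

theorem IsFlat.eq_τ {a : S.W} (h : S.IsFlat a) :
    a = S.τ fun r => MvPowerSeries.constantCoeff (a r) :=
  h.ext S (S.isFlat_τ _) fun r =>
    (S.constantCoeff_τ (fun r => MvPowerSeries.constantCoeff (a r)) r).symm

/-- Recursion for the homogeneous components of a flat element. -/
theorem IsFlat.dp_succ {a : S.W} (h : S.IsFlat a) (k : ℕ) : dp (k + 1) a =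
    dp (k + 1) (S.con fun r => MvPowerSeries.constantCoeff (a r)) +
      dinv₁ fun α => S.D α (dp k a) -
        Complex.I • ∑ l ∈ range (k + 1), br (S.rDeg (l + 2) α) (dp (k - l) a) := by
  have e : ∀ j, dp j a = S.τDeg (fun r => MvPowerSeries.constantCoeff (a r)) j := fun j => by
    conv_lhs => rw [h.eq_τ]
    rw [dp_τ]
  simp only [e, τDeg_succ]

theorem IsFlat.dp_zero {a : S.W} (h : S.IsFlat a) : dp 0 a =
    dp 0 (S.con fun r => MvPowerSeries.constantCoeff (a r)) := by
  conv_lhs => rw [h.eq_τ]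
  rw [dp_τ, τDeg]

end FedosovDatum
end LagrangeFedosov

namespace LagrangeFedosov

open Finset

/-! ### The star product -/

/-- The formal series `c`, concentrated in `v`-degree zero. -/
def single {A : Type*} [Zero A] (c : A) : ℕ → A := fun r => if r = 0 then c else 0

/-- Multiplication of a formal series by `v`. -/
def shift {A : Type*} [Zero A] (F : ℕ → A) : ℕ → A
  | 0 => 0
  | r + 1 => F r

theorem eq_single_add_shift {A : Type*} [AddCommMonoid A] (F : ℕ → A) :
    F = single (F 0) + shift fun r => F (r + 1) := by
  funext r
  cases r <;> simp [single, shift]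

/-- A map of formal series which is additive and `v`-linear is determined by its values on series
that are concentrated in `v`-degree zero. -/
theorem vLinear_apply {A M : Type*} [AddCommMonoid A] [AddCommMonoid M] (T : (ℕ → A) → ℕ → M)
    (hadd : ∀ F F' r, T (F + F') r = T F r + T F' r) (h0 : ∀ F, T (shift F) 0 = 0)
    (hsucc : ∀ F r, T (shift F) (r + 1) = T F r) (F : ℕ → A) (r : ℕ) :
    T F r = ∑ p ∈ antidiagonal r, T (single (F p.1)) p.2 := by
  induction r generalizing F with
  | zero =>
    conv_lhs => rw [eq_single_add_shift F, hadd, h0, add_zero]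
    simp
  | succ r ih =>
    conv_lhs => rw [eq_single_add_shift F, hadd, hsucc, ih]
    rw [Nat.sum_antidiagonal_succ]

namespace FedosovDatum

open WickAlg

variable {ι A : Type*} [Fintype ι] [DecidableEq ι] [CommRing A] [Algebra ℂ A]
  (S : FedosovDatum ι A)

theorem IsFlat.csmul {a : S.W} (c : ℂ) (h : S.IsFlat a) : S.IsFlat (c • a) := fun α => by
  have := h α
  rw [fD] at this ⊢
  rw [map_smul, map_smul, br_csmul_right, smul_comm Complex.I c, ← smul_neg, ← smul_add,
    ← smul_sub, this, smul_zero]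

theorem τ_eq {F : ℕ → A} {a : S.W} (h : S.IsFlat a)
    (hF : ∀ r, MvPowerSeries.constantCoeff (a r) = F r) : S.τ F = a :=
  (S.isFlat_τ F).ext S h fun r => by rw [constantCoeff_τ, hF]

theorem τ_add (F G : ℕ → A) : S.τ (F + G) = S.τ F + S.τ G :=
  S.τ_eq ((S.isFlat_τ F).add S (S.isFlat_τ G)) fun r => by
    rw [val_add, map_add, constantCoeff_τ, constantCoeff_τ, Pi.add_apply]

theorem constantCoeff_csmul (c : ℂ) (f : MvPowerSeries ι A) :
    MvPowerSeries.constantCoeff (c • f) = c • MvPowerSeries.constantCoeff f := by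
  simp only [← MvPowerSeries.coeff_zero_eq_constantCoeff_apply, coeff_csmul]

theorem τ_csmul (c : ℂ) (F : ℕ → A) : S.τ (c • F) = c • S.τ F :=
  S.τ_eq ((S.isFlat_τ F).csmul S c) fun r => by
    rw [val_csmul, constantCoeff_csmul, constantCoeff_τ, Pi.smul_apply]

theorem τ_shift (F : ℕ → A) : S.τ (shift F) = sh (S.τ F) :=
  S.τ_eq ((S.isFlat_τ F).sh S) fun r => by
    cases r with
    | zero => exact map_zero _
    | succ r => rw [sh_succ, constantCoeff_τ, shift]

theorem isFlat_one : S.IsFlat 1 := fun α => by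
  have h := S.fD_mul α 1 1
  rw [mul_one, mul_one, one_mul] at h
  exact left_eq_add.1 h

theorem τ_single_one : S.τ (single 1) = 1 :=
  S.τ_eq S.isFlat_one fun r => by
    rw [one_apply, single]
    split_ifs <;> simp

/-- The flat element `τ(F)` is `v`-linear in `F`. -/
theorem τ_apply (F : ℕ → A) (r : ℕ) :
    S.τ F r = ∑ p ∈ antidiagonal r, S.τ (single (F p.1)) p.2 :=
  vLinear_apply (fun F => S.τ F) (fun F F' r => by rw [τ_add]; rfl)
    (fun F => by rw [τ_shift]; rfl) (fun F r => by rw [τ_shift]; rfl) F r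

/-- The product of formal series which the product of flat elements induces. -/
noncomputable def star (F G : ℕ → A) : ℕ → A := fun r =>
  MvPowerSeries.constantCoeff ((S.τ F * S.τ G) r)

theorem τ_star (F G : ℕ → A) : S.τ (S.star F G) = S.τ F * S.τ G :=
  S.τ_eq ((S.isFlat_τ F).mul S (S.isFlat_τ G)) fun _ => rfl

theorem star_assoc (F G K : ℕ → A) : S.star (S.star F G) K = S.star F (S.star G K) := by
  funext r
  rw [star, star, τ_star, τ_star, mul_assoc]

theorem one_star (F : ℕ → A) : S.star (single 1) F = F := by
  funext r
  rw [star, τ_single_one, one_mul, constantCoeff_τ]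

theorem star_one (F : ℕ → A) : S.star F (single 1) = F := by
  funext r
  rw [star, τ_single_one, mul_one, constantCoeff_τ]

theorem add_star (F F' G : ℕ → A) : S.star (F + F') G = S.star F G + S.star F' G := by
  funext r
  rw [Pi.add_apply, star, τ_add, add_mul, val_add, map_add, star, star]

theorem star_add (F G G' : ℕ → A) : S.star F (G + G') = S.star F G + S.star F G' := by
  funext r
  rw [Pi.add_apply, star, τ_add, mul_add, val_add, map_add, star, star]

theorem csmul_star (c : ℂ) (F G : ℕ → A) : S.star (c • F) G = c • S.star F G := by
  funext r
  rw [Pi.smul_apply, star, τ_csmul, smul_mul_assoc, val_csmul, constantCoeff_csmul, star]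

theorem star_csmul (c : ℂ) (F G : ℕ → A) : S.star F (c • G) = c • S.star F G := by
  funext r
  rw [Pi.smul_apply, star, τ_csmul, mul_smul_comm, val_csmul, constantCoeff_csmul, star]

/-- The star product is `v`-linear and `v`-adically continuous in both arguments. -/
theorem star_apply (F G : ℕ → A) (k : ℕ) : S.star F G k = ∑ r ∈ range (k + 1),
    ∑ p ∈ antidiagonal (k - r), S.star (single (F p.1)) (single (G p.2)) r := by
  have h1 : ∀ F G k, S.star F G k = ∑ p ∈ antidiagonal k, S.star (single (F p.1)) G p.2 :=
    fun F G k => vLinear_apply (fun F => S.star F G) (fun F F' r => by rw [add_star]; rfl)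
      (fun F => by rw [star, τ_shift, sh_mul, sh_zero, map_zero])
      (fun F r => by rw [star, τ_shift, sh_mul, sh_succ, star]) F k
  have h2 : ∀ F G k, S.star F G k = ∑ p ∈ antidiagonal k, S.star F (single (G p.1)) p.2 :=
    fun F G k => vLinear_apply (fun G => S.star F G) (fun G G' r => by rw [star_add]; rfl)
      (fun G => by rw [star, τ_shift, mul_sh, sh_zero, map_zero])
      (fun G r => by rw [star, τ_shift, mul_sh, sh_succ, star]) G k
  rw [h1, sum_congr rfl fun x _ => h2 (single (F x.1)) G x.2,
    sum_antidiagonal_assoc (fun i j m => S.star (single (F i)) (single (G j)) m),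
    ← Nat.sum_antidiagonal_swap, Nat.sum_antidiagonal_eq_sum_range_succ_mk]
  rfl

theorem star_apply_zero (F G : ℕ → A) : S.star F G 0 = F 0 * G 0 := by
  rw [star, mul_apply_zero, map_mul, constantCoeff_τ, constantCoeff_τ]

theorem br_apply_zero (a b : S.W) : br a b 0 = Complex.I • ∑ α, ∑ β, S.θup α β •
    (MvPowerSeries.pderiv A α (a 0) * MvPowerSeries.pderiv A β (b 0)) := by
  have e : ∀ a b : S.W, (a * b) 1 = a 0 * b 1 + a 1 * b 0 + (Complex.I / 2) • ∑ α, ∑ β, S.Λ α β •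
      (MvPowerSeries.pderiv A α (a 0) * MvPowerSeries.pderiv A β (b 0)) := fun a b => by
    rw [mul_apply]
    simp [Nat.sum_antidiagonal_succ, bidiff_succ, expCoeff_one]
  have h2 : ∑ α, ∑ β, S.Λ α β • (MvPowerSeries.pderiv A α (b 0) * MvPowerSeries.pderiv A β (a 0)) =
      ∑ α, ∑ β, S.Λ β α •
        (MvPowerSeries.pderiv A α (a 0) * MvPowerSeries.pderiv A β (b 0)) := by
    rw [sum_comm]
    exact sum_congr rfl fun α _ => sum_congr rfl fun β _ => by rw [mul_comm]
  have h3 : ∑ α, ∑ β, S.Λ α β • (MvPowerSeries.pderiv A α (a 0) * MvPowerSeries.pderiv A β (b 0)) -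
      ∑ α, ∑ β, S.Λ β α • (MvPowerSeries.pderiv A α (a 0) * MvPowerSeries.pderiv A β (b 0)) =
      (2 : ℂ) • ∑ α, ∑ β, S.θup α β •
        (MvPowerSeries.pderiv A α (a 0) * MvPowerSeries.pderiv A β (b 0)) := by
    simp only [← sum_sub_distrib, ← sub_smul, Λ_sub_transpose, smul_sum, smul_assoc]
  rw [br_apply, zero_add, val_sub, e, e, h2]
  have h4 := congrArg (fun x => (Complex.I / 2) • x) h3
  simp only [smul_sub, smul_smul, div_mul_cancel₀ Complex.I (two_ne_zero' ℂ)] at h4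
  rw [← h4]
  ring

/-- The linear part of a flat element is the differential of its constant part. -/
theorem constantCoeff_pderiv_τ (F : ℕ → A) (α : ι) :
    MvPowerSeries.constantCoeff (MvPowerSeries.pderiv A α (S.τ F 0)) = S.pdv α (F 0) := by
  have h := congrArg (fun a : S.W => MvPowerSeries.constantCoeff (a 0)) (S.isFlat_τ F α)
  simp only [fD, val_sub, val_add, val_neg, val_csmul, map_sub, map_add, map_neg,
    constantCoeff_cov, constantCoeff_τ, constantCoeff_csmul, br_apply_zero, del_apply] at h
  have hr : ∀ β, MvPowerSeries.constantCoeff (MvPowerSeries.pderiv A β (S.r α 0)) = 0 := by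
    intro β
    have h1 := congrArg (fun a : S.W => MvPowerSeries.coeff (Finsupp.single β 1) (a 0))
      (S.dp_r_of_lt α 1 (by norm_num))
    rw [coeff_dp, if_pos (by simp)] at h1
    rw [← MvPowerSeries.coeff_zero_eq_constantCoeff_apply, MvPowerSeries.coeff_pderiv, zero_add, h1]
    exact zero_mul _
  have h2 : MvPowerSeries.constantCoeff (∑ μ, ∑ ν, S.θup μ ν •
      (MvPowerSeries.pderiv A μ (S.r α 0) * MvPowerSeries.pderiv A ν (S.τ F 0))) = 0 := by
    rw [map_sum]
    refine sum_eq_zero fun μ _ => ?_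
    rw [map_sum]
    refine sum_eq_zero fun ν _ => ?_
    rw [MvPowerSeries.smul_eq_C_mul, map_mul, map_mul, hr, zero_mul, mul_zero]
  rw [h2, smul_zero, smul_zero, sub_zero] at h
  have h3 : (0 : S.W) 0 = 0 := rfl
  rw [h3, map_zero] at h
  exact neg_add_eq_zero.1 h

/-- The first-order term of the star commutator is the Poisson bracket. -/
theorem star_sub_star (f g : A) : S.star (single f) (single g) 1 - S.star (single g) (single f) 1 =
    Complex.I • ∑ α, ∑ β, S.θup α β * (S.pdv α f * S.pdv β g) := by
  have h : S.star (single f) (single g) 1 - S.star (single g) (single f) 1 =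
      MvPowerSeries.constantCoeff (br (S.τ (single f)) (S.τ (single g)) 0) := by
    rw [br_apply, val_sub, map_sub, star, star]
  rw [h, br_apply_zero, constantCoeff_csmul, map_sum]
  simp only [map_sum, MvPowerSeries.smul_eq_C_mul, map_mul, constantCoeff_pderiv_τ,
    MvPowerSeries.constantCoeff_C]
  rfl

end FedosovDatum
end LagrangeFedosov

namespace LagrangeFedosov

open Finset

/-! ### Linear changes of the fibre coordinates -/

section

variable {ι A A' : Type*} [Fintype ι] [DecidableEq ι] [CommRing A] [Algebra ℂ A]
  [CommRing A'] [Algebra ℂ A']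

theorem constantCoeff_rowForm (P : Matrix ι ι A) (β : ι) :
    MvPowerSeries.constantCoeff (rowForm P β) = 0 := by
  simp [rowForm]

theorem hasSubst_rowForm (P : Matrix ι ι A) : MvPowerSeries.HasSubst (rowForm P) :=
  MvPowerSeries.hasSubst_of_constantCoeff_zero (constantCoeff_rowForm P)

/-- Linear change of the fibre coordinates along a change of the ring of coefficients: apply `σ` to
the coefficients and substitute `z^β = ∑_α (P β α) z'^α`. -/
noncomputable def pullM (σ : A' →ₐ[ℂ] A) (P : Matrix ι ι A) :
    MvPowerSeries ι A' →+* MvPowerSeries ι A :=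
  ((MvPowerSeries.substAlgHom (R := A) (hasSubst_rowForm P)).toRingHom).comp
    (MvPowerSeries.map σ.toRingHom)

variable (σ : A' →ₐ[ℂ] A) (P : Matrix ι ι A)

theorem pullM_apply (f : MvPowerSeries ι A') :
    pullM σ P f = MvPowerSeries.subst (rowForm P) (MvPowerSeries.map σ.toRingHom f) := by
  rw [← MvPowerSeries.coe_substAlgHom (hasSubst_rowForm P)]
  rfl

theorem pullM_C (c : A') : pullM σ P (MvPowerSeries.C c) = MvPowerSeries.C (σ c) := by
  rw [pullM_apply, MvPowerSeries.map_C, MvPowerSeries.subst_C]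
  rfl

theorem pullM_X (β : ι) : pullM σ P (MvPowerSeries.X β) = rowForm P β := by
  rw [pullM_apply, MvPowerSeries.map_X, MvPowerSeries.subst_X (hasSubst_rowForm P)]

theorem pullM_smul (c : A') (f : MvPowerSeries ι A') :
    pullM σ P (c • f) = σ c • pullM σ P f := by
  rw [MvPowerSeries.smul_eq_C_mul, map_mul, pullM_C, MvPowerSeries.smul_eq_C_mul]

theorem pullM_csmul (c : ℂ) (f : MvPowerSeries ι A') :
    pullM σ P (c • f) = c • pullM σ P f := by
  rw [← algebraMap_smul A' c f, pullM_smul, AlgHom.commutes, algebraMap_smul]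

theorem pullM_rowForm (G : Matrix ι ι A') (γ : ι) :
    pullM σ P (rowForm G γ) = rowForm (G.map σ * P) γ := by
  simp only [rowForm, map_sum, pullM_smul, pullM_X, Matrix.mul_apply, Matrix.map_apply, smul_sum,
    sum_smul, smul_smul]
  rw [sum_comm]

theorem constantCoeff_pullM (f : MvPowerSeries ι A') :
    MvPowerSeries.constantCoeff (pullM σ P f) = σ (MvPowerSeries.constantCoeff f) := by
  have hd : f = MvPowerSeries.C (MvPowerSeries.constantCoeff f) +
      (f - MvPowerSeries.C (MvPowerSeries.constantCoeff f)) := by ring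
  have h0 : MvPowerSeries.constantCoeff
      (pullM σ P (f - MvPowerSeries.C (MvPowerSeries.constantCoeff f))) = 0 := by
    rw [pullM_apply]
    exact MvPowerSeries.constantCoeff_subst_eq_zero (hasSubst_rowForm P)
      (constantCoeff_rowForm P) (by simp)
  rw [hd, map_add, map_add, h0, pullM_C]
  simp

/-- A linear change of the fibre coordinates does not lower the order. -/
theorem coeff_pullM_eq_zero {N : ℕ} {f : MvPowerSeries ι A'}
    (h : ∀ m, m.degree < N → MvPowerSeries.coeff m f = 0) (m : ι →₀ ℕ) (hm : m.degree < N) :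
    MvPowerSeries.coeff m (pullM σ P f) = 0 := by
  apply MvPowerSeries.coeff_of_lt_order
  rw [pullM_apply]
  have h1 : (N : ℕ∞) ≤ (MvPowerSeries.map σ.toRingHom f).order := by
    refine MvPowerSeries.le_order fun d hd => ?_
    rw [MvPowerSeries.coeff_map, h d (by exact_mod_cast hd), map_zero]
  have h2 : (1 : ℕ∞) ≤ ⨅ i, (rowForm P i).order :=
    le_iInf fun i => MvPowerSeries.one_le_order_iff_constCoeff_eq_zero.2
      (constantCoeff_rowForm P i)
  calc ((m.degree : ℕ) : ℕ∞) < N := by exact_mod_cast hm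
    _ ≤ _ := h1
    _ ≤ _ := le_mul_of_one_le_left' h2
    _ ≤ _ := MvPowerSeries.le_order_subst (hasSubst_rowForm P) _

/-- A derivation along a change of fibre coordinates which vanishes on the coefficients and on the
coordinates is zero; it is assumed to lower the order by at most one. -/
theorem eq_zero_of_pullM_derivation (E : MvPowerSeries ι A' →+ MvPowerSeries ι A)
    (hmul : ∀ f g, E (f * g) = E f * pullM σ P g + pullM σ P f * E g)
    (hC : ∀ c, E (MvPowerSeries.C c) = 0) (hX : ∀ i, E (MvPowerSeries.X i) = 0)
    (hlow : ∀ N f, (∀ m : ι →₀ ℕ, m.degree < N + 1 → MvPowerSeries.coeff m f = 0) →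
      ∀ m : ι →₀ ℕ, m.degree < N → MvPowerSeries.coeff m (E f) = 0)
    (f : MvPowerSeries ι A') : E f = 0 := by
  have hpoly : ∀ p : MvPolynomial ι A', E (p : MvPowerSeries ι A') = 0 := by
    intro p
    induction p using MvPolynomial.induction_on with
    | C a => rw [MvPolynomial.coe_C, hC]
    | add p q hp hq => rw [MvPolynomial.coe_add, map_add, hp, hq, add_zero]
    | mul_X p i hp => rw [MvPolynomial.coe_mul, hmul, hp, MvPolynomial.coe_X, hX]; simp
  refine MvPowerSeries.ext fun m => ?_
  -- modulo terms of degree greater than `|m| + 1`, which do not contribute, `f` is a polynomial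
  have hd : f = (MvPowerSeries.truncTotal (m.degree + 2) f : MvPolynomial ι A') +
      (f - (MvPowerSeries.truncTotal (m.degree + 2) f : MvPolynomial ι A')) := by ring
  rw [hd, map_add, hpoly, zero_add]
  refine hlow (m.degree + 1) _ (fun m' hm' => ?_) m (Nat.lt_succ_self _)
  rw [map_sub, MvPolynomial.coeff_coe, MvPowerSeries.coeff_truncTotal f hm', sub_self]

theorem coeff_pderiv_eq_zero {N : ℕ} {f : MvPowerSeries ι A}
    (h : ∀ m, m.degree < N + 1 → MvPowerSeries.coeff m f = 0) (β : ι) (m : ι →₀ ℕ)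
    (hm : m.degree < N) : MvPowerSeries.coeff m (MvPowerSeries.pderiv A β f) = 0 := by
  rw [MvPowerSeries.coeff_pderiv, h, zero_mul]
  rw [map_add, Finsupp.degree_single]
  omega

theorem coeff_mul_eq_zero_of_right {N : ℕ} {f : MvPowerSeries ι A}
    (h : ∀ m, m.degree < N → MvPowerSeries.coeff m f = 0) (g : MvPowerSeries ι A) (m : ι →₀ ℕ)
    (hm : m.degree < N) : MvPowerSeries.coeff m (g * f) = 0 := by
  rw [MvPowerSeries.coeff_mul]
  refine sum_eq_zero fun x hx => ?_
  have := congrArg Finsupp.degree (HasAntidiagonal.mem_antidiagonal.1 hx)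
  rw [map_add] at this
  rw [h x.2 (by omega), mul_zero]

/-- The chain rule for a linear change of the fibre coordinates. -/
theorem pderiv_pullM (α : ι) (f : MvPowerSeries ι A') :
    MvPowerSeries.pderiv A α (pullM σ P f) =
      ∑ β, P β α • pullM σ P (MvPowerSeries.pderiv A' β f) := by
  rw [← sub_eq_zero]
  -- the difference of the two sides is a derivation along `pullM σ P`
  let E : MvPowerSeries ι A' →+ MvPowerSeries ι A := AddMonoidHom.mk'
    (fun f => MvPowerSeries.pderiv A α (pullM σ P f) -
      ∑ β, P β α • pullM σ P (MvPowerSeries.pderiv A' β f)) (fun f g => by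
      simp only [map_add, smul_add, sum_add_distrib]
      abel)
  refine eq_zero_of_pullM_derivation σ P E (fun f g => ?_) (fun c => ?_) (fun i => ?_)
    (fun N f hf m hm => ?_) f
  · change MvPowerSeries.pderiv A α (pullM σ P (f * g)) -
      ∑ β, P β α • pullM σ P (MvPowerSeries.pderiv A' β (f * g)) =
      (MvPowerSeries.pderiv A α (pullM σ P f) -
      ∑ β, P β α • pullM σ P (MvPowerSeries.pderiv A' β f)) * _ + _ *
      (MvPowerSeries.pderiv A α (pullM σ P g) -
      ∑ β, P β α • pullM σ P (MvPowerSeries.pderiv A' β g))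
    simp only [map_mul, Derivation.leibniz, smul_eq_mul, map_add, smul_add, sum_add_distrib,
      sub_mul, mul_sub, sum_mul, mul_sum, mul_smul_comm, smul_mul_assoc]
    simp only [mul_comm]
    ring
  · change MvPowerSeries.pderiv A α (pullM σ P (MvPowerSeries.C c)) -
      ∑ β, P β α • pullM σ P (MvPowerSeries.pderiv A' β (MvPowerSeries.C c)) = 0
    simp [pullM_C, MvPowerSeries.pderiv_C]
  · change MvPowerSeries.pderiv A α (pullM σ P (MvPowerSeries.X i)) -
      ∑ β, P β α • pullM σ P (MvPowerSeries.pderiv A' β (MvPowerSeries.X i)) = 0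
    rw [pullM_X, pderiv_rowForm, sum_eq_single i, MvPowerSeries.pderiv_X_self]
    · simp [MvPowerSeries.smul_eq_C_mul]
    · intro b _ hb
      rw [MvPowerSeries.pderiv_X_of_ne hb.symm, map_zero, smul_zero]
    · simp
  · change MvPowerSeries.coeff m (MvPowerSeries.pderiv A α (pullM σ P f) -
      ∑ β, P β α • pullM σ P (MvPowerSeries.pderiv A' β f)) = 0
    rw [map_sub, coeff_pderiv_eq_zero (coeff_pullM_eq_zero σ P hf) α m hm, map_sum, zero_sub,
      neg_eq_zero]
    refine sum_eq_zero fun β _ => ?_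
    rw [map_smul, coeff_pullM_eq_zero σ P (coeff_pderiv_eq_zero hf β) m hm, smul_zero]

/-- The chain rule for derivations of the coefficients. -/
theorem coeffDer_pullM {d : Derivation ℂ A A} {d' : ι → Derivation ℂ A' A'} {c : ι → A}
    (h : ∀ a, d (σ a) = ∑ δ, c δ * σ (d' δ a)) (f : MvPowerSeries ι A') :
    coeffDer d (pullM σ P f) = ∑ δ, c δ • pullM σ P (coeffDer (d' δ) f) +
      ∑ β, rowForm (P.map d) β * pullM σ P (MvPowerSeries.pderiv A' β f) := by
  rw [← sub_eq_zero]
  -- the difference of the two sides is a derivation along `pullM σ P`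
  let E : MvPowerSeries ι A' →+ MvPowerSeries ι A := AddMonoidHom.mk'
    (fun f => coeffDer d (pullM σ P f) - (∑ δ, c δ • pullM σ P (coeffDer (d' δ) f) +
      ∑ β, rowForm (P.map d) β * pullM σ P (MvPowerSeries.pderiv A' β f))) (fun f g => by
      simp only [map_add, smul_add, mul_add, sum_add_distrib]
      abel)
  refine eq_zero_of_pullM_derivation σ P E (fun f g => ?_) (fun c' => ?_) (fun i => ?_)
    (fun N f hf m hm => ?_) f
  · change coeffDer d (pullM σ P (f * g)) - (∑ δ, c δ • pullM σ P (coeffDer (d' δ) (f * g)) +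
      ∑ β, rowForm (P.map d) β * pullM σ P (MvPowerSeries.pderiv A' β (f * g))) =
      (coeffDer d (pullM σ P f) - (∑ δ, c δ • pullM σ P (coeffDer (d' δ) f) +
      ∑ β, rowForm (P.map d) β * pullM σ P (MvPowerSeries.pderiv A' β f))) * _ + _ *
      (coeffDer d (pullM σ P g) - (∑ δ, c δ • pullM σ P (coeffDer (d' δ) g) +
      ∑ β, rowForm (P.map d) β * pullM σ P (MvPowerSeries.pderiv A' β g)))
    simp only [map_mul, Derivation.leibniz, smul_eq_mul, map_add, smul_add, mul_add,
      sum_add_distrib, sub_mul, mul_sub, add_mul, sum_mul, mul_sum, mul_smul_comm,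
      smul_mul_assoc]
    have e1 : ∀ x y z : MvPowerSeries ι A, x * (y * z) = y * x * z := fun x y z => by ring
    have e2 : ∀ x y z : MvPowerSeries ι A, x * (y * z) = x * z * y := fun x y z => by ring
    have h1 : ∑ β, rowForm (P.map d) β * (pullM σ P f * pullM σ P (MvPowerSeries.pderiv A' β g)) =
        ∑ β, pullM σ P f * (rowForm (P.map d) β * pullM σ P (MvPowerSeries.pderiv A' β g)) :=
      sum_congr rfl fun β _ => by ring
    have h2 : ∑ β, rowForm (P.map d) β * (pullM σ P g * pullM σ P (MvPowerSeries.pderiv A' β f)) =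
        ∑ β, rowForm (P.map d) β * pullM σ P (MvPowerSeries.pderiv A' β f) * pullM σ P g :=
      sum_congr rfl fun β _ => by ring
    have h3 : ∑ δ, c δ • (pullM σ P g * pullM σ P (coeffDer (d' δ) f)) =
        ∑ δ, c δ • (pullM σ P (coeffDer (d' δ) f) * pullM σ P g) :=
      sum_congr rfl fun β _ => by rw [mul_comm]
    rw [h1, h2, h3]
    ring
  · change coeffDer d (pullM σ P (MvPowerSeries.C c')) -
      (∑ δ, c δ • pullM σ P (coeffDer (d' δ) (MvPowerSeries.C c')) +
      ∑ β, rowForm (P.map d) β * pullM σ P (MvPowerSeries.pderiv A' β (MvPowerSeries.C c'))) = 0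
    simp only [pullM_C, coeffDer_C, MvPowerSeries.pderiv_C, map_zero, mul_zero, sum_const_zero,
      add_zero, h, map_sum, map_mul, MvPowerSeries.smul_eq_C_mul, sub_self]
  · change coeffDer d (pullM σ P (MvPowerSeries.X i)) -
      (∑ δ, c δ • pullM σ P (coeffDer (d' δ) (MvPowerSeries.X i)) +
      ∑ β, rowForm (P.map d) β * pullM σ P (MvPowerSeries.pderiv A' β (MvPowerSeries.X i))) = 0
    have h2 : ∑ β, rowForm (P.map d) β * pullM σ P (MvPowerSeries.pderiv A' β (MvPowerSeries.X i))
        = rowForm (P.map d) i := by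
      rw [sum_eq_single i]
      · simp
      · intro b _ hb
        rw [MvPowerSeries.pderiv_X_of_ne hb.symm, map_zero, mul_zero]
      · simp
    rw [pullM_X, h2]
    simp only [coeffDer_X, map_zero, smul_zero, sum_const_zero, zero_add]
    simp only [rowForm, map_sum, coeffDer_smul, coeffDer_X, smul_zero, add_zero, Matrix.map_apply,
      sub_self]
  · have hf' : ∀ m : ι →₀ ℕ, m.degree < N → MvPowerSeries.coeff m f = 0 :=
      fun m hm => hf m (by omega)
    change MvPowerSeries.coeff m (coeffDer d (pullM σ P f) -
      (∑ δ, c δ • pullM σ P (coeffDer (d' δ) f) +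
      ∑ β, rowForm (P.map d) β * pullM σ P (MvPowerSeries.pderiv A' β f))) = 0
    rw [map_sub, coeff_coeffDer, coeff_pullM_eq_zero σ P hf' m hm, map_zero, map_add, map_sum,
      map_sum, zero_sub, neg_eq_zero]
    rw [sum_eq_zero, sum_eq_zero, add_zero]
    · exact fun β _ => coeff_mul_eq_zero_of_right
        (coeff_pullM_eq_zero σ P (coeff_pderiv_eq_zero hf β)) _ m hm
    · intro δ _
      rw [map_smul, coeff_pullM_eq_zero σ P (fun m hm => ?_) m hm, smul_zero]
      rw [coeff_coeffDer, hf' m hm, map_zero]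

end

end LagrangeFedosov

namespace LagrangeFedosov

open Finset

/-! ### Changes of the fibre coordinates in the Wick algebra -/

section

variable {ι A A' : Type*} [Fintype ι] [DecidableEq ι] [CommRing A] [Algebra ℂ A]
  [CommRing A'] [Algebra ℂ A'] (σ : A' →ₐ[ℂ] A) (P : Matrix ι ι A)

theorem sum_comm_pair {M : Type*} [AddCommMonoid M] (f : ι → ι → ι → ι → M) :
    ∑ α, ∑ β, ∑ γ, ∑ δ, f α β γ δ = ∑ γ, ∑ δ, ∑ α, ∑ β, f α β γ δ := by
  rw [sum_congr rfl fun α _ => sum_comm, sum_comm]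
  refine sum_congr rfl fun γ _ => ?_
  rw [sum_congr rfl fun α _ => sum_comm, sum_comm]

/-- Contractions commute with linear changes of the fibre coordinates under which `Λ` is
a tensor. -/
theorem bidiff_pullM {Λ : Matrix ι ι A} {Λ' : Matrix ι ι A'} (h : Λ'.map σ = P * Λ * Pᵀ) (k : ℕ)
    (f g : MvPowerSeries ι A') :
    bidiff Λ k (pullM σ P f) (pullM σ P g) = pullM σ P (bidiff Λ' k f g) := by
  induction k generalizing f g with
  | zero => simp only [bidiff_zero, map_mul]
  | succ k ih =>
    have h' : ∀ γ δ, σ (Λ' γ δ) = ∑ α, ∑ β, P γ α * Λ α β * P δ β := fun γ δ => by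
      have := congrFun (congrFun h γ) δ
      rw [Matrix.map_apply] at this
      rw [this]
      simp only [Matrix.mul_apply, Matrix.transpose_apply, sum_mul]
      rw [sum_comm]
    simp only [bidiff_succ, map_sum, pullM_smul, h', pderiv_pullM, map_smul,
      LinearMap.sum_apply, LinearMap.smul_apply, ih, smul_sum, sum_smul, smul_smul]
    rw [sum_comm_pair, sum_comm]
    refine sum_congr rfl fun γ _ => ?_
    refine sum_congr rfl fun δ _ => ?_
    refine sum_congr rfl fun α _ => ?_
    refine sum_congr rfl fun β _ => ?_
    congr 1
    ring

end

namespace WickAlg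

variable {ι A A' : Type*} [Fintype ι] [DecidableEq ι] [CommRing A] [Algebra ℂ A]
  [CommRing A'] [Algebra ℂ A'] (σ : A' →ₐ[ℂ] A) (P : Matrix ι ι A)
  {Λ : Matrix ι ι A} {Λ' : Matrix ι ι A'}

/-- Linear change of the fibre coordinates in the Wick algebra. -/
noncomputable def pull : WickAlg Λ' →ₗ[ℂ] WickAlg Λ where
  toFun a := fun r => pullM σ P (a r)
  map_add' a b := ext_v fun r => map_add (pullM σ P) (a r) (b r)
  map_smul' c a := ext_v fun r => pullM_csmul σ P c (a r)

theorem pull_apply (a : WickAlg Λ') (r : ℕ) : (pull σ P a : WickAlg Λ) r = pullM σ P (a r) := rfl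

theorem pull_smul (c : A') (a : WickAlg Λ') :
    (pull σ P (c • a) : WickAlg Λ) = σ c • pull σ P a :=
  ext_v fun r => pullM_smul σ P c (a r)

theorem pull_mul (h : Λ'.map σ = P * Λ * Pᵀ) (a b : WickAlg Λ') :
    (pull σ P (a * b) : WickAlg Λ) = pull σ P a * pull σ P b := by
  refine ext_v fun r => ?_
  rw [pull_apply, mul_apply, mul_apply]
  simp only [map_sum, pullM_csmul, ← bidiff_pullM σ P h]
  rfl

theorem pull_one : (pull σ P (1 : WickAlg Λ') : WickAlg Λ) = 1 := by
  refine ext_v fun r => ?_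
  rw [pull_apply, one_apply, one_apply]
  split_ifs <;> simp

theorem pull_sh (a : WickAlg Λ') : (pull σ P (sh a) : WickAlg Λ) = sh (pull σ P a) := by
  refine ext_v fun r => ?_
  cases r with
  | zero => exact map_zero (pullM σ P)
  | succ r => rfl

theorem pull_br (h : Λ'.map σ = P * Λ * Pᵀ) (a b : WickAlg Λ') :
    (pull σ P (br a b) : WickAlg Λ) = br (pull σ P a) (pull σ P b) := by
  apply sh_injective
  rw [← pull_sh, sh_br, sh_br, map_sub, pull_mul σ P h, pull_mul σ P h]

theorem del_pull (α : ι) (a : WickAlg Λ') :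
    del α (pull σ P a : WickAlg Λ) = ∑ β, P β α • pull σ P (del β a) := by
  refine ext_v fun r => ?_
  rw [val_sum, del_apply, pull_apply, pderiv_pullM]
  rfl

theorem pull_mulX (β : ι) (a : WickAlg Λ') :
    (pull σ P (mulX β a) : WickAlg Λ) = ∑ α, P β α • mulX α (pull σ P a) := by
  refine ext_v fun r => ?_
  rw [val_sum, pull_apply, mulX_apply, map_mul, pullM_X, rowForm, sum_mul]
  refine sum_congr rfl fun α _ => ?_
  rw [val_smul, mulX_apply, pull_apply, smul_mul_assoc]

theorem num_zero_pull (a : WickAlg Λ') :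
    num 0 (pull σ P a : WickAlg Λ) = pull σ P (num 0 a) := by
  rw [← sum_mulX_del, ← sum_mulX_del, map_sum]
  simp only [del_pull, pull_mulX, map_sum, mulX_smul]
  rw [sum_comm]

theorem num_pull (c : ℕ) (a : WickAlg Λ') :
    num c (pull σ P a : WickAlg Λ) = pull σ P (num c a) := by
  have h1 := num_add 0 c (pull σ P a : WickAlg Λ)
  have h2 := num_add 0 c a
  rw [zero_add] at h1 h2
  rw [h1, h2, num_zero_pull, map_add, pull_smul, map_natCast]

/-- The covariant derivative is natural if the coefficients of the connection obey the usual
inhomogeneous transformation law. -/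
theorem cov_pull {d : Derivation ℂ A A} {d' : ι → Derivation ℂ A' A'} {c : ι → A}
    {G : Matrix ι ι A} {G' : ι → Matrix ι ι A'}
    (h : ∀ a, d (σ a) = ∑ δ, c δ * σ (d' δ a))
    (hG : P * G - P.map d = ∑ δ, c δ • ((G' δ).map σ * P)) (a : WickAlg Λ') :
    cov d G (pull σ P a : WickAlg Λ) = ∑ δ, c δ • pull σ P (cov (d' δ) (G' δ) a) := by
  refine ext_v fun r => ?_
  rw [val_sum]
  simp only [val_smul, pull_apply, cov_apply, covDer_apply, map_sub, smul_sub, sum_sub_distrib]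
  rw [coeffDer_pullM σ P h, linField_apply]
  simp only [linField_apply, map_sum, map_mul, pderiv_pullM, pullM_rowForm]
  have h1 : ∀ β, ∑ γ, P β γ • rowForm G γ = rowForm (P * G) β := fun β => by
    simp only [rowForm, Matrix.mul_apply, smul_sum, sum_smul, smul_smul]
    rw [sum_comm]
  have h2 : ∀ β, rowForm (P.map d) β - rowForm (P * G) β =
      -∑ δ, c δ • rowForm ((G' δ).map σ * P) β := fun β => by
    have e : ∀ τ, (P.map d) β τ - (P * G) β τ = -∑ δ, c δ * ((G' δ).map σ * P) β τ := fun τ => by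
      have := congrFun (congrFun hG β) τ
      rw [Matrix.sub_apply, Matrix.sum_apply] at this
      simp only [Matrix.smul_apply, smul_eq_mul] at this
      rw [← this]; ring
    simp only [rowForm, ← sum_sub_distrib, ← sub_smul, e, smul_sum, smul_smul, neg_smul,
      sum_smul, sum_neg_distrib]
    rw [sum_comm]
  have h3 : ∑ γ, rowForm G γ * ∑ β, P β γ • pullM σ P (MvPowerSeries.pderiv A' β (a r)) =
      ∑ β, rowForm (P * G) β * pullM σ P (MvPowerSeries.pderiv A' β (a r)) := by
    simp only [← h1, mul_sum, sum_mul, mul_smul_comm, smul_mul_assoc]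
    rw [sum_comm]
  have h4 : ∑ δ, c δ • ∑ β, rowForm ((G' δ).map σ * P) β *
      pullM σ P (MvPowerSeries.pderiv A' β (a r)) =
      -(∑ β, (rowForm (P.map d) β - rowForm (P * G) β) *
        pullM σ P (MvPowerSeries.pderiv A' β (a r))) := by
    simp only [h2, neg_mul, sum_neg_distrib, neg_neg, smul_sum, sum_mul, smul_mul_assoc]
    rw [sum_comm]
  rw [h3, h4]
  simp only [sub_mul, sum_sub_distrib]
  abel

/-- A change of the fibre coordinates preserves the filtration by the total degree. -/
theorem dp_pull_eq_zero {a : WickAlg Λ'} {N : ℕ} (h : ∀ j < N, dp j a = 0) :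
    ∀ j < N, dp j (pull σ P a : WickAlg Λ) = 0 := by
  intro j hj
  refine WickAlg.ext fun r m => ?_
  rw [coeff_dp]
  split_ifs with hm
  · rw [pull_apply]
    refine coeff_pullM_eq_zero σ P (N := m.degree + 1) (fun m' hm' => ?_) m (Nat.lt_succ_self _)
    have := congrArg (fun x : WickAlg Λ' => MvPowerSeries.coeff m' (x r))
      (h (2 * r + m'.degree) (by omega))
    rw [coeff_dp, if_pos rfl] at this
    exact this
  · rfl

end WickAlg

end LagrangeFedosov

namespace LagrangeFedosov

open Finset

/-! ### Invariance of the connection under changes of coordinates -/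

variable {ι A A' : Type*} [Fintype ι] [DecidableEq ι] [CommRing A] [Algebra ℂ A]
  [CommRing A'] [Algebra ℂ A']

/-- A change of coordinates between two data: the pullback `σ` of scalars and the Jacobian matrix
`P`, by which the derivations, the connections and the tensors are related. -/
structure FedosovDatum.Change (S : FedosovDatum ι A) (S' : FedosovDatum ι A') where
  σ : A' →ₐ[ℂ] A
  P : Matrix ι ι A
  Q : Matrix ι ι A
  Q_mul_P : Q * P = 1
  pdv_σ : ∀ α a, S.pdv α (σ a) = ∑ δ, P δ α * σ (S'.pdv δ a)
  pdv_P : ∀ α β γ, S.pdv α (P β γ) = S.pdv γ (P β α)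
  Γ_law : ∀ α, P * S.Γ α - P.map (S.pdv α) = ∑ δ, P δ α • ((S'.Γ δ).map σ * P)
  θup_law : S'.θup.map σ = P * S.θup * Pᵀ
  gup_law : S'.gup.map σ = P * S.gup * Pᵀ

namespace FedosovDatum.Change

open WickAlg

variable {S : FedosovDatum ι A} {S' : FedosovDatum ι A'} (c : S.Change S')

theorem Λ_law : (S'.Λ).map c.σ = c.P * S.Λ * c.Pᵀ := by
  have e : (S'.Λ).map c.σ = S'.θup.map c.σ - Complex.I • S'.gup.map c.σ := by
    ext i j
    simp [FedosovDatum.Λ]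
  rw [e, c.θup_law, c.gup_law, FedosovDatum.Λ, mul_sub, sub_mul, mul_smul_comm, smul_mul_assoc]

/-- The change of fibre coordinates. -/
noncomputable def Φ : S'.W →ₗ[ℂ] S.W := pull c.σ c.P

theorem Φ_mul (a b : S'.W) : c.Φ (a * b) = c.Φ a * c.Φ b := pull_mul _ _ c.Λ_law a b

theorem Φ_br (a b : S'.W) : c.Φ (br a b) = br (c.Φ a) (c.Φ b) := pull_br _ _ c.Λ_law a b

theorem del_Φ (α : ι) (a : S'.W) : del α (c.Φ a) = ∑ β, c.P β α • c.Φ (del β a) :=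
  del_pull _ _ α a

theorem D_Φ (α : ι) (a : S'.W) : S.D α (c.Φ a) = ∑ β, c.P β α • c.Φ (S'.D β a) :=
  cov_pull _ _ (c.pdv_σ α) (c.Γ_law α) a

theorem D_smul (α : ι) (x : A) (a : S.W) : S.D α (x • a) = S.pdv α x • a + x • S.D α a :=
  cov_smul _ _ x a

theorem ofM_X_eq (μ : ι) : (ofM (MvPowerSeries.X μ) : S.W) =
    ∑ β, c.Q μ β • c.Φ (ofM (MvPowerSeries.X β)) := by
  have h : ∀ β, c.Φ (ofM (MvPowerSeries.X β)) = ∑ γ, c.P β γ • ofM (MvPowerSeries.X γ) := by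
    intro β
    rw [ofM_X, Φ, pull_mulX, pull_one]
    simp only [ofM_X]
  simp only [h, smul_sum, smul_smul]
  rw [sum_comm]
  simp only [← sum_smul]
  have h2 : ∀ γ, ∑ β, c.Q μ β * c.P β γ = (1 : Matrix ι ι A) μ γ := fun γ => by
    rw [← c.Q_mul_P, Matrix.mul_apply]
  simp [h2, Matrix.one_apply]

/-- The pullback of a form of degree `2`. -/
noncomputable def pull₂ (x : ι → ι → S'.W) (α β : ι) : S.W :=
  ∑ δ, ∑ ε, (c.P δ α * c.P ε β) • c.Φ (x δ ε)

theorem br_pull₂ (x : ι → ι → S'.W) (α β : ι) (a : S'.W) : br (c.pull₂ x α β) (c.Φ a) =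
    c.pull₂ (fun δ ε => br (x δ ε) a) α β := by
  simp only [pull₂, map_sum, LinearMap.sum_apply, map_smul, LinearMap.smul_apply, Φ_br]

theorem pull₂_sub (x y : ι → ι → S'.W) (α β : ι) :
    c.pull₂ (fun δ ε => x δ ε - y δ ε) α β = c.pull₂ x α β - c.pull₂ y α β := by
  simp only [pull₂, map_sub, smul_sub, sum_sub_distrib]

theorem pull₂_add (x y : ι → ι → S'.W) (α β : ι) :
    c.pull₂ (fun δ ε => x δ ε + y δ ε) α β = c.pull₂ x α β + c.pull₂ y α β := by
  simp only [pull₂, map_add, smul_add, sum_add_distrib]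

theorem pull₂_csmul (k : ℂ) (x : ι → ι → S'.W) (α β : ι) :
    c.pull₂ (fun δ ε => k • x δ ε) α β = k • c.pull₂ x α β := by
  simp only [pull₂, map_smul, smul_sum]
  exact sum_congr rfl fun δ _ => sum_congr rfl fun ε _ => smul_comm _ _ _

theorem pull₂_neg (x : ι → ι → S'.W) (α β : ι) :
    c.pull₂ (fun δ ε => -x δ ε) α β = -c.pull₂ x α β := by
  simp only [pull₂, map_neg, smul_neg, sum_neg_distrib]

theorem pull₂_swap (x : ι → ι → S'.W) (α β : ι) :
    c.pull₂ (fun δ ε => x ε δ) α β = c.pull₂ x β α := by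
  rw [pull₂, pull₂, sum_comm]
  exact sum_congr rfl fun δ _ => sum_congr rfl fun ε _ => by rw [mul_comm]

theorem D_smul_Φ (x : ι → S'.W) (α β : ι) : S.D α (∑ ε, c.P ε β • c.Φ (x ε)) =
    ∑ ε, S.pdv α (c.P ε β) • c.Φ (x ε) + c.pull₂ (fun δ ε => S'.D δ (x ε)) α β := by
  simp only [map_sum, D_smul, sum_add_distrib, D_Φ, smul_sum, smul_smul]
  congr 1
  rw [pull₂, sum_comm]
  exact sum_congr rfl fun δ _ => sum_congr rfl fun ε _ => by rw [mul_comm]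

theorem del_smul_Φ (x : ι → S'.W) (α β : ι) : del α (∑ ε, c.P ε β • c.Φ (x ε)) =
    c.pull₂ (fun δ ε => del δ (x ε)) α β := by
  simp only [map_sum, del_smul, del_Φ, smul_sum, smul_smul]
  rw [pull₂, sum_comm]
  exact sum_congr rfl fun δ _ => sum_congr rfl fun ε _ => by rw [mul_comm]

/-- A form of degree `2` is the pullback of another one if it generates the pulled back
commutators. -/
theorem eq_of_br {x : S.W} {y : ι → ι → S'.W} {α β : ι}
    (h : ∀ a : S'.W, br x (c.Φ a) = c.pull₂ (fun δ ε => br (y δ ε) a) α β)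
    (hx : ∀ r, MvPowerSeries.constantCoeff (x r) = 0)
    (hy : ∀ δ ε r, MvPowerSeries.constantCoeff (y δ ε r) = 0) : x = c.pull₂ y α β := by
  rw [← sub_eq_zero]
  refine S.eq_zero_of_br (fun μ => ?_) fun r => ?_
  · rw [c.ofM_X_eq]
    simp only [map_sum, map_smul, map_sub, LinearMap.sub_apply, h, br_pull₂, sub_self, smul_zero,
      sum_const_zero]
  · rw [val_sub, map_sub, hx, pull₂, val_sum, map_sum, zero_sub, neg_eq_zero]
    refine sum_eq_zero fun δ _ => ?_
    rw [val_sum, map_sum]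
    refine sum_eq_zero fun ε _ => ?_
    rw [val_smul, Φ, pull_apply, MvPowerSeries.smul_eq_C_mul, map_mul, constantCoeff_pullM, hy,
      map_zero, mul_zero]

/-- The torsion operator is a tensor, because the commutators which it generates are natural. -/
theorem t_law (α β : ι) : S.t α β = c.pull₂ S'.t α β := by
  refine c.eq_of_br (fun a => ?_) (constantCoeff_ofM S (S.constantCoeff_tM α β))
    (fun δ ε => constantCoeff_ofM S' (S'.constantCoeff_tM δ ε))
  have h : Complex.I • br (S.t α β) (c.Φ a) =
      Complex.I • c.pull₂ (fun δ ε => br (S'.t δ ε) a) α β := by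
    rw [← pull₂_csmul]
    simp only [S'.I_smul_br_t]
    rw [S.I_smul_br_t]
    simp only [del_Φ, D_Φ, D_smul_Φ, del_smul_Φ, pull₂_sub]
    rw [c.pull₂_swap (fun δ ε => S'.D δ (del ε a)), c.pull₂_swap (fun δ ε => del δ (S'.D ε a))]
    simp only [c.pdv_P α _ β]
    abel
  exact smul_right_injective _ Complex.I_ne_zero h

/-- The curvature operator is a tensor, because the commutators which it generates are natural. -/
theorem ρ_law (α β : ι) : S.ρ α β = c.pull₂ S'.ρ α β := by
  refine c.eq_of_br (fun a => ?_) (constantCoeff_ofM S (S.constantCoeff_ρM α β))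
    (fun δ ε => constantCoeff_ofM S' (S'.constantCoeff_ρM δ ε))
  have h : Complex.I • br (S.ρ α β) (c.Φ a) =
      Complex.I • c.pull₂ (fun δ ε => br (S'.ρ δ ε) a) α β := by
    rw [← pull₂_csmul]
    simp only [S'.I_smul_br_ρ]
    rw [S.I_smul_br_ρ, pull₂_neg]
    simp only [D_Φ, D_smul_Φ, pull₂_sub]
    rw [c.pull₂_swap (fun δ ε => S'.D δ (S'.D ε a))]
    simp only [c.pdv_P α _ β]
    abel
  exact smul_right_injective _ Complex.I_ne_zero h

/-- Fedosov's element is a global form of degree `1`: its pullback solves the equation which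
determines it. -/
theorem r_law (α : ι) : S.r α = ∑ β, c.P β α • c.Φ (S'.r β) := by
  symm
  refine S.r_unique (r' := fun α => ∑ β, c.P β α • c.Φ (S'.r β)) (fun β j hj => ?_)
    (fun β => ?_) α
  · rw [map_sum]
    refine sum_eq_zero fun δ _ => ?_
    rw [map_smul, Φ, dp_pull_eq_zero c.σ c.P (fun j hj => S'.dp_r_of_lt δ j hj) j hj, smul_zero]
  · have hbr : ∀ α, br (∑ δ, c.P δ α • c.Φ (S'.r δ)) (∑ ε, c.P ε β • c.Φ (S'.r ε)) =
        c.pull₂ (fun δ ε => br (S'.r δ) (S'.r ε)) α β := fun α => by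
      simp only [map_sum, map_smul, LinearMap.sum_apply, LinearMap.smul_apply, ← Φ_br, smul_sum,
        smul_smul, pull₂]
      rw [sum_comm]
      exact sum_congr rfl fun δ _ => sum_congr rfl fun ε _ => by rw [mul_comm]
    have e : ∀ α, S.t α β + S.ρ α β + (S.D α (∑ ε, c.P ε β • c.Φ (S'.r ε)) -
        S.D β (∑ ε, c.P ε α • c.Φ (S'.r ε))) - Complex.I •
          br (∑ δ, c.P δ α • c.Φ (S'.r δ)) (∑ ε, c.P ε β • c.Φ (S'.r ε)) =
        c.pull₂ (fun δ ε => S'.t δ ε + S'.ρ δ ε + (S'.D δ (S'.r ε) - S'.D ε (S'.r δ)) -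
          Complex.I • br (S'.r δ) (S'.r ε)) α β := fun α => by
      rw [hbr, D_smul_Φ, D_smul_Φ, pull₂_sub, pull₂_add, pull₂_add, pull₂_sub, pull₂_csmul,
        ← t_law, ← ρ_law, c.pull₂_swap (fun δ ε => S'.D δ (S'.r ε))]
      simp only [c.pdv_P α _ β]
      abel
    simp only [e]
    have h2 : ∀ ε, num 1 (c.Φ (S'.r ε)) = ∑ δ, ∑ α, c.P δ α • mulX α (c.Φ
        (S'.t δ ε + S'.ρ δ ε + (S'.D δ (S'.r ε) - S'.D ε (S'.r δ)) -
          Complex.I • br (S'.r δ) (S'.r ε))) := fun ε => by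
      rw [Φ, num_pull, S'.num_r, map_sum]
      exact sum_congr rfl fun δ _ => pull_mulX _ _ _ _
    have h3 : ∀ (x : A) (a : S.W), num 1 (x • a) = x • num 1 a := fun x a =>
      WickAlg.ext fun r m => by
        rw [coeff_num, val_smul, val_smul, map_smul, map_smul, coeff_num]
        simp only [smul_eq_mul]
        ring
    rw [map_sum]
    simp only [h3, h2, pull₂, map_sum, mulX_smul, smul_sum, smul_smul]
    rw [sum_congr rfl fun ε _ => sum_comm, sum_comm]
    refine sum_congr rfl fun α _ => ?_
    rw [sum_comm]
    exact sum_congr rfl fun δ _ => sum_congr rfl fun ε _ => by rw [mul_comm]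

/-- Fedosov's connection is globally defined. -/
theorem fD_Φ (α : ι) (a : S'.W) : S.fD α (c.Φ a) = ∑ β, c.P β α • c.Φ (S'.fD β a) := by
  simp only [fD, map_add, map_sub, map_neg, map_smul, smul_add, smul_sub, smul_neg,
    sum_add_distrib, sum_sub_distrib, sum_neg_distrib, Φ_br]
  rw [del_Φ, D_Φ, c.r_law α, map_sum, LinearMap.sum_apply, smul_sum]
  congr 1
  refine sum_congr rfl fun β _ => ?_
  rw [map_smul, LinearMap.smul_apply, smul_comm]

theorem isFlat_Φ {a : S'.W} (h : S'.IsFlat a) : S.IsFlat (c.Φ a) := fun α => by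
  rw [fD_Φ]
  exact sum_eq_zero fun β _ => by rw [h β, map_zero, smul_zero]

end FedosovDatum.Change

end LagrangeFedosov

namespace LagrangeFedosov

open Finset

/-! ### The geometry of a regular Lagrangian over an algebra of functions -/

/-- A regular Lagrangian `L` over a commutative algebra `A` with commuting derivations
`∂/∂x^i = pdv (Sum.inl i)`, `∂/∂y^i = pdv (Sum.inr i)`; `y k` is the coordinate `y^k`. -/
structure LagrangeDatum (n : ℕ) (A : Type*) [CommRing A] [Algebra ℂ A] where
  pdv : Idx n → Derivation ℂ A A
  pdv_comm : ∀ α β a, pdv α (pdv β a) = pdv β (pdv α a)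
  L : A
  y : Fin n → A
  pdv_inr_y : ∀ j k, pdv (Sum.inr j) (y k) = if j = k then 1 else 0
  hinv : Matrix (Fin n) (Fin n) A
  h_mul_hinv : (Matrix.of fun i j => (1 / 2 : ℂ) • pdv (Sum.inr i) (pdv (Sum.inr j) L)) * hinv = 1

/-- The Christoffel symbols of the matrix `h` with inverse `hinv`, for the derivations `d`. -/
noncomputable def christoffel {n : ℕ} {A : Type*} [CommRing A] [Algebra ℂ A]
    (d : Fin n → Derivation ℂ A A) (h hinv : Matrix (Fin n) (Fin n) A) (k : Fin n) :
    Matrix (Fin n) (Fin n) A :=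
  Matrix.of fun i j => (1 / 2 : ℂ) • ∑ m, hinv i m * (d k (h j m) + d j (h m k) - d m (h j k))

section

variable {n : ℕ} {A : Type*} [CommRing A] [Algebra ℂ A]

theorem mul_christoffel_apply (d : Fin n → Derivation ℂ A A) {h hinv : Matrix (Fin n) (Fin n) A}
    (hi : h * hinv = 1) (k m j : Fin n) : (h * christoffel d h hinv k) m j =
      (1 / 2 : ℂ) • (d k (h j m) + d j (h m k) - d m (h j k)) := by
  have e : christoffel d h hinv k = (1 / 2 : ℂ) •
      (hinv * Matrix.of fun p j => d k (h j p) + d j (h p k) - d p (h j k)) := by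
    ext i j
    simp [christoffel, Matrix.mul_apply]
  rw [e, mul_smul_comm, ← Matrix.mul_assoc, hi, Matrix.one_mul]
  rfl

/-- The Christoffel symbols are those of a metric connection. -/
theorem christoffel_metric (d : Fin n → Derivation ℂ A A) {h hinv : Matrix (Fin n) (Fin n) A}
    (hi : h * hinv = 1) (hs : hᵀ = h) (k : Fin n) :
    h.map (d k) = (christoffel d h hinv k)ᵀ * h + h * christoffel d h hinv k := by
  have e : (christoffel d h hinv k)ᵀ * h = (h * christoffel d h hinv k)ᵀ := by
    rw [Matrix.transpose_mul, hs]
  have hs' : ∀ i j, h i j = h j i := fun i j => congrFun (congrFun hs j) i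
  rw [e]
  ext m j
  rw [Matrix.add_apply, Matrix.transpose_apply, mul_christoffel_apply d hi,
    mul_christoffel_apply d hi, Matrix.map_apply, ← smul_add, hs' j k, hs' m k, hs' k j, hs' k m,
    hs' j m]
  module

theorem map_derivation_inverse {ι : Type*} [Fintype ι] [DecidableEq ι] (d : Derivation ℂ A A)
    {X Y : Matrix ι ι A} (h : X * Y = 1) : Y.map d = -(Y * X.map d * Y) := by
  have h1 := Matrix_map_derivation_mul d X Y
  rw [h, Matrix_map_derivation_one] at h1
  have h2 := congrArg (fun Z => Y * Z) h1.symm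
  simp only [mul_add, mul_zero, ← Matrix.mul_assoc, mul_eq_one_comm.1 h, Matrix.one_mul] at h2
  exact eq_neg_of_add_eq_zero_right h2

end

/-- The matrix of the almost complex structure in an adapted frame. -/
def J₀ (n : ℕ) (A : Type*) [CommRing A] : Matrix (Idx n) (Idx n) A := Matrix.fromBlocks 0 1 (-1) 0

section

variable {n : ℕ} {A : Type*} [CommRing A]

theorem J₀_mul_transpose : J₀ n A * (J₀ n A)ᵀ = 1 := by
  simp [J₀, Matrix.fromBlocks_transpose, Matrix.fromBlocks_multiply]

theorem J₀_transpose : (J₀ n A)ᵀ = -J₀ n A := by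
  simp [J₀, Matrix.fromBlocks_transpose, Matrix.fromBlocks_neg]

theorem J₀_mul_diag (X : Matrix (Fin n) (Fin n) A) :
    J₀ n A * Matrix.fromBlocks X 0 0 X = Matrix.fromBlocks X 0 0 X * J₀ n A := by
  simp [J₀, Matrix.fromBlocks_multiply]

end

namespace LagrangeDatum

variable {n : ℕ} {A : Type*} [CommRing A] [Algebra ℂ A] (X : LagrangeDatum n A)

/-- `h_{ij} = (1/2) ∂²L/∂y^i∂y^j`. -/
noncomputable def h : Matrix (Fin n) (Fin n) A :=
  Matrix.of fun i j => (1 / 2 : ℂ) • X.pdv (Sum.inr i) (X.pdv (Sum.inr j) X.L)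

/-- The semispray coefficients. -/
noncomputable def G (i : Fin n) : A := (1 / 4 : ℂ) • ∑ j, X.hinv i j *
  ((∑ k, X.pdv (Sum.inr j) (X.pdv (Sum.inl k) X.L) * X.y k) - X.pdv (Sum.inl j) X.L)

/-- The canonical N-connection `N^a_i`. -/
noncomputable def N : Matrix (Fin n) (Fin n) A :=
  Matrix.of fun a i => X.pdv (Sum.inr i) (X.G a)

/-- The adapted coframe; the row `α` lists the components of `e^α`. -/
noncomputable def E : Matrix (Idx n) (Idx n) A := Matrix.fromBlocks 1 0 X.N 1

/-- The adapted frame; the column `α` lists the components of `e_α`. -/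
noncomputable def F : Matrix (Idx n) (Idx n) A := Matrix.fromBlocks 1 0 (-X.N) 1

/-- The derivation along the adapted frame vector `e_α`. -/
noncomputable def e (α : Idx n) : Derivation ℂ A A := ∑ μ, X.F μ α • X.pdv μ

/-- The Christoffel symbols `L^i_{jk}` (for `α = Sum.inl k`) and `C^i_{jk}` (for
`α = Sum.inr k`). -/
noncomputable def K (α : Idx n) : Matrix (Fin n) (Fin n) A :=
  match α with
  | Sum.inl k => christoffel (fun k => X.e (Sum.inl k)) X.h X.hinv k
  | Sum.inr k => christoffel (fun k => X.e (Sum.inr k)) X.h X.hinv k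

/-- The matrix of `h` in both the horizontal and the vertical block. -/
noncomputable def H : Matrix (Idx n) (Idx n) A := Matrix.fromBlocks X.h 0 0 X.h

/-- The inverse of `H`. -/
noncomputable def Hinv : Matrix (Idx n) (Idx n) A := Matrix.fromBlocks X.hinv 0 0 X.hinv

/-- The matrix of the normal d-connection in the adapted frame, in the direction `e_α`. -/
noncomputable def frameConn (α : Idx n) : Matrix (Idx n) (Idx n) A :=
  Matrix.fromBlocks (X.K α) 0 0 (X.K α)

/-- The matrix of the normal d-connection in the adapted frame, in the direction `∂_μ`. -/
noncomputable def Ω (μ : Idx n) : Matrix (Idx n) (Idx n) A := ∑ α, X.E α μ • X.frameConn α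

/-- The matrix of the normal d-connection in the coordinate frame, in the direction `∂_μ`. -/
noncomputable def Γ (μ : Idx n) : Matrix (Idx n) (Idx n) A :=
  X.F * (X.E.map (X.pdv μ) + X.Ω μ * X.E)

theorem E_mul_F : X.E * X.F = 1 := by
  simp [E, F, Matrix.fromBlocks_multiply]

theorem F_mul_E : X.F * X.E = 1 := mul_eq_one_comm.1 X.E_mul_F

theorem h_mul : X.h * X.hinv = 1 := X.h_mul_hinv

theorem h_symm : X.hᵀ = X.h := by
  ext i j
  simp only [h, Matrix.transpose_apply, Matrix.of_apply]
  rw [X.pdv_comm]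

theorem hinv_symm : X.hinvᵀ = X.hinv := by
  have h1 : X.hinvᵀ * X.h = 1 := by
    have := congrArg Matrix.transpose X.h_mul
    rwa [Matrix.transpose_mul, X.h_symm, Matrix.transpose_one] at this
  calc X.hinvᵀ = X.hinvᵀ * (X.h * X.hinv) := by rw [X.h_mul, mul_one]
    _ = X.hinv := by rw [← Matrix.mul_assoc, h1, one_mul]

theorem H_mul_Hinv : X.H * X.Hinv = 1 := by
  simp [H, Hinv, Matrix.fromBlocks_multiply, X.h_mul]

theorem Hinv_mul_H : X.Hinv * X.H = 1 := mul_eq_one_comm.1 X.H_mul_Hinv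

theorem Hinv_symm : X.Hinvᵀ = X.Hinv := by
  simp [Hinv, Matrix.fromBlocks_transpose, X.hinv_symm]

theorem e_apply (α : Idx n) (a : A) : X.e α a = ∑ μ, X.F μ α * X.pdv μ a := by
  change Derivation.coeFnAddMonoidHom (X.e α) a = _
  rw [e, map_sum, Finset.sum_apply]
  rfl

theorem pdv_eq (μ : Idx n) (a : A) : X.pdv μ a = ∑ α, X.E α μ * X.e α a := by
  simp only [e_apply, mul_sum, ← mul_assoc]
  rw [sum_comm]
  simp only [← sum_mul]
  have h2 : ∀ ν, ∑ α, X.E α μ * X.F ν α = (1 : Matrix (Idx n) (Idx n) A) ν μ := fun ν => by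
    rw [← X.F_mul_E, Matrix.mul_apply]
    exact sum_congr rfl fun _ _ => mul_comm _ _
  simp [h2, Matrix.one_apply]

theorem e_h (α : Idx n) : X.h.map (X.e α) = (X.K α)ᵀ * X.h + X.h * X.K α := by
  rcases α with k | k
  · exact christoffel_metric (fun k => X.e (Sum.inl k)) X.h_mul X.h_symm k
  · exact christoffel_metric (fun k => X.e (Sum.inr k)) X.h_mul X.h_symm k

theorem pdv_H (μ : Idx n) : X.H.map (X.pdv μ) = (X.Ω μ)ᵀ * X.H + X.H * X.Ω μ := by
  have h1 : ∀ α, X.H.map (X.e α) = (X.frameConn α)ᵀ * X.H + X.H * X.frameConn α := fun α => by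
    simp [H, frameConn, Matrix.fromBlocks_map, Matrix.fromBlocks_transpose,
      Matrix.fromBlocks_multiply,
      Matrix.fromBlocks_add, X.e_h]
  have h2 : X.H.map (X.pdv μ) = ∑ α, X.E α μ • X.H.map (X.e α) := by
    ext i j
    rw [Matrix.map_apply, pdv_eq, Matrix.sum_apply]
    rfl
  rw [h2, Ω, Matrix.transpose_sum, Matrix.sum_mul, Matrix.mul_sum, ← sum_add_distrib]
  refine sum_congr rfl fun α _ => ?_
  rw [h1, smul_add, Matrix.transpose_smul, Matrix.smul_mul, Matrix.mul_smul]

theorem pdv_Hinv (μ : Idx n) :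
    X.Hinv.map (X.pdv μ) + X.Ω μ * X.Hinv + X.Hinv * (X.Ω μ)ᵀ = 0 := by
  rw [map_derivation_inverse _ X.H_mul_Hinv, pdv_H]
  have e1 : X.Hinv * ((X.Ω μ)ᵀ * X.H + X.H * X.Ω μ) * X.Hinv =
      X.Hinv * (X.Ω μ)ᵀ * (X.H * X.Hinv) + (X.Hinv * X.H) * X.Ω μ * X.Hinv := by
    noncomm_ring
  rw [e1, H_mul_Hinv, Hinv_mul_H, mul_one, one_mul]
  abel

theorem Ω_eq (μ : Idx n) : X.Ω μ = Matrix.fromBlocks (∑ α, X.E α μ • X.K α) 0 0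
    (∑ α, X.E α μ • X.K α) := by
  rw [Ω]
  ext (i | i) (j | j) <;> simp [frameConn, Matrix.sum_apply]

/-- A tensor whose matrix in the adapted frame is constant for the connection `Ω` is covariantly
constant. -/
theorem isParallel_of_frame {M : Matrix (Idx n) (Idx n) A} (μ : Idx n)
    (hM : M.map (X.pdv μ) + X.Ω μ * M + M * (X.Ω μ)ᵀ = 0) :
    IsParallel (X.pdv μ) (X.Γ μ) (X.F * M * X.Fᵀ) := by
  have hF := map_derivation_inverse (X.pdv μ) X.E_mul_F
  have hFt : (X.Fᵀ).map (X.pdv μ) = (X.F.map (X.pdv μ))ᵀ := rfl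
  have hEF : X.E * X.F = 1 := X.E_mul_F
  have hEF' : X.Fᵀ * X.Eᵀ = 1 := by rw [← Matrix.transpose_mul, hEF, Matrix.transpose_one]
  unfold IsParallel
  rw [Matrix_map_derivation_mul, Matrix_map_derivation_mul, hFt, hF, Γ, Matrix.transpose_mul,
    Matrix.transpose_add, Matrix.transpose_neg, Matrix.transpose_mul, Matrix.transpose_mul,
    Matrix.transpose_mul]
  have e1 : X.F * (X.E.map (X.pdv μ) + X.Ω μ * X.E) * (X.F * M * X.Fᵀ) =
      X.F * X.E.map (X.pdv μ) * X.F * M * X.Fᵀ + X.F * X.Ω μ * (X.E * X.F) * M * X.Fᵀ := by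
    noncomm_ring
  have e2 : X.F * M * X.Fᵀ * (((X.E.map (X.pdv μ))ᵀ + X.Eᵀ * (X.Ω μ)ᵀ) * X.Fᵀ) =
      X.F * M * X.Fᵀ * (X.E.map (X.pdv μ))ᵀ * X.Fᵀ +
        X.F * M * (X.Fᵀ * X.Eᵀ) * (X.Ω μ)ᵀ * X.Fᵀ := by
    noncomm_ring
  rw [e1, e2, hEF, hEF']
  have e3 : X.F * (M.map (X.pdv μ) + X.Ω μ * M + M * (X.Ω μ)ᵀ) * X.Fᵀ = 0 := by
    rw [hM, mul_zero, zero_mul]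
  rw [← e3]
  noncomm_ring

/-- The metric with upper indices. -/
noncomputable def gup : Matrix (Idx n) (Idx n) A := X.F * X.Hinv * X.Fᵀ

/-- The form `θ` with upper indices. -/
noncomputable def θup : Matrix (Idx n) (Idx n) A := X.F * (X.Hinv * (J₀ n A)ᵀ) * X.Fᵀ

/-- The form `θ`. -/
noncomputable def θ : Matrix (Idx n) (Idx n) A := X.Eᵀ * ((J₀ n A)ᵀ * X.H) * X.E

/-- The potential `(1/2) ∂L/∂y^i dx^i` of `θ`. -/
noncomputable def q : Idx n → A
  | Sum.inl i => (1 / 2 : ℂ) • X.pdv (Sum.inr i) X.L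
  | Sum.inr _ => 0

/-- The antisymmetric part of `h N`, obtained from the derivatives `∂/∂y^i` of the equation `hG`
which defines the semispray. -/
theorem h_mul_N (i j : Fin n) : ∑ a, X.N a i * X.h a j - ∑ a, X.h i a * X.N a j =
    X.pdv (Sum.inl i) (X.q (Sum.inl j)) - X.pdv (Sum.inl j) (X.q (Sum.inl i)) := by
  have hG : ∀ j, ∑ a, X.h j a * X.G a = (1 / 4 : ℂ) •
      ((∑ k, X.pdv (Sum.inr j) (X.pdv (Sum.inl k) X.L) * X.y k) - X.pdv (Sum.inl j) X.L) := by
    intro j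
    set v : Fin n → A := fun j =>
      (∑ k, X.pdv (Sum.inr j) (X.pdv (Sum.inl k) X.L) * X.y k) - X.pdv (Sum.inl j) X.L with hv
    have h1 : ∑ a, X.h j a * X.G a = (1 / 4 : ℂ) • (X.h *ᵥ (X.hinv *ᵥ v)) j := by
      simp only [Matrix.mulVec, dotProduct, G, mul_smul_comm, hv]
      rw [← smul_sum]
    rw [h1, Matrix.mulVec_mulVec, X.h_mul, Matrix.one_mulVec]
  have hd : ∀ i j, ∑ a, X.pdv (Sum.inr i) (X.h j a) * X.G a + ∑ a, X.h j a * X.N a i =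
      (1 / 4 : ℂ) • (X.pdv (Sum.inr j) (X.pdv (Sum.inl i) X.L) +
        (∑ k, X.pdv (Sum.inr i) (X.pdv (Sum.inr j) (X.pdv (Sum.inl k) X.L)) * X.y k) -
        X.pdv (Sum.inr i) (X.pdv (Sum.inl j) X.L)) := by
    intro i j
    have h1 := congrArg (X.pdv (Sum.inr i)) (hG j)
    simp only [map_sum, Derivation.leibniz, Derivation.map_smul, map_sub, smul_eq_mul,
      X.pdv_inr_y, sum_add_distrib, mul_ite, mul_one, mul_zero, sum_ite_eq, mem_univ,
      if_true] at h1
    rw [add_comm (∑ a, _ * X.G a)]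
    calc _ = _ := by
          congr 1
          exact sum_congr rfl fun a _ => mul_comm _ _
      _ = _ := h1
      _ = _ := by
          congr 3
          exact sum_congr rfl fun a _ => mul_comm _ _
  have hh : ∀ a, X.pdv (Sum.inr i) (X.h j a) = X.pdv (Sum.inr j) (X.h i a) := fun a => by
    simp only [h, Matrix.of_apply, Derivation.map_smul]
    rw [X.pdv_comm]
  have h1 := hd i j
  have h2 := hd j i
  have e1 : ∑ a, X.N a i * X.h a j = ∑ a, X.h j a * X.N a i := sum_congr rfl fun a _ => by
    rw [mul_comm, ← X.h_symm, Matrix.transpose_apply, X.h_symm]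
  have e2 : ∀ k, X.pdv (Sum.inr i) (X.pdv (Sum.inr j) (X.pdv (Sum.inl k) X.L)) =
    X.pdv (Sum.inr j) (X.pdv (Sum.inr i) (X.pdv (Sum.inl k) X.L)) := fun k => X.pdv_comm _ _ _
  simp only [hh] at h1
  simp only [e2] at h1
  rw [e1]
  simp only [q, Derivation.map_smul]
  rw [X.pdv_comm (Sum.inl i), X.pdv_comm (Sum.inl j)]
  linear_combination (norm := module) h1 - h2

/-- The form `θ = dq` is exact. -/
theorem θ_eq (α β : Idx n) : X.θ α β = X.pdv α (X.q β) - X.pdv β (X.q α) := by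
  have e : X.θ = Matrix.fromBlocks (X.Nᵀ * X.h - X.h * X.N) (-X.h) X.h 0 := by
    simp only [θ, E, H, J₀, Matrix.fromBlocks_transpose, Matrix.fromBlocks_multiply]
    simp [sub_eq_add_neg]
  rw [e]
  rcases α with i | i <;> rcases β with j | j
  · simp only [Matrix.fromBlocks_apply₁₁, Matrix.sub_apply, Matrix.mul_apply,
      Matrix.transpose_apply, h_mul_N]
  · simp only [Matrix.fromBlocks_apply₁₂, Matrix.neg_apply, q, map_zero, zero_sub,
      Derivation.map_smul, h, Matrix.of_apply]
    rw [X.pdv_comm]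
  · simp only [Matrix.fromBlocks_apply₂₁, q, map_zero, sub_zero,
      Derivation.map_smul, h, Matrix.of_apply]
  · simp [q]

/-- The data of Fedosov's construction which a regular Lagrangian defines. -/
noncomputable def toFedosovDatum : FedosovDatum (Idx n) A where
  pdv := X.pdv
  pdv_comm := X.pdv_comm
  Γ := X.Γ
  θ := X.θ
  θup := X.θup
  gup := X.gup
  gup_symm := by
    rw [gup, Matrix.transpose_mul, Matrix.transpose_mul, Matrix.transpose_transpose, X.Hinv_symm,
      Matrix.mul_assoc]
  θup_antisymm := by
    have h1 : J₀ n A * X.Hinv = X.Hinv * J₀ n A := J₀_mul_diag _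
    rw [θup, Matrix.transpose_mul, Matrix.transpose_mul, Matrix.transpose_mul,
      Matrix.transpose_transpose, Matrix.transpose_transpose, X.Hinv_symm, h1, J₀_transpose]
    noncomm_ring
  θup_mul_θ := by
    have h1 : J₀ n A * X.Hinv = X.Hinv * J₀ n A := J₀_mul_diag _
    have h2 : X.Fᵀ * X.Eᵀ = 1 := by
      rw [← Matrix.transpose_mul, E_mul_F, Matrix.transpose_one]
    rw [θup, θ, Matrix.transpose_mul, Matrix.transpose_mul, Matrix.transpose_mul,
      Matrix.transpose_transpose, Matrix.transpose_transpose, X.Hinv_symm, h1]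
    calc _ = X.F * X.Hinv * J₀ n A * (X.Fᵀ * X.Eᵀ) * (J₀ n A)ᵀ * X.H * X.E := by noncomm_ring
      _ = X.F * X.Hinv * (J₀ n A * (J₀ n A)ᵀ) * X.H * X.E := by rw [h2]; noncomm_ring
      _ = X.F * (X.Hinv * X.H) * X.E := by rw [J₀_mul_transpose]; noncomm_ring
      _ = 1 := by rw [Hinv_mul_H, mul_one, F_mul_E]
  parallel_gup μ := X.isParallel_of_frame μ (X.pdv_Hinv μ)
  parallel_θup μ := by
    refine X.isParallel_of_frame μ ?_
    have h0 : (J₀ n A)ᵀ.map (X.pdv μ) = 0 := by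
      ext (i | i) (j | j) <;> simp [J₀, Matrix.one_apply, apply_ite]
    have h1 : (J₀ n A)ᵀ * (X.Ω μ)ᵀ = (X.Ω μ)ᵀ * (J₀ n A)ᵀ := by
      rw [← Matrix.transpose_mul, ← Matrix.transpose_mul, Ω_eq, J₀_mul_diag]
    rw [Matrix_map_derivation_mul, h0, mul_zero, add_zero, Matrix.mul_assoc X.Hinv, h1,
      ← Matrix.mul_assoc, ← Matrix.mul_assoc, ← add_mul, ← add_mul, pdv_Hinv, zero_mul]
  closed α β γ := by
    simp only [θ_eq, map_sub]
    rw [X.pdv_comm α β, X.pdv_comm β γ, X.pdv_comm α γ]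
    abel

end LagrangeDatum

end LagrangeFedosov

namespace LagrangeFedosov

open Finset

/-! ### Invariance of the normal d-connection -/

section

variable {n : ℕ} {A A' : Type*} [CommRing A] [Algebra ℂ A] [CommRing A'] [Algebra ℂ A']

/-- The transformation law of the Christoffel symbols under a change of frame `a` which satisfies
`d_k a^q_j = d_j a^q_k`. -/
theorem christoffel_change {σ : A' →ₐ[ℂ] A} {a : Matrix (Fin n) (Fin n) A}
    {d : Fin n → Derivation ℂ A A} {d' : Fin n → Derivation ℂ A' A'}
    {h hinv : Matrix (Fin n) (Fin n) A} {h' hinv' : Matrix (Fin n) (Fin n) A'}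
    (hi : h * hinv = 1) (hi' : h' * hinv' = 1) (hs' : h'ᵀ = h')
    (hd : ∀ k x, d k (σ x) = ∑ p, a p k * σ (d' p x))
    (ha : ∀ k q j, d k (a q j) = d j (a q k)) (hh : h = aᵀ * h'.map σ * a) (k : Fin n) :
    a * christoffel d h hinv k - a.map (d k) =
      ∑ p, a p k • ((christoffel d' h' hinv' p).map σ * a) := by
  have hinvl : a * hinv * (aᵀ * h'.map σ) = 1 := by
    have h1 : hinv * (aᵀ * h'.map σ * a) = 1 := by rw [← hh]; exact mul_eq_one_comm.1 hi
    have h2 : hinv * (aᵀ * h'.map σ) * a = 1 := by rw [← h1]; noncomm_ring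
    have h3 := mul_eq_one_comm.1 h2
    rw [← h3]; noncomm_ring
  have hs : ∀ q r, σ (h' q r) = σ (h' r q) := fun q r =>
    congrArg σ (congrFun (congrFun hs' r) q)
  -- the derivative of `h = aᵀ h' a` consists of two terms `U`, in which `a` is differentiated, and
  -- of `Y`, in which `h'` is differentiated; `U` is symmetric in its first two indices
  set U : Fin n → Fin n → Fin n → A := fun k j m =>
    ∑ q, ∑ r, d k (a q j) * σ (h' q r) * a r m with hU
  set Y : Fin n → Fin n → Fin n → A := fun k j m =>
    ∑ q, ∑ r, a q j * a r m * d k (σ (h' q r)) with hY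
  have hdh : ∀ k j m, d k (h j m) = U k j m + U k m j + Y k j m := by
    intro k j m
    have e : h j m = ∑ q, ∑ r, a q j * σ (h' q r) * a r m := by
      rw [hh]
      simp only [Matrix.mul_apply, Matrix.transpose_apply, Matrix.map_apply, sum_mul]
      exact sum_comm
    have e2 : U k m j = ∑ q, ∑ r, a q j * σ (h' q r) * d k (a r m) := by
      rw [hU]
      simp only
      rw [sum_comm]
      exact sum_congr rfl fun q _ => sum_congr rfl fun r _ => by rw [hs r q]; ring
    rw [e, e2, hU, hY]
    simp only [map_sum, Derivation.leibniz, smul_eq_mul, ← sum_add_distrib]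
    exact sum_congr rfl fun q _ => sum_congr rfl fun r _ => by ring
  have hUs : ∀ k j m, U k j m = U j k m := fun k j m => by
    rw [hU]
    exact sum_congr rfl fun q _ => sum_congr rfl fun r _ => by rw [ha k q j]
  have hYd : ∀ k j m, Y k j m = ∑ p, ∑ q, ∑ r, a p k * a q j * a r m * σ (d' p (h' q r)) := by
    intro k j m
    rw [hY]
    simp only [hd, mul_sum]
    rw [sum_congr rfl fun q _ => sum_comm, sum_comm]
    exact sum_congr rfl fun p _ => sum_congr rfl fun q _ => sum_congr rfl fun r _ => by ring
  -- both sides agree after multiplication by the invertible matrix `aᵀ h'`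
  have key : aᵀ * h'.map σ * (a * christoffel d h hinv k - a.map (d k)) =
      aᵀ * h'.map σ * ∑ p, a p k • ((christoffel d' h' hinv' p).map σ * a) := by
    ext m j
    have l1 : aᵀ * h'.map σ * (a * christoffel d h hinv k - a.map (d k)) =
        h * christoffel d h hinv k - aᵀ * h'.map σ * a.map (d k) := by
      rw [hh]; noncomm_ring
    have l2 : (aᵀ * h'.map σ * a.map (d k)) m j = U k j m := by
      rw [hU]
      simp only [Matrix.mul_apply, Matrix.transpose_apply, Matrix.map_apply, sum_mul]
      refine sum_congr rfl fun q _ => sum_congr rfl fun r _ => ?_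
      rw [hs q r]; ring
    have r1 : aᵀ * h'.map σ * ∑ p, a p k • ((christoffel d' h' hinv' p).map σ * a) =
        ∑ p, a p k • (aᵀ * (h' * christoffel d' h' hinv' p).map σ * a) := by
      rw [Matrix.mul_sum]
      refine sum_congr rfl fun p _ => ?_
      rw [Matrix.mul_smul, Matrix.map_mul]
      congr 1
      noncomm_ring
    have hexp : ∀ M : Matrix (Fin n) (Fin n) A,
        (aᵀ * M * a) m j = ∑ q, ∑ r, a r m * M r q * a q j := fun M => by
      simp only [Matrix.mul_apply, Matrix.transpose_apply, sum_mul]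
    have r2 : (∑ p, a p k • (aᵀ * (h' * christoffel d' h' hinv' p).map σ * a)) m j =
        (1 / 2 : ℂ) • (Y k j m + Y j m k - Y m j k) := by
      have y1 : Y j m k = ∑ p, ∑ q, ∑ r, a p k * a q j * a r m * σ (d' q (h' r p)) := by
        rw [hYd, sum_congr rfl fun q _ => sum_comm, sum_comm]
        exact sum_congr rfl fun p _ => sum_congr rfl fun q _ => sum_congr rfl fun r _ => by ring
      have y2 : Y m j k = ∑ p, ∑ q, ∑ r, a p k * a q j * a r m * σ (d' r (h' q p)) := by
        rw [hYd, sum_comm, sum_congr rfl fun q _ => sum_comm, sum_comm]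
        exact sum_congr rfl fun p _ => sum_congr rfl fun q _ => sum_congr rfl fun r _ => by ring
      rw [y1, y2, hYd, ← sum_add_distrib, ← sum_sub_distrib, smul_sum, Matrix.sum_apply]
      refine sum_congr rfl fun p _ => ?_
      rw [← sum_add_distrib, ← sum_sub_distrib, smul_sum, Matrix.smul_apply, smul_eq_mul]
      rw [hexp, mul_sum]
      simp only [Matrix.map_apply, mul_christoffel_apply d' hi', map_smul, map_add, map_sub]
      refine sum_congr rfl fun q _ => ?_
      rw [← sum_add_distrib, ← sum_sub_distrib, smul_sum, mul_sum]
      refine sum_congr rfl fun r _ => ?_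
      simp only [Algebra.smul_def]
      ring
    rw [l1, r1, r2, Matrix.sub_apply, l2, mul_christoffel_apply d hi, hdh, hdh, hdh,
      hUs k m j, hUs m j k, hUs j k m]
    module
  have h1 := congrArg (fun Z => a * hinv * Z) key
  simp only [← Matrix.mul_assoc (a * hinv) (aᵀ * h'.map σ), hinvl, Matrix.one_mul] at h1
  exact h1

end

variable {n : ℕ} {A A' : Type*} [CommRing A] [Algebra ℂ A] [CommRing A'] [Algebra ℂ A']

/-- A change of coordinates under which the metric, the almost complex structure and the vertical
distribution of two regular Lagrangians correspond to each other. -/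
structure LagrangeDatum.Change (X : LagrangeDatum n A) (X' : LagrangeDatum n A') where
  σ : A' →ₐ[ℂ] A
  P : Matrix (Idx n) (Idx n) A
  pdv_σ : ∀ α a, X.pdv α (σ a) = ∑ δ, P δ α * σ (X'.pdv δ a)
  pdv_P : ∀ α β γ, X.pdv α (P β γ) = X.pdv γ (P β α)
  metric : X.Eᵀ * X.H * X.E = Pᵀ * (X'.Eᵀ * X'.H * X'.E).map σ * P
  acs : P * (X.F * J₀ n A * X.E) = (X'.F * J₀ n A' * X'.E).map σ * P
  vertical : ∀ i j, P (Sum.inl i) (Sum.inr j) = 0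

namespace LagrangeDatum.Change

variable {X : LagrangeDatum n A} {X' : LagrangeDatum n A'} (c : X.Change X')

/-- The change of the adapted horizontal frame. -/
def a : Matrix (Fin n) (Fin n) A := c.P.toBlocks₁₁

/-- The change of the adapted frame. -/
def Q : Matrix (Idx n) (Idx n) A := Matrix.fromBlocks c.a 0 0 c.a

theorem map_one : (1 : Matrix (Idx n) (Idx n) A').map c.σ = 1 :=
  Matrix.map_one _ (_root_.map_zero _) (_root_.map_one _)

theorem σE_mul_σF : X'.E.map c.σ * X'.F.map c.σ = 1 := by
  rw [← Matrix.map_mul, E_mul_F, c.map_one]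

theorem σF_mul_σE : X'.F.map c.σ * X'.E.map c.σ = 1 := mul_eq_one_comm.1 c.σE_mul_σF

theorem map_J₀ : (J₀ n A').map c.σ = J₀ n A := by
  rw [J₀, J₀, Matrix.fromBlocks_map]
  congr 1
  · ext i j; simp
  · ext i j; simp [Matrix.one_apply, apply_ite c.σ]
  · ext i j; simp [Matrix.one_apply, apply_ite c.σ]
  · ext i j; simp

/-- The adapted frames of the two Lagrangians are related by a block diagonal matrix: the change of
frame is block triangular because it preserves the vertical distribution, and it commutes with the
almost complex structure. -/
theorem Q_eq : X'.E.map c.σ * c.P * X.F = c.Q := by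
  have hJ : X'.E.map c.σ * c.P * X.F * J₀ n A = J₀ n A * (X'.E.map c.σ * c.P * X.F) := by
    have h := c.acs
    rw [Matrix.map_mul, Matrix.map_mul, c.map_J₀] at h
    have h1 : X'.E.map c.σ * (c.P * (X.F * J₀ n A * X.E)) * X.F =
        X'.E.map c.σ * (X'.F.map c.σ * J₀ n A * X'.E.map c.σ * c.P) * X.F := by rw [h]
    have e1 : X'.E.map c.σ * (c.P * (X.F * J₀ n A * X.E)) * X.F =
        X'.E.map c.σ * c.P * X.F * J₀ n A * (X.E * X.F) := by noncomm_ring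
    have e2 : X'.E.map c.σ * (X'.F.map c.σ * J₀ n A * X'.E.map c.σ * c.P) * X.F =
        (X'.E.map c.σ * X'.F.map c.σ) * J₀ n A * (X'.E.map c.σ * c.P * X.F) := by noncomm_ring
    rw [e1, e2, c.σE_mul_σF, E_mul_F, mul_one, one_mul] at h1
    exact h1
  have hP : c.P = Matrix.fromBlocks c.P.toBlocks₁₁ 0 c.P.toBlocks₂₁ c.P.toBlocks₂₂ := by
    conv_lhs => rw [← Matrix.fromBlocks_toBlocks c.P]
    congr 1
    ext i j
    exact c.vertical i j
  have hE : X'.E.map c.σ = Matrix.fromBlocks 1 0 (X'.N.map c.σ) 1 := by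
    rw [E, Matrix.fromBlocks_map]
    simp
  have hT : ∃ b' c', X'.E.map c.σ * c.P * X.F = Matrix.fromBlocks c.a 0 b' c' := by
    rw [hP, hE, F, Matrix.fromBlocks_multiply, Matrix.fromBlocks_multiply]
    simp [a]
  obtain ⟨b', c', hT⟩ := hT
  rw [hT, J₀, Matrix.fromBlocks_multiply, Matrix.fromBlocks_multiply, Matrix.fromBlocks_inj] at hJ
  obtain ⟨h11, h12, -, -⟩ := hJ
  rw [hT, Q]
  simp only [mul_zero, zero_mul, mul_one, one_mul, add_zero, zero_add] at h11 h12
  rw [← h11, ← h12]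

theorem σE_mul_P : X'.E.map c.σ * c.P = c.Q * X.E := by
  rw [← c.Q_eq, Matrix.mul_assoc _ X.F, F_mul_E, mul_one]

theorem P_mul_F : c.P * X.F = X'.F.map c.σ * c.Q := by
  rw [← c.Q_eq, Matrix.mul_assoc (X'.E.map c.σ), ← Matrix.mul_assoc (X'.F.map c.σ), c.σF_mul_σE,
    one_mul]

theorem H_law : X.H = c.Qᵀ * X'.H.map c.σ * c.Q := by
  have h := c.metric
  have h2 : X.Fᵀ * X.Eᵀ = 1 := by rw [← Matrix.transpose_mul, E_mul_F, Matrix.transpose_one]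
  have h1 : X.Fᵀ * (X.Eᵀ * X.H * X.E) * X.F = X.Fᵀ * (c.Pᵀ *
    (X'.Eᵀ * X'.H * X'.E).map c.σ * c.P) * X.F := by rw [h]
  have e1 : X.Fᵀ * (X.Eᵀ * X.H * X.E) * X.F = (X.Fᵀ * X.Eᵀ) * X.H * (X.E * X.F) := by
    noncomm_ring
  rw [e1, h2, E_mul_F, mul_one, one_mul] at h1
  rw [h1, ← c.Q_eq, Matrix.map_mul, Matrix.map_mul, Matrix.transpose_mul, Matrix.transpose_mul,
    Matrix.transpose_map]
  noncomm_ring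

theorem h_law : X.h = c.aᵀ * X'.h.map c.σ * c.a := by
  have h := c.H_law
  rw [H, H, Q, Matrix.fromBlocks_transpose, Matrix.fromBlocks_map, Matrix.fromBlocks_multiply,
    Matrix.fromBlocks_multiply, Matrix.fromBlocks_inj] at h
  simpa using h.1

theorem e_σ (α : Idx n) (x : A') : X.e α (c.σ x) = ∑ γ, c.Q γ α * c.σ (X'.e γ x) := by
  have h : ∀ γ, c.Q γ α = ∑ μ, ∑ δ, X.F μ α * (c.P δ μ * c.σ (X'.E γ δ)) := fun γ => by
    rw [← c.Q_eq, Matrix.mul_apply]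
    refine sum_congr rfl fun μ _ => ?_
    rw [Matrix.mul_apply, sum_mul]
    refine sum_congr rfl fun δ _ => ?_
    rw [Matrix.map_apply]
    ring
  have h2 : ∀ δ, c.σ (X'.pdv δ x) = ∑ γ, c.σ (X'.E γ δ) * c.σ (X'.e γ x) := fun δ => by
    rw [X'.pdv_eq, map_sum]
    exact sum_congr rfl fun γ _ => map_mul _ _ _
  rw [e_apply]
  simp only [c.pdv_σ, h2, h, mul_sum, sum_mul]
  rw [sum_congr rfl fun μ _ => sum_comm, sum_comm]
  exact sum_congr rfl fun γ _ => sum_congr rfl fun μ _ => sum_congr rfl fun δ _ => by ring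

/-- The integrability condition for `a^q_j = ∂x'^q/∂x^j`. -/
theorem e_inl_a (k q j : Fin n) : X.e (Sum.inl k) (c.a q j) = X.e (Sum.inl j) (c.a q k) := by
  have h : ∀ k j, X.e (Sum.inl k) (c.a q j) = X.pdv (Sum.inl k) (c.P (Sum.inl q) (Sum.inl j)) := by
    intro k j
    rw [e_apply, sum_eq_single (Sum.inl k)]
    · simp [F, a, Matrix.toBlocks₁₁]
    · rintro (i | i) - hi
      · simp [F, show i ≠ k from fun h => hi (by rw [h])]
      · rw [a, Matrix.toBlocks₁₁, Matrix.of_apply, c.pdv_P, c.vertical, map_zero, mul_zero]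
    · simp
  rw [h, h, c.pdv_P]

/-- The Jacobian `∂x'/∂x` does not depend on `y`, because `∂x'/∂y = 0`. -/
theorem e_inr_a (k q j : Fin n) : X.e (Sum.inr k) (c.a q j) = 0 := by
  rw [e_apply]
  refine sum_eq_zero fun μ _ => ?_
  rcases μ with i | i
  · simp [F]
  · rw [a, Matrix.toBlocks₁₁, Matrix.of_apply, c.pdv_P, c.vertical, map_zero, mul_zero]

theorem K_law (α : Idx n) : c.a * X.K α - c.a.map (X.e α) =
    ∑ γ, c.Q γ α • ((X'.K γ).map c.σ * c.a) := by
  rcases α with k | k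
  · rw [Fintype.sum_sum_type]
    simp only [Q, Matrix.fromBlocks_apply₁₁, Matrix.fromBlocks_apply₂₁, Matrix.zero_apply,
      zero_smul, sum_const_zero, add_zero]
    exact christoffel_change (d := fun k => X.e (Sum.inl k)) (d' := fun k => X'.e (Sum.inl k))
      X.h_mul X'.h_mul X'.h_symm (fun k x => by rw [e_σ, Fintype.sum_sum_type]; simp [Q])
      c.e_inl_a c.h_law k
  · rw [Fintype.sum_sum_type]
    simp only [Q, Matrix.fromBlocks_apply₁₂, Matrix.fromBlocks_apply₂₂, Matrix.zero_apply,
      zero_smul, sum_const_zero, zero_add]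
    exact christoffel_change (d := fun k => X.e (Sum.inr k)) (d' := fun k => X'.e (Sum.inr k))
      X.h_mul X'.h_mul X'.h_symm (fun k x => by rw [e_σ, Fintype.sum_sum_type]; simp [Q])
      (fun k q j => by rw [e_inr_a, e_inr_a]) c.h_law k

theorem frameConn_law (α : Idx n) : c.Q * X.frameConn α - c.Q.map (X.e α) =
    ∑ γ, c.Q γ α • ((X'.frameConn γ).map c.σ * c.Q) := by
  have h := c.K_law α
  have e1 : ∀ γ, (X'.frameConn γ).map c.σ * c.Q = Matrix.fromBlocks ((X'.K γ).map c.σ * c.a) 0 0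
      ((X'.K γ).map c.σ * c.a) := fun γ => by
    rw [frameConn, Matrix.fromBlocks_map, Q, Matrix.fromBlocks_multiply]
    simp
  have e2 : ∀ Z : Idx n → Matrix (Fin n) (Fin n) A, ∑ γ, c.Q γ α • Matrix.fromBlocks (Z γ) 0 0 (Z γ)
      = Matrix.fromBlocks (∑ γ, c.Q γ α • Z γ) 0 0 (∑ γ, c.Q γ α • Z γ) := fun Z => by
    ext (i | i) (j | j) <;> simp [Matrix.sum_apply]
  simp only [e1, e2, ← h]
  rw [Q, frameConn, Matrix.fromBlocks_multiply, Matrix.fromBlocks_map]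
  ext (i | i) (j | j) <;> simp

theorem Ω_law (μ : Idx n) : c.Q * X.Ω μ - c.Q.map (X.pdv μ) =
    ∑ δ, c.P δ μ • ((X'.Ω δ).map c.σ * c.Q) := by
  have h1 : c.Q.map (X.pdv μ) = ∑ α, X.E α μ • c.Q.map (X.e α) := by
    ext i j
    rw [Matrix.map_apply, pdv_eq, Matrix.sum_apply]
    rfl
  have h2 : ∀ δ, (X'.Ω δ).map c.σ * c.Q =
      ∑ γ, c.σ (X'.E γ δ) • ((X'.frameConn γ).map c.σ * c.Q) := fun δ => by
    have : (X'.Ω δ).map c.σ = ∑ γ, c.σ (X'.E γ δ) • (X'.frameConn γ).map c.σ := by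
      ext i j
      simp [Ω, Matrix.sum_apply]
    rw [this, Matrix.sum_mul]
    exact sum_congr rfl fun γ _ => Matrix.smul_mul _ _ _
  have h3 : ∀ γ, ∑ δ, c.P δ μ * c.σ (X'.E γ δ) = ∑ α, X.E α μ * c.Q γ α := fun γ => by
    have := congrFun (congrFun c.σE_mul_P γ) μ
    rw [Matrix.mul_apply, Matrix.mul_apply] at this
    simp only [Matrix.map_apply] at this
    simpa only [mul_comm] using this
  have h4 : ∑ δ, c.P δ μ • ((X'.Ω δ).map c.σ * c.Q) =
      ∑ γ, (∑ δ, c.P δ μ * c.σ (X'.E γ δ)) • ((X'.frameConn γ).map c.σ * c.Q) := by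
    simp only [h2, smul_sum, sum_smul, smul_smul]
    exact sum_comm
  have h5 : c.Q * X.Ω μ - c.Q.map (X.pdv μ) =
      ∑ α, X.E α μ • (c.Q * X.frameConn α - c.Q.map (X.e α)) := by
    rw [h1, Ω, Matrix.mul_sum, ← sum_sub_distrib]
    exact sum_congr rfl fun α _ => by rw [Matrix.mul_smul, smul_sub]
  rw [h4, h5]
  simp only [h3, frameConn_law, smul_sum, sum_smul, smul_smul]
  exact sum_comm

/-- The transformation law of the normal d-connection. -/
theorem Γ_law (μ : Idx n) : c.P * X.Γ μ - c.P.map (X.pdv μ) =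
    ∑ δ, c.P δ μ • ((X'.Γ δ).map c.σ * c.P) := by
  have h1 := congrArg (fun Z => Z.map (X.pdv μ)) c.σE_mul_P
  simp only [Matrix_map_derivation_mul] at h1
  have h2 : ∑ δ, c.P δ μ • ((X'.Γ δ).map c.σ * c.P) = X'.F.map c.σ *
      ((X'.E.map c.σ).map (X.pdv μ) * c.P +
        (∑ δ, c.P δ μ • ((X'.Ω δ).map c.σ * c.Q)) * X.E) := by
    have e1 : (X'.E.map c.σ).map (X.pdv μ) = ∑ δ, c.P δ μ • (X'.E.map (X'.pdv δ)).map c.σ := by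
      ext i j
      rw [Matrix.map_apply, Matrix.map_apply, c.pdv_σ, Matrix.sum_apply]
      rfl
    rw [e1, Matrix.sum_mul, Matrix.sum_mul, ← sum_add_distrib, Matrix.mul_sum]
    refine sum_congr rfl fun δ _ => ?_
    have e2 : (X'.Γ δ).map c.σ * c.P = X'.F.map c.σ * ((X'.E.map (X'.pdv δ)).map c.σ * c.P +
        (X'.Ω δ).map c.σ * (X'.E.map c.σ * c.P)) := by
      rw [Γ, Matrix.map_mul, Matrix.map_add _ (map_add c.σ), Matrix.map_mul]
      noncomm_ring
    rw [e2, c.σE_mul_P, Matrix.smul_mul, Matrix.smul_mul, ← smul_add, Matrix.mul_smul]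
    congr 2
    noncomm_ring
  rw [h2, ← Ω_law, Γ, ← Matrix.mul_assoc, P_mul_F]
  have h3 : (X'.E.map c.σ).map (X.pdv μ) * c.P = c.Q.map (X.pdv μ) * X.E +
      c.Q * X.E.map (X.pdv μ) - X'.E.map c.σ * c.P.map (X.pdv μ) := eq_sub_of_add_eq h1
  rw [h3]
  have h4 : X'.F.map c.σ * (c.Q.map (X.pdv μ) * X.E + c.Q * X.E.map (X.pdv μ) -
      X'.E.map c.σ * c.P.map (X.pdv μ) + (c.Q * X.Ω μ - c.Q.map (X.pdv μ)) * X.E) =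
      X'.F.map c.σ * c.Q * (X.E.map (X.pdv μ) + X.Ω μ * X.E) -
        (X'.F.map c.σ * X'.E.map c.σ) * c.P.map (X.pdv μ) := by noncomm_ring
  rw [h4, c.σF_mul_σE, one_mul]

theorem Q_mul_Hinv : c.Q * X.Hinv * c.Qᵀ = X'.Hinv.map c.σ := by
  have h1 : X'.Hinv.map c.σ * X'.H.map c.σ = 1 := by
    rw [← Matrix.map_mul, Hinv_mul_H, c.map_one]
  have h2 : (X.Hinv * c.Qᵀ * X'.H.map c.σ) * c.Q = 1 := by
    rw [← X.Hinv_mul_H, c.H_law]; noncomm_ring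
  have h3 : (c.Q * X.Hinv * c.Qᵀ) * X'.H.map c.σ = 1 := by
    rw [← mul_eq_one_comm.1 h2]; noncomm_ring
  calc _ = (c.Q * X.Hinv * c.Qᵀ) * (X'.H.map c.σ * X'.Hinv.map c.σ) := by
        rw [mul_eq_one_comm.1 h1, mul_one]
    _ = _ := by rw [← Matrix.mul_assoc, h3, one_mul]

theorem up_law {M : Matrix (Idx n) (Idx n) A} {M' : Matrix (Idx n) (Idx n) A'}
    (h : M'.map c.σ = c.Q * M * c.Qᵀ) :
    (X'.F * M' * X'.Fᵀ).map c.σ = c.P * (X.F * M * X.Fᵀ) * c.Pᵀ := by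
  have h1 : X.Fᵀ * c.Pᵀ = c.Qᵀ * (X'.F.map c.σ)ᵀ := by
    rw [← Matrix.transpose_mul, P_mul_F, Matrix.transpose_mul]
  calc _ = X'.F.map c.σ * (c.Q * M * c.Qᵀ) * (X'.F.map c.σ)ᵀ := by
        rw [Matrix.map_mul, Matrix.map_mul, h, Matrix.transpose_map]
    _ = (X'.F.map c.σ * c.Q) * M * (c.Qᵀ * (X'.F.map c.σ)ᵀ) := by noncomm_ring
    _ = _ := by rw [← h1, ← P_mul_F]; noncomm_ring

/-- The change of the data of Fedosov's construction. -/
noncomputable def toFedosov : X.toFedosovDatum.Change X'.toFedosovDatum where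
  σ := c.σ
  P := c.P
  Q := X.F * (X.Hinv * c.Qᵀ * X'.H.map c.σ) * X'.E.map c.σ
  Q_mul_P := by
    have h2 : (X.Hinv * c.Qᵀ * X'.H.map c.σ) * c.Q = 1 := by
      rw [← X.Hinv_mul_H, c.H_law]; noncomm_ring
    rw [Matrix.mul_assoc, σE_mul_P, ← Matrix.mul_assoc, Matrix.mul_assoc X.F, h2, mul_one, F_mul_E]
  pdv_σ := c.pdv_σ
  pdv_P := c.pdv_P
  Γ_law := c.Γ_law
  θup_law := by
    refine c.up_law ?_
    have h1 : (J₀ n A)ᵀ * c.Qᵀ = c.Qᵀ * (J₀ n A)ᵀ := by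
      rw [← Matrix.transpose_mul, ← Matrix.transpose_mul, Q, J₀_mul_diag]
    rw [Matrix.map_mul, Matrix.transpose_map, c.map_J₀, ← Q_mul_Hinv, Matrix.mul_assoc,
      Matrix.mul_assoc, Matrix.mul_assoc, Matrix.mul_assoc, h1]
  gup_law := c.up_law c.Q_mul_Hinv.symm

end LagrangeDatum.Change

end LagrangeFedosov

namespace LagrangeFedosov

open Finset

/-! ### Smooth functions on an open set of coordinates -/

open TopologicalSpace (Opens)

section

variable {n : ℕ}

/-- Extension by zero of a function on an open set. -/
noncomputable def extZero {U : Opens (Coord n)} (f : U → ℂ) (w : Coord n) : ℂ :=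
  open Classical in if h : w ∈ U then f ⟨w, h⟩ else 0

theorem extZero_apply {U : Opens (Coord n)} (f : U → ℂ) (w : U) : extZero f w = f w := by
  rw [extZero, dif_pos w.2]

/-- The algebra of smooth functions on an open set of coordinates. -/
noncomputable def SF (U : Opens (Coord n)) : Subalgebra ℂ (U → ℂ) where
  carrier := {f | ContDiffOn ℝ ∞ (extZero f) U}
  mul_mem' {f g} hf hg := (ContDiffOn.mul hf hg).congr fun w hw => by
    simp [extZero, show w ∈ U from hw]
  add_mem' {f g} hf hg := (ContDiffOn.add hf hg).congr fun w hw => by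
    simp [extZero, show w ∈ U from hw]
  algebraMap_mem' c := (contDiffOn_const (c := c)).congr fun w hw => by
    simp [extZero, show w ∈ U from hw]

variable {U : Opens (Coord n)}

/-- The restriction to `U` of a function that is smooth on `U`. -/
noncomputable def SF.mk (g : Coord n → ℂ) (hg : ContDiffOn ℝ ∞ g U) : SF U :=
  ⟨fun w => g w, hg.congr fun w hw => extZero_apply (U := U) (fun w => g w) ⟨w, hw⟩⟩

/-- Evaluation at a point. -/
noncomputable def ev (w : U) : SF U →ₐ[ℂ] ℂ := (Pi.evalAlgHom ℂ (fun _ : U => ℂ) w).comp (SF U).val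

theorem ev_apply (w : U) (a : SF U) : ev w a = a.1 w := rfl

theorem SF.ext_ev {a b : SF U} (h : ∀ w : U, ev w a = ev w b) : a = b := Subtype.ext (funext h)

theorem ev_mk (g : Coord n → ℂ) (hg : ContDiffOn ℝ ∞ g U) (w : U) : ev w (SF.mk g hg) = g w := rfl

theorem SF.smooth (a : SF U) : ContDiffOn ℝ ∞ (extZero a.1) U := a.2

theorem contDiffOn_pd {F : Type*} [NormedAddCommGroup F] [NormedSpace ℝ F] {g : Coord n → F}
    (hg : ContDiffOn ℝ ∞ g U) (μ : Idx n) : ContDiffOn ℝ ∞ (pd μ g) U := by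
  have h := hg.fderiv_of_isOpen U.isOpen (m := ∞) (by simp)
  exact h.clm_apply contDiffOn_const

theorem pd_congr {F : Type*} [NormedAddCommGroup F] [NormedSpace ℝ F] {g g' : Coord n → F}
    (h : ∀ w ∈ U, g w = g' w) (μ : Idx n) {w : Coord n} (hw : w ∈ U) : pd μ g w = pd μ g' w := by
  have e : g =ᶠ[nhds w] g' := by
    filter_upwards [U.isOpen.mem_nhds hw] with x hx using h x hx
  rw [pd, pd, e.fderiv_eq]

theorem differentiableAt_of_contDiffOn {F : Type*} [NormedAddCommGroup F] [NormedSpace ℝ F]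
    {g : Coord n → F} (hg : ContDiffOn ℝ ∞ g U) {w : Coord n} (hw : w ∈ U) :
    DifferentiableAt ℝ g w :=
  (hg.contDiffAt (U.isOpen.mem_nhds hw)).differentiableAt (by simp)

theorem pd_comm {F : Type*} [NormedAddCommGroup F] [NormedSpace ℝ F] {g : Coord n → F}
    (hg : ContDiffOn ℝ ∞ g U) (μ ν : Idx n) {w : Coord n} (hw : w ∈ U) :
    pd μ (pd ν g) w = pd ν (pd μ g) w := by
  have hs : IsSymmSndFDerivAt ℝ g w :=
    (hg.contDiffAt (U.isOpen.mem_nhds hw)).isSymmSndFDerivAt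
      (by rw [minSmoothness_of_isRCLikeNormedField]; exact
        WithTop.coe_le_coe.2 (le_top : (2 : ℕ∞) ≤ ⊤))
  have hd : DifferentiableAt ℝ (fderiv ℝ g) w :=
    differentiableAt_of_contDiffOn (hg.fderiv_of_isOpen U.isOpen (m := ∞) (by simp)) hw
  have e : ∀ μ ν : Idx n, pd μ (pd ν g) w =
      fderiv ℝ (fderiv ℝ g) w (Pi.single μ 1) (Pi.single ν 1) := by
    intro μ ν
    change fderiv ℝ (fun x => fderiv ℝ g x (Pi.single ν 1)) w (Pi.single μ 1) = _
    rw [fderiv_clm_apply hd (differentiableAt_const _)]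
    simp
  rw [e, e, hs]

/-- The partial derivatives of smooth functions. -/
noncomputable def SF.pdv (μ : Idx n) : Derivation ℂ (SF U) (SF U) :=
  Derivation.mk'
    { toFun := fun a => SF.mk (pd μ (extZero a.1)) (contDiffOn_pd (SF.smooth a) μ)
      map_add' := fun a b => SF.ext_ev fun w => by
        have h : ∀ x ∈ U, extZero (a + b).1 x = (extZero a.1 + extZero b.1) x := fun x hx => by
          simp [extZero, hx]
        change pd μ (extZero (a + b).1) w = pd μ (extZero a.1) w + pd μ (extZero b.1) w
        rw [pd_congr h μ w.2, pd, fderiv_add (differentiableAt_of_contDiffOn (SF.smooth a) w.2)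
          (differentiableAt_of_contDiffOn (SF.smooth b) w.2)]
        rfl
      map_smul' := fun c a => SF.ext_ev fun w => by
        have h : ∀ x ∈ U, extZero (c • a).1 x = (c • extZero a.1) x := fun x hx => by
          simp [extZero, hx]
        change pd μ (extZero (c • a).1) w = c * pd μ (extZero a.1) w
        rw [pd_congr h μ w.2, pd, fderiv_const_smul
          (differentiableAt_of_contDiffOn (SF.smooth a) w.2)]
        rfl }
    (fun a b => SF.ext_ev fun w => by
      have h : ∀ x ∈ U, extZero (a * b).1 x = (extZero a.1 * extZero b.1) x := fun x hx => by
        simp [extZero, hx]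
      change pd μ (extZero (a * b).1) w =
        a.1 w * pd μ (extZero b.1) w + b.1 w * pd μ (extZero a.1) w
      rw [pd_congr h μ w.2, pd, fderiv_mul (differentiableAt_of_contDiffOn (SF.smooth a) w.2)
        (differentiableAt_of_contDiffOn (SF.smooth b) w.2), extZero_apply, extZero_apply]
      rfl)

theorem ev_pdv (μ : Idx n) (a : SF U) {g : Coord n → ℂ} (hg : ∀ w : U, ev w a = g w) (w : U) :
    ev w (SF.pdv μ a) = pd μ g w :=
  pd_congr (fun x hx => (extZero_apply a.1 ⟨x, hx⟩).trans (hg ⟨x, hx⟩)) μ w.2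

theorem SF.pdv_comm (μ ν : Idx n) (a : SF U) : SF.pdv μ (SF.pdv ν a) = SF.pdv ν (SF.pdv μ a) :=
  SF.ext_ev fun w => by
    have h : ∀ μ, ∀ w : U, ev w (SF.pdv μ a) = pd μ (extZero a.1) w := fun μ w => rfl
    rw [ev_pdv μ _ (h ν), ev_pdv ν _ (h μ), pd_comm (SF.smooth a) μ ν w.2]

/-- An element of `SF U` whose values are those of the real function `g`. -/
def IsRep (a : SF U) (g : Coord n → ℝ) : Prop := ∀ w : U, ev w a = (g w : ℂ)

namespace IsRep

variable {a b : SF U} {f g : Coord n → ℝ}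

theorem contDiffOn (h : IsRep a g) : ContDiffOn ℝ ∞ g U := by
  have h1 := Complex.reCLM.contDiff.comp_contDiffOn (n := ∞) (SF.smooth a)
  refine h1.congr fun w hw => ?_
  have := h ⟨w, hw⟩
  rw [ev_apply] at this
  simp only [Function.comp_apply, Complex.reCLM_apply]
  rw [extZero_apply a.1 ⟨w, hw⟩, this, Complex.ofReal_re]

theorem add (ha : IsRep a f) (hb : IsRep b g) : IsRep (a + b) fun w => f w + g w := fun w => by
  rw [map_add, ha, hb, Complex.ofReal_add]

theorem sub (ha : IsRep a f) (hb : IsRep b g) : IsRep (a - b) fun w => f w - g w := fun w => by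
  rw [map_sub, ha, hb, Complex.ofReal_sub]

theorem neg (ha : IsRep a f) : IsRep (-a) fun w => -f w := fun w => by
  rw [map_neg, ha, Complex.ofReal_neg]

theorem mul (ha : IsRep a f) (hb : IsRep b g) : IsRep (a * b) fun w => f w * g w := fun w => by
  rw [map_mul, ha, hb, Complex.ofReal_mul]

theorem smul {c : ℂ} {x : ℝ} (hc : c = x) (ha : IsRep a f) : IsRep (c • a) fun w => x * f w :=
  fun w => by rw [map_smul, ha, smul_eq_mul, Complex.ofReal_mul, hc]

theorem zero : IsRep (0 : SF U) fun _ => 0 := fun w => by simp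

theorem sum {κ : Type*} {s : Finset κ} {x : κ → SF U} {y : κ → Coord n → ℝ}
    (h : ∀ i ∈ s, IsRep (x i) (y i)) : IsRep (∑ i ∈ s, x i) fun w => ∑ i ∈ s, y i w := fun w => by
  rw [map_sum, Complex.ofReal_sum]
  exact sum_congr rfl fun i hi => h i hi w

theorem congr (ha : IsRep a f) (h : ∀ w ∈ U, f w = g w) : IsRep a g := fun w => by
  rw [ha, h w w.2]

theorem pd (ha : IsRep a f) (μ : Idx n) : IsRep (SF.pdv μ a) (pd μ f) := fun w => by
  rw [ev_pdv μ a (g := fun w => (f w : ℂ)) ha]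
  have h := (Complex.ofRealCLM.hasFDerivAt (x := f w)).comp w.1
    (differentiableAt_of_contDiffOn ha.contDiffOn w.2).hasFDerivAt
  rw [LagrangeFedosov.pd, LagrangeFedosov.pd]
  have e : fderiv ℝ (fun w => (f w : ℂ)) w = Complex.ofRealCLM.comp (fderiv ℝ f w) := h.fderiv
  rw [e]
  rfl

end IsRep

/-- A nowhere vanishing smooth function is invertible. -/
theorem SF.exists_inv (a : SF U) (h : ∀ w : U, ev w a ≠ 0) : ∃ b : SF U, a * b = 1 := by
  refine ⟨SF.mk (fun w => (extZero a.1 w)⁻¹) ((SF.smooth a).inv fun w hw => ?_),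
    SF.ext_ev fun w => ?_⟩
  · rw [extZero_apply a.1 ⟨w, hw⟩]; exact h ⟨w, hw⟩
  · rw [map_mul, ev_mk, extZero_apply, map_one]
    exact mul_inv_cancel₀ (h w)

end

end LagrangeFedosov

namespace LagrangeFedosov

open Finset

/-! ### Regular Lagrangians on open sets of coordinates -/

open TopologicalSpace (Opens)

variable {n : ℕ} {U : Opens (Coord n)}

/-- A matrix over `SF U` whose values are those of the real matrix function `g`. -/
def IsRepM {κ κ' : Type*} (M : Matrix κ κ' (SF U)) (g : Coord n → Matrix κ κ' ℝ) : Prop :=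
  ∀ i j, IsRep (M i j) fun w => g w i j

namespace IsRepM

variable {κ κ' κ'' : Type*} [Fintype κ']

theorem map_eq {M : Matrix κ κ'' (SF U)} {g : Coord n → Matrix κ κ'' ℝ} (h : IsRepM M g) (w : U) :
    M.map (ev w) = (g w).map Complex.ofRealHom := by
  ext i j
  exact h i j w

theorem mul {M : Matrix κ κ' (SF U)} {N : Matrix κ' κ'' (SF U)} {f : Coord n → Matrix κ κ' ℝ}
    {g : Coord n → Matrix κ' κ'' ℝ} (hM : IsRepM M f) (hN : IsRepM N g) :
    IsRepM (M * N) fun w => f w * g w := fun i j => by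
  simp only [Matrix.mul_apply]
  exact IsRep.sum fun k _ => (hM i k).mul (hN k j)

theorem transpose {M : Matrix κ κ'' (SF U)} {f : Coord n → Matrix κ κ'' ℝ} (hM : IsRepM M f) :
    IsRepM Mᵀ fun w => (f w)ᵀ := fun i j => hM j i

theorem congr {M : Matrix κ κ'' (SF U)} {f g : Coord n → Matrix κ κ'' ℝ} (hM : IsRepM M f)
    (h : ∀ w ∈ U, f w = g w) : IsRepM M g := fun i j => (hM i j).congr fun w hw => by rw [h w hw]

theorem fromBlocks {ι₁ ι₂ ι₃ ι₄ : Type*} {M₁ : Matrix ι₁ ι₃ (SF U)} {M₂ : Matrix ι₁ ι₄ (SF U)}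
    {M₃ : Matrix ι₂ ι₃ (SF U)} {M₄ : Matrix ι₂ ι₄ (SF U)} {f₁ : Coord n → Matrix ι₁ ι₃ ℝ}
    {f₂ : Coord n → Matrix ι₁ ι₄ ℝ} {f₃ : Coord n → Matrix ι₂ ι₃ ℝ} {f₄ : Coord n → Matrix ι₂ ι₄ ℝ}
    (h₁ : IsRepM M₁ f₁) (h₂ : IsRepM M₂ f₂) (h₃ : IsRepM M₃ f₃) (h₄ : IsRepM M₄ f₄) :
    IsRepM (Matrix.fromBlocks M₁ M₂ M₃ M₄)
      fun w => Matrix.fromBlocks (f₁ w) (f₂ w) (f₃ w) (f₄ w) := by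
  rintro (i | i) (j | j)
  exacts [h₁ i j, h₂ i j, h₃ i j, h₄ i j]

theorem zero : IsRepM (0 : Matrix κ κ'' (SF U)) fun _ => 0 := fun _ _ => IsRep.zero

theorem one [DecidableEq κ] : IsRepM (1 : Matrix κ κ (SF U)) fun _ => 1 := fun i j w => by
  simp only [Matrix.one_apply]
  split_ifs <;> simp

theorem neg {M : Matrix κ κ'' (SF U)} {f : Coord n → Matrix κ κ'' ℝ} (hM : IsRepM M f) :
    IsRepM (-M) fun w => -f w := fun i j => (hM i j).neg

theorem inv [DecidableEq κ'] {X Y : Matrix κ' κ' (SF U)} {g : Coord n → Matrix κ' κ' ℝ}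
    (hX : IsRepM X g) (h : X * Y = 1) : IsRepM Y fun w => (g w)⁻¹ := by
  intro i j w
  have h1 : (g w).map Complex.ofRealHom * Y.map (ev w) = 1 := by
    rw [← hX.map_eq, ← Matrix.map_mul, h]
    exact Matrix.map_one _ (map_zero _) (map_one _)
  have hdet : (g w).det ≠ 0 := fun h0 => by
    have h2 := congrArg Matrix.det h1
    rw [Matrix.det_mul, ← RingHom.mapMatrix_apply, ← RingHom.map_det, h0, map_zero, zero_mul,
      Matrix.det_one] at h2
    exact zero_ne_one h2
  have h3 : ((g w)⁻¹).map Complex.ofRealHom * (g w).map Complex.ofRealHom = 1 := by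
    rw [← Matrix.map_mul, Matrix.nonsing_inv_mul _ (isUnit_iff_ne_zero.2 hdet)]
    exact Matrix.map_one _ (map_zero _) (map_one _)
  have h4 : Y.map (ev w) = ((g w)⁻¹).map Complex.ofRealHom := by
    rw [← Matrix.one_mul (Y.map (ev w)), ← h3, Matrix.mul_assoc, h1, Matrix.mul_one]
  exact congrFun (congrFun h4 i) j

end IsRepM

/-- A Lagrangian that is smooth and regular on `U`. -/
structure IsRegularOn (U : Opens (Coord n)) (L : Coord n → ℝ) : Prop where
  smooth : ContDiffOn ℝ ∞ L U
  regular : ∀ w ∈ U, (hess L w).det ≠ 0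

namespace IsRegularOn

variable {L : Coord n → ℝ} (hL : IsRegularOn U L)

/-- The Lagrangian as an element of the algebra of smooth functions. -/
noncomputable def lag : SF U :=
  SF.mk (fun w => (L w : ℂ)) (Complex.ofRealCLM.contDiff.comp_contDiffOn hL.smooth)

theorem isRep_lag : IsRep hL.lag L := fun _ => rfl

theorem isRepM_hess :
    IsRepM (Matrix.of fun i j => (1 / 2 : ℂ) • SF.pdv (Sum.inr i) (SF.pdv (Sum.inr j) hL.lag))
      (hess L) := fun i j =>
  ((hL.isRep_lag.pd (Sum.inr j)).pd (Sum.inr i)).smul (x := 1 / 2) (by norm_num)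

theorem exists_hinv : ∃ Y : Matrix (Fin n) (Fin n) (SF U),
    (Matrix.of fun i j => (1 / 2 : ℂ) • SF.pdv (Sum.inr i) (SF.pdv (Sum.inr j) hL.lag)) * Y
      = 1 := by
  set X := Matrix.of fun i j => (1 / 2 : ℂ) • SF.pdv (Sum.inr i) (SF.pdv (Sum.inr j) hL.lag)
  obtain ⟨b, hb⟩ := SF.exists_inv X.det fun w => by
    rw [AlgHom.map_det, AlgHom.mapMatrix_apply, hL.isRepM_hess.map_eq w,
      ← RingHom.mapMatrix_apply, ← RingHom.map_det]
    exact Complex.ofReal_ne_zero.2 (hL.regular w w.2)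
  refine ⟨b • X.adjugate, ?_⟩
  rw [Matrix.mul_smul, Matrix.mul_adjugate, smul_smul, mul_comm, hb, one_smul]

theorem isRep_coord (μ : Idx n) : IsRep (SF.mk (U := U) (fun w => (w μ : ℂ))
    (Complex.ofRealCLM.contDiff.comp_contDiffOn (contDiff_apply ℝ ℝ μ).contDiffOn))
    fun w => w μ := fun _ => rfl

theorem pd_coord (μ ν : Idx n) (w : Coord n) :
    pd μ (fun w : Coord n => w ν) w = if μ = ν then 1 else 0 := by
  have h : fderiv ℝ (fun w : Coord n => w ν) w = ContinuousLinearMap.proj ν :=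
    (ContinuousLinearMap.proj (R := ℝ) (φ := fun _ : Idx n => ℝ) ν).fderiv
  rw [pd, h, ContinuousLinearMap.proj_apply, Pi.single_apply]
  simp only [eq_comm]

/-- The algebraic datum of a regular Lagrangian. -/
noncomputable def datum : LagrangeDatum n (SF U) where
  pdv := SF.pdv
  pdv_comm := SF.pdv_comm
  L := hL.lag
  y k := SF.mk (fun w => (w (Sum.inr k) : ℂ))
    (Complex.ofRealCLM.contDiff.comp_contDiffOn (contDiff_apply ℝ ℝ (Sum.inr k)).contDiffOn)
  pdv_inr_y j k := SF.ext_ev fun w => by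
    rw [(isRep_coord (Sum.inr k)).pd, pd_coord]
    by_cases h : j = k <;> simp [h]
  hinv := hL.exists_hinv.choose
  h_mul_hinv := hL.exists_hinv.choose_spec

theorem isRepM_h : IsRepM hL.datum.h (hess L) := hL.isRepM_hess

theorem isRepM_hinv : IsRepM hL.datum.hinv fun w => (hess L w)⁻¹ :=
  hL.isRepM_hess.inv hL.datum.h_mul_hinv

theorem isRep_G (i : Fin n) : IsRep (hL.datum.G i) (spray L i) := by
  refine IsRep.smul (by norm_num) (IsRep.sum fun j _ => (hL.isRepM_hinv i j).mul
    ((IsRep.sum fun k _ => ?_).sub (hL.isRep_lag.pd _)))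
  exact ((hL.isRep_lag.pd _).pd _).mul (isRep_coord (Sum.inr k))

theorem isRepM_N : IsRepM hL.datum.N fun w => Matrix.of fun a i => nconn L a i w :=
  fun a i => (hL.isRep_G a).pd (Sum.inr i)

theorem isRepM_E : IsRepM hL.datum.E (coframe L) :=
  IsRepM.one.fromBlocks IsRepM.zero hL.isRepM_N IsRepM.one

theorem isRepM_F : IsRepM hL.datum.F fun w => (frame L w)ᵀ := by
  refine (IsRepM.one.fromBlocks IsRepM.zero hL.isRepM_N.neg IsRepM.one).congr fun w _ => ?_
  rw [frame, Matrix.fromBlocks_transpose, Matrix.transpose_one, Matrix.transpose_zero]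
  rfl

theorem isRep_e {a : SF U} {g : Coord n → ℝ} (h : IsRep a g) (α : Idx n) :
    IsRep (hL.datum.e α a) (frameDeriv L α g) := by
  rw [LagrangeDatum.e_apply]
  exact IsRep.sum fun μ _ => (hL.isRepM_F μ α).mul (h.pd μ)

theorem frameDeriv_inr (k : Fin n) (g : Coord n → ℝ) (w : Coord n) :
    frameDeriv L (Sum.inr k) g w = pd (Sum.inr k) g w := by
  rw [frameDeriv, Fintype.sum_sum_type]
  simp [frame, Matrix.one_apply]

theorem isRep_K_inl (i j k : Fin n) : IsRep (hL.datum.K (Sum.inl k) i j) (hatL L i j k) :=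
  IsRep.smul (by norm_num) (IsRep.sum fun m _ => (hL.isRepM_hinv i m).mul
    (((hL.isRep_e (hL.isRepM_h j m) _).add (hL.isRep_e (hL.isRepM_h m k) _)).sub
      (hL.isRep_e (hL.isRepM_h j k) _)))

theorem isRep_K_inr (i j k : Fin n) : IsRep (hL.datum.K (Sum.inr k) i j) (hatC L i j k) := by
  refine IsRep.congr (IsRep.smul (x := 1 / 2) (by norm_num)
    (IsRep.sum fun m _ => (hL.isRepM_hinv i m).mul
    (((hL.isRep_e (hL.isRepM_h j m) (Sum.inr k)).add (hL.isRep_e (hL.isRepM_h m k) (Sum.inr j))).sub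
      (hL.isRep_e (hL.isRepM_h j k) (Sum.inr m))))) fun w _ => ?_
  simp only [frameDeriv_inr, hatC]

theorem isRep_frameConn (α γ β : Idx n) :
    IsRep (hL.datum.frameConn α γ β) fun w => normalCoeff L w γ β α := by
  rcases γ with i | i <;> rcases β with j | j <;> rcases α with k | k
  exacts [hL.isRep_K_inl i j k, hL.isRep_K_inr i j k, IsRep.zero, IsRep.zero, IsRep.zero,
    IsRep.zero, hL.isRep_K_inl i j k, hL.isRep_K_inr i j k]

theorem isRep_Γ (μ l ν : Idx n) : IsRep (hL.datum.Γ μ l ν) (conn L l ν μ) := by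
  have h1 : hL.datum.Γ μ l ν = ∑ γ, hL.datum.F l γ * (hL.datum.pdv μ (hL.datum.E γ ν) +
      ∑ α, ∑ β, hL.datum.E α μ * hL.datum.E β ν * hL.datum.frameConn α γ β) := by
    rw [LagrangeDatum.Γ, Matrix.mul_apply]
    refine sum_congr rfl fun γ _ => ?_
    rw [Matrix.add_apply, Matrix.map_apply, LagrangeDatum.Ω, Matrix.sum_mul, Matrix.sum_apply]
    congr 2
    refine sum_congr rfl fun α _ => ?_
    rw [Matrix.mul_apply]
    refine sum_congr rfl fun β _ => ?_
    rw [Matrix.smul_apply, smul_eq_mul]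
    ring
  rw [h1]
  exact IsRep.sum fun γ _ => (hL.isRepM_F l γ).mul (((hL.isRepM_E γ ν).pd μ).add
    (IsRep.sum fun α _ => IsRep.sum fun β _ => ((hL.isRepM_E α μ).mul (hL.isRepM_E β ν)).mul
      (hL.isRep_frameConn α γ β)))

theorem coframe_mul_frame (w : Coord n) : coframe L w * (frame L w)ᵀ = 1 := by
  rw [coframe, frame, Matrix.fromBlocks_transpose, Matrix.fromBlocks_multiply]
  have e : (Matrix.of fun a i => nconn L a i w) + (Matrix.of fun i a => -nconn L a i w)ᵀ = 0 := by
    ext a i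
    simp
  simp [e]

theorem acs_eq (w : Coord n) : acs L w = (frame L w)ᵀ * J₀ n ℝ * coframe L w := by
  ext l μ
  rw [Matrix.mul_assoc, Matrix.mul_apply, Fintype.sum_sum_type]
  simp only [J₀, Matrix.mul_apply, Fintype.sum_sum_type, Matrix.transpose_apply,
    Matrix.fromBlocks_apply₁₁, Matrix.fromBlocks_apply₁₂, Matrix.fromBlocks_apply₂₁,
    Matrix.fromBlocks_apply₂₂, Matrix.zero_apply, Matrix.neg_apply, Matrix.one_apply, zero_mul,
    sum_const_zero, zero_add, add_zero, ite_mul, one_mul, sum_ite_eq, mem_univ, if_true, neg_mul,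
    sum_neg_distrib, mul_neg, acs, Matrix.of_apply, sub_eq_add_neg, sum_add_distrib]

theorem isRepM_J₀ : IsRepM (J₀ n (SF U)) fun _ => J₀ n ℝ :=
  IsRepM.zero.fromBlocks IsRepM.one IsRepM.one.neg IsRepM.zero

theorem isRepM_H : IsRepM hL.datum.H fun w => Matrix.fromBlocks (hess L w) 0 0 (hess L w) :=
  hL.isRepM_h.fromBlocks IsRepM.zero IsRepM.zero hL.isRepM_h

theorem isRepM_metric : IsRepM (hL.datum.Eᵀ * hL.datum.H * hL.datum.E) (metric L) :=
  (hL.isRepM_E.transpose.mul hL.isRepM_H).mul hL.isRepM_E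

theorem isRepM_acs : IsRepM (hL.datum.F * J₀ n (SF U) * hL.datum.E) (acs L) :=
  ((hL.isRepM_F.mul isRepM_J₀).mul hL.isRepM_E).congr fun w _ => (acs_eq w).symm

theorem isRepM_θ : IsRepM hL.datum.θ (symp L) := by
  refine ((hL.isRepM_E.transpose.mul (isRepM_J₀.transpose.mul hL.isRepM_H)).mul
    hL.isRepM_E).congr fun w _ => ?_
  have h : frame L w * (coframe L w)ᵀ = 1 := by
    have := congrArg Matrix.transpose (coframe_mul_frame (L := L) w)
    rwa [Matrix.transpose_mul, Matrix.transpose_transpose, Matrix.transpose_one] at this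
  rw [symp, acs_eq, metric, Matrix.transpose_mul, Matrix.transpose_mul, Matrix.transpose_transpose]
  calc _ = (coframe L w)ᵀ * (J₀ n ℝ)ᵀ * 1 * Matrix.fromBlocks (hess L w) 0 0 (hess L w) *
        coframe L w := by rw [mul_one, ← Matrix.mul_assoc]
    _ = _ := by rw [← h]; noncomm_ring

theorem metric_mul : hL.datum.Eᵀ * hL.datum.H * hL.datum.E * hL.datum.gup = 1 := by
  rw [LagrangeDatum.gup]
  calc _ = hL.datum.Eᵀ * hL.datum.H * (hL.datum.E * hL.datum.F) * hL.datum.Hinv *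
        hL.datum.Fᵀ := by noncomm_ring
    _ = hL.datum.Eᵀ * (hL.datum.H * hL.datum.Hinv) * hL.datum.Fᵀ := by
        rw [LagrangeDatum.E_mul_F]; noncomm_ring
    _ = 1 := by
        rw [LagrangeDatum.H_mul_Hinv, mul_one, ← Matrix.transpose_mul, LagrangeDatum.F_mul_E,
          Matrix.transpose_one]

theorem isRepM_gup : IsRepM hL.datum.gup fun w => (metric L w)⁻¹ :=
  hL.isRepM_metric.inv hL.metric_mul

theorem isRepM_θup : IsRepM hL.datum.θup (sympUp L) := by
  have h : hL.datum.θup = hL.datum.gup * hL.datum.θ * hL.datum.gup := by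
    have h2 : hL.datum.Fᵀ * hL.datum.Eᵀ = 1 := by
      rw [← Matrix.transpose_mul, LagrangeDatum.E_mul_F, Matrix.transpose_one]
    rw [LagrangeDatum.gup, LagrangeDatum.θ, LagrangeDatum.θup]
    symm
    calc _ = hL.datum.F * hL.datum.Hinv * (hL.datum.Fᵀ * hL.datum.Eᵀ) * (J₀ n (SF U))ᵀ *
          hL.datum.H * (hL.datum.E * hL.datum.F) * hL.datum.Hinv * hL.datum.Fᵀ := by noncomm_ring
      _ = hL.datum.F * hL.datum.Hinv * (J₀ n (SF U))ᵀ *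
          (hL.datum.H * hL.datum.Hinv) * hL.datum.Fᵀ := by
          rw [h2, LagrangeDatum.E_mul_F]; noncomm_ring
      _ = _ := by rw [LagrangeDatum.H_mul_Hinv]; noncomm_ring
  rw [h]
  exact (hL.isRepM_gup.mul hL.isRepM_θ).mul hL.isRepM_gup

/-- The data of Fedosov's construction on `U`. -/
noncomputable def fed : FedosovDatum (Idx n) (SF U) := hL.datum.toFedosovDatum

theorem isRep_T (τ α β : Idx n) : IsRep (hL.fed.T τ α β) (torsion L τ α β) :=
  (hL.isRep_Γ β τ α).sub (hL.isRep_Γ α τ β)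

theorem isRep_R (α β τ φ : Idx n) : IsRep (hL.fed.R α β τ φ) (curvature L τ φ α β) := by
  have h : hL.fed.R α β τ φ = SF.pdv β (hL.datum.Γ α τ φ) - SF.pdv α (hL.datum.Γ β τ φ) +
      ∑ m, (hL.datum.Γ α m φ * hL.datum.Γ β τ m - hL.datum.Γ β m φ * hL.datum.Γ α τ m) := by
    rw [FedosovDatum.R, Matrix.add_apply, Matrix.sub_apply, Matrix.sub_apply, Matrix.mul_apply,
      Matrix.mul_apply, ← sum_sub_distrib]
    congr 1
    exact sum_congr rfl fun m _ => by
      rw [mul_comm, mul_comm (hL.fed.Γ α τ m)]; rfl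
  rw [h]
  exact (((hL.isRep_Γ α τ φ).pd β).sub ((hL.isRep_Γ β τ φ).pd α)).add (IsRep.sum fun m _ =>
    ((hL.isRep_Γ α m φ).mul (hL.isRep_Γ β τ m)).sub ((hL.isRep_Γ β m φ).mul (hL.isRep_Γ α τ m)))

theorem Λ_map (w : U) : (hL.fed.Λ).map (ev w) = wickTensor L w := by
  ext α β
  have h1 := hL.isRepM_θup α β w
  have h2 := hL.isRepM_gup α β w
  change ev w (hL.datum.θup α β - Complex.I • hL.datum.gup α β) = _
  rw [map_sub, map_smul, h1, h2]
  rfl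

end IsRegularOn

end LagrangeFedosov

namespace LagrangeFedosov

open Finset

open TopologicalSpace (Opens)

/-! ### Evaluation of the abstract construction at a point -/

theorem pullM_one {ι A A' : Type*} [Fintype ι] [DecidableEq ι] [CommRing A] [Algebra ℂ A]
    [CommRing A'] [Algebra ℂ A'] (σ : A' →ₐ[ℂ] A) (f : MvPowerSeries ι A') :
    pullM σ 1 f = MvPowerSeries.map σ.toRingHom f := by
  rw [pullM_apply, show rowForm (1 : Matrix ι ι A) = MvPowerSeries.X from funext rowForm_one,
    MvPowerSeries.subst_self]
  rfl

variable {n : ℕ} {U : Opens (Coord n)}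

open WickAlg

/-- The value at a point of a section of the bundle of Wick algebras. -/
noncomputable def evW {Λ : Matrix (Idx n) (Idx n) (SF U)} (w : U) (a : WickAlg Λ) : Wick n :=
  fun r => MvPowerSeries.map (ev w).toRingHom (a r)

section

variable {Λ : Matrix (Idx n) (Idx n) (SF U)}

theorem coeff_evW (w : U) (a : WickAlg Λ) (r : ℕ) (m : Idx n →₀ ℕ) :
    MvPowerSeries.coeff m (evW w a r) = ev w (MvPowerSeries.coeff m (a r)) :=
  MvPowerSeries.coeff_map _ _ _

theorem constantCoeff_evW (w : U) (a : WickAlg Λ) (r : ℕ) :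
    MvPowerSeries.constantCoeff (evW w a r) = ev w (MvPowerSeries.constantCoeff (a r)) :=
  coeff_evW w a r 0

theorem Wick.ext {a b : Wick n}
    (h : ∀ r m, MvPowerSeries.coeff m (a r) = MvPowerSeries.coeff m (b r)) : a = b :=
  funext fun r => MvPowerSeries.ext (h r)

theorem eq_of_evW {a b : WickAlg Λ} (h : ∀ w : U, evW w a = evW w b) : a = b :=
  WickAlg.ext fun r m => SF.ext_ev fun w => by rw [← coeff_evW, h, coeff_evW]

theorem evW_zero (w : U) : evW w (0 : WickAlg Λ) = 0 :=
  funext fun _ => map_zero (MvPowerSeries.map _)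

theorem evW_add (w : U) (a b : WickAlg Λ) : evW w (a + b) = evW w a + evW w b :=
  funext fun r => map_add (MvPowerSeries.map _) (a r) (b r)

theorem evW_sub (w : U) (a b : WickAlg Λ) : evW w (a - b) = evW w a - evW w b :=
  funext fun r => map_sub (MvPowerSeries.map _) (a r) (b r)

theorem evW_neg (w : U) (a : WickAlg Λ) : evW w (-a) = -evW w a :=
  funext fun r => map_neg (MvPowerSeries.map _) (a r)

theorem evW_csmul (w : U) (c : ℂ) (a : WickAlg Λ) : evW w (c • a) = c • evW w a := by
  refine Wick.ext fun r m => ?_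
  rw [coeff_evW, val_csmul, coeff_csmul, map_smul, ← coeff_evW]
  rfl

theorem evW_sum (w : U) {κ : Type*} (s : Finset κ) (a : κ → WickAlg Λ) :
    evW w (∑ i ∈ s, a i) = ∑ i ∈ s, evW w (a i) := by
  induction s using Finset.cons_induction with
  | empty => exact evW_zero w
  | cons i s hi ih => rw [sum_cons, sum_cons, evW_add, ih]

theorem evW_mul {Λw : Matrix (Idx n) (Idx n) ℂ} (w : U) (h : Λ.map (ev w) = Λw)
    (a b : WickAlg Λ) : evW w (a * b) = wickMul Λw (evW w a) (evW w b) := by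
  have h1 := pull_mul (Λ := Λw) (ev w) 1 (by rw [h, one_mul, Matrix.transpose_one, mul_one]) a b
  have e : ∀ a : WickAlg Λ, (pull (ev w) 1 a : WickAlg Λw) = evW w a := fun a =>
    funext fun r => pullM_one (ev w) (a r)
  rw [wickMul_eq_wmul]
  rw [e, e, e] at h1
  exact h1

theorem evW_del (w : U) (α : Idx n) (a : WickAlg Λ) : evW w (del α a) = delta α (evW w a) := by
  refine Wick.ext fun r m => ?_
  rw [coeff_evW, del_apply, delta, MvPowerSeries.coeff_pderiv, MvPowerSeries.coeff_pderiv, map_mul,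
    coeff_evW, map_add, map_natCast, map_one]

theorem evW_dp (w : U) (k : ℕ) (a : WickAlg Λ) : evW w (dp k a) = degPart k (evW w a) := by
  refine Wick.ext fun r m => ?_
  rw [coeff_evW, coeff_dp]
  change _ = if 2 * r + m.degree = k then MvPowerSeries.coeff m (evW w a r) else 0
  rw [coeff_evW]
  split_ifs <;> simp

theorem evW_unshift (w : U) (a : WickAlg Λ) : evW w (unshift a) = divV (evW w a) := rfl

theorem evW_br {Λw : Matrix (Idx n) (Idx n) ℂ} (w : U) (h : Λ.map (ev w) = Λw)
    (a b : WickAlg Λ) : evW w (br a b) =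
      divV (wickMul Λw (evW w a) (evW w b) - wickMul Λw (evW w b) (evW w a)) := by
  rw [← evW_mul w h, ← evW_mul w h, ← evW_sub]
  rfl

theorem map_sum_X_mul (w : U) (b : Idx n → WickAlg Λ) (r : ℕ) :
    MvPowerSeries.map (ev w).toRingHom (∑ α, MvPowerSeries.X α * b α r) =
      ∑ α, MvPowerSeries.X α * evW w (b α) r := by
  simp only [map_sum, map_mul, MvPowerSeries.map_X]
  rfl

theorem evW_dinv₁ (w : U) (b : Idx n → WickAlg Λ) :
    evW w (dinv₁ b) = deltaInv₁ fun α => evW w (b α) := by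
  refine Wick.ext fun r m => ?_
  rw [coeff_evW]
  change ev w ((m.degree : ℂ)⁻¹ • _) = (m.degree : ℂ)⁻¹ * _
  rw [map_smul, ← map_sum_X_mul, MvPowerSeries.coeff_map]
  rfl

theorem evW_dinv₂ (w : U) (c : Idx n → Idx n → WickAlg Λ) (β : Idx n) :
    evW w (dinv₂ c β) = deltaInv₂ (fun α α' => evW w (c α α')) β := by
  refine Wick.ext fun r m => ?_
  rw [coeff_evW]
  change ev w (((m.degree + 1 : ℕ) : ℂ)⁻¹ • _) = ((m.degree + 1 : ℕ) : ℂ)⁻¹ * _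
  rw [map_smul, ← map_sum_X_mul w (fun α => c α β), MvPowerSeries.coeff_map]
  rfl

end

namespace IsRegularOn

variable {L : Coord n → ℝ} (hL : IsRegularOn U L)

theorem evW_D {a : hL.fed.W} {b : Coord n → Wick n} (h : ∀ w : U, evW w a = b w) (α : Idx n)
    (w : U) : evW w (hL.fed.D α a) = covD L α b w := by
  refine Wick.ext fun r m => ?_
  rw [coeff_evW, FedosovDatum.D, cov_apply, covDer_apply, map_sub, coeff_coeffDer, map_sub,
    linField_apply]
  have h1 : ev w (hL.fed.pdv α (MvPowerSeries.coeff m (a r))) =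
      pd α (fun u => MvPowerSeries.coeff m (b u r)) w :=
    ev_pdv α _ (fun w => by rw [← coeff_evW, h]) w
  rw [h1]
  change _ = pd α (fun u => MvPowerSeries.coeff m (b u r)) w - ∑ β, ∑ γ, _
  congr 1
  rw [map_sum, map_sum, sum_comm]
  refine sum_congr rfl fun γ _ => ?_
  rw [rowForm, sum_mul, map_sum, map_sum]
  refine sum_congr rfl fun β _ => ?_
  rw [smul_mul_assoc, map_smul, smul_eq_mul, map_mul]
  congr 1
  · exact hL.isRep_Γ α γ β w
  · have h2 : delta γ (b w) r = MvPowerSeries.map (ev w).toRingHom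
        (MvPowerSeries.pderiv (SF U) γ (a r)) := by
      rw [← h w, ← evW_del]
      rfl
    change _ = MvPowerSeries.coeff m (MvPowerSeries.X β * delta γ (b w) r)
    rw [h2, ← MvPowerSeries.map_X (ev w).toRingHom β, ← map_mul, MvPowerSeries.coeff_map]
    rfl

theorem evW_t (α β : Idx n) (w : U) : evW w (hL.fed.t α β) = torsionForm L α β w := by
  funext r
  change MvPowerSeries.map (ev w).toRingHom ((ofM (hL.fed.tM α β) : hL.fed.W) r) = _
  rw [ofM_apply, torsionForm]
  split_ifs
  · rw [FedosovDatum.tM, map_sum]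
    refine sum_congr rfl fun γ _ => ?_
    rw [map_sum]
    refine sum_congr rfl fun τ _ => ?_
    rw [MvPowerSeries.smul_eq_C_mul, map_mul, MvPowerSeries.map_C, MvPowerSeries.map_X,
      MvPowerSeries.smul_eq_C_mul]
    congr 2
    exact (hL.isRepM_θ γ τ).mul (hL.isRep_T τ α β) w
  · exact map_zero _

theorem evW_ρ (α β : Idx n) (w : U) : evW w (hL.fed.ρ α β) = curvatureForm L α β w := by
  funext r
  change MvPowerSeries.map (ev w).toRingHom ((ofM (hL.fed.ρM α β) : hL.fed.W) r) = _
  rw [ofM_apply, curvatureForm]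
  split_ifs
  · rw [FedosovDatum.ρM, map_sum]
    refine sum_congr rfl fun γ _ => ?_
    rw [map_sum]
    refine sum_congr rfl fun φ _ => ?_
    rw [map_sum]
    refine sum_congr rfl fun τ _ => ?_
    rw [MvPowerSeries.smul_eq_C_mul, map_mul, MvPowerSeries.map_C, map_mul, MvPowerSeries.map_X,
      MvPowerSeries.map_X, MvPowerSeries.smul_eq_C_mul]
    congr 2
    exact ((hL.isRepM_θ γ τ).mul (hL.isRep_R α β τ φ)).smul (x := 1 / 2) (by norm_num) w
  · exact map_zero _

theorem evW_rDeg (k : ℕ) : ∀ (β : Idx n) (w : U), evW w (hL.fed.rDeg k β) = rDeg L k β w := by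
  induction k using Nat.strong_induction_on with
  | _ k ih =>
    intro β w
    rcases k with _ | _ | _ | k
    · rw [FedosovDatum.rDeg, rDeg]; exact evW_zero w
    · rw [FedosovDatum.rDeg, rDeg]; exact evW_zero w
    · rw [FedosovDatum.rDeg, rDeg, evW_dinv₂]
      simp only [hL.evW_t]
    · rw [FedosovDatum.rDeg, rDeg, evW_dinv₂]
      congr 1
      funext α α'
      rw [evW_sub, evW_add, evW_sub, evW_csmul, evW_unshift, evW_sum,
        hL.evW_D (fun w => ih (k + 2) (by omega) α' w),
        hL.evW_D (fun w => ih (k + 2) (by omega) α w)]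
      congr 1
      · congr 1
        split_ifs
        · exact hL.evW_ρ α α' w
        · exact evW_zero w
      · congr 2
        refine sum_congr rfl fun l _ => ?_
        have hl := l.2
        rw [evW_sub, evW_mul w (hL.Λ_map w), evW_mul w (hL.Λ_map w), ih _ (by omega),
          ih _ (by omega), ih _ (by omega), ih _ (by omega)]
        rfl

theorem evW_r (β : Idx n) (w : U) : evW w (hL.fed.r β) = rTotal L β w := by
  refine Wick.ext fun r m => ?_
  rw [coeff_evW, FedosovDatum.r, coeff_total, ← coeff_evW, evW_rDeg]
  rfl

theorem evW_fD {a : hL.fed.W} {b : Coord n → Wick n} (h : ∀ w : U, evW w a = b w) (α : Idx n)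
    (w : U) : evW w (hL.fed.fD α a) = fedosovD L b α w := by
  rw [FedosovDatum.fD, evW_sub, evW_add, evW_neg, evW_csmul, hL.evW_D h, evW_del,
    evW_br w (hL.Λ_map w), evW_r, h]
  rfl

theorem divV_sum {κ : Type*} (s : Finset κ) (a : κ → Wick n) :
    divV (∑ i ∈ s, a i) = ∑ i ∈ s, divV (a i) := by
  funext r
  rw [Finset.sum_apply]
  exact Finset.sum_apply (r + 1) s a

theorem evW_tauStep {a : hL.fed.W} {b : Coord n → Wick n} (h : ∀ w : U, evW w a = b w) (k : ℕ)
    (w : U) : evW w (dinv₁ fun α => hL.fed.D α (dp k a) -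
      Complex.I • ∑ l ∈ range (k + 1), br (hL.fed.rDeg (l + 2) α) (dp (k - l) a)) =
      tauStep L b k w := by
  rw [evW_dinv₁, tauStep]
  congr 1
  funext α
  rw [evW_sub, evW_csmul,
    hL.evW_D (b := fun u => degPart k (b u)) (fun w => by rw [evW_dp, h w]), divV_sum, evW_sum]
  congr 2
  refine sum_congr rfl fun l _ => ?_
  rw [evW_br w (hL.Λ_map w), evW_rDeg, evW_dp, h]
  rfl

end IsRegularOn

end LagrangeFedosov

namespace LagrangeFedosov

open Finset

open TopologicalSpace (Opens)

/-! ### Changes of coordinates -/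

variable {n : ℕ} {U U' : Opens (Coord n)}

/-- The pullback of smooth functions along a smooth map. -/
noncomputable def SF.pullback (κ : Coord n → Coord n) (hκ : ContDiffOn ℝ ∞ κ U)
    (hm : ∀ w ∈ U, κ w ∈ U') : SF U' →ₐ[ℂ] SF U where
  toFun a := SF.mk (fun w => extZero a.1 (κ w)) ((SF.smooth a).comp hκ hm)
  map_one' := SF.ext_ev fun w => extZero_apply (U := U') 1 ⟨κ w, hm w w.2⟩
  map_zero' := SF.ext_ev fun w => extZero_apply (U := U') 0 ⟨κ w, hm w w.2⟩
  map_mul' a b := SF.ext_ev fun w => by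
    rw [map_mul, ev_mk, ev_mk, ev_mk]
    simp [extZero, hm w w.2]
  map_add' a b := SF.ext_ev fun w => by
    rw [map_add, ev_mk, ev_mk, ev_mk]
    simp [extZero, hm w w.2]
  commutes' c := SF.ext_ev fun w => by
    rw [ev_mk, AlgHom.commutes]
    exact extZero_apply (U := U') (algebraMap ℂ (SF U') c).1 ⟨κ w, hm w w.2⟩

theorem ev_pullback (κ : Coord n → Coord n) (hκ : ContDiffOn ℝ ∞ κ U) (hm : ∀ w ∈ U, κ w ∈ U')
    (a : SF U') (w : U) : ev w (SF.pullback κ hκ hm a) = ev ⟨κ w, hm w w.2⟩ a :=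
  extZero_apply a.1 ⟨κ w, hm w w.2⟩

theorem pd_apply_coord {κ : Coord n → Coord n} (hκ : ContDiffOn ℝ ∞ κ U) (μ β : Idx n)
    {w : Coord n} (hw : w ∈ U) : pd μ κ w β = pd μ (fun x => κ x β) w := by
  have h := (hasFDerivAt_pi'.1 (differentiableAt_of_contDiffOn hκ hw).hasFDerivAt β).fderiv
  rw [pd, pd, h]
  rfl

/-- The Jacobian matrix as a matrix of smooth functions. -/
noncomputable def jacSF (κ : Coord n → Coord n) (hκ : ContDiffOn ℝ ∞ κ U) :
    Matrix (Idx n) (Idx n) (SF U) :=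
  Matrix.of fun β α => SF.mk (fun w => (jac κ w β α : ℂ))
    (Complex.ofRealCLM.contDiff.comp_contDiffOn
      ((contDiff_apply ℝ ℝ β).comp_contDiffOn (contDiffOn_pd hκ α)))

theorem isRepM_jacSF {κ : Coord n → Coord n} (hκ : ContDiffOn ℝ ∞ κ U) :
    IsRepM (jacSF κ hκ) (jac κ) := fun _ _ _ => rfl

theorem IsRepM.pullback {κ : Coord n → Coord n} (hκ : ContDiffOn ℝ ∞ κ U)
    (hm : ∀ w ∈ U, κ w ∈ U') {ι ι' : Type*} {M : Matrix ι ι' (SF U')} {g : Coord n → Matrix ι ι' ℝ}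
    (h : IsRepM M g) : IsRepM (M.map (SF.pullback κ hκ hm)) fun w => g (κ w) := fun i j w => by
  rw [Matrix.map_apply, ev_pullback, h]

theorem IsRepM.eq {ι ι' : Type*} {M N : Matrix ι ι' (SF U)} {f g : Coord n → Matrix ι ι' ℝ}
    (hM : IsRepM M f) (hN : IsRepM N g) (h : ∀ w ∈ U, f w = g w) : M = N := by
  ext i j
  exact congrFun (congrArg Subtype.val (SF.ext_ev fun w =>
    (hM i j w).trans ((congrArg (fun M => ((M i j : ℝ) : ℂ)) (h w w.2)).trans (hN i j w).symm))) _

theorem pd_comp {κ : Coord n → Coord n} (hκ : ContDiffOn ℝ ∞ κ U) (hm : ∀ w ∈ U, κ w ∈ U')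
    {g : Coord n → ℂ} (hg : ContDiffOn ℝ ∞ g U') (μ : Idx n) {w : Coord n} (hw : w ∈ U) :
    pd μ (fun x => g (κ x)) w = ∑ δ, (jac κ w δ μ : ℂ) * pd δ g (κ w) := by
  have h := (differentiableAt_of_contDiffOn hg (hm w hw)).hasFDerivAt.comp w
    (differentiableAt_of_contDiffOn hκ hw).hasFDerivAt
  have e : fderiv ℝ (fun x => g (κ x)) w = (fderiv ℝ g (κ w)).comp (fderiv ℝ κ w) := h.fderiv
  rw [pd, e, ContinuousLinearMap.comp_apply]
  have hv : fderiv ℝ κ w (Pi.single μ 1) =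
      ∑ δ, jac κ w δ μ • (Pi.single δ (1 : ℝ) : Coord n) := by
    funext δ
    rw [Finset.sum_apply]
    simp [jac, pd, Pi.single_apply]
  rw [hv, map_sum]
  refine sum_congr rfl fun δ _ => ?_
  rw [map_smul, Complex.real_smul]
  rfl

variable {L L' : Coord n → ℝ} (hL : IsRegularOn U L) (hL' : IsRegularOn U' L')

/-- The assumption that `κ` maps the metric, the almost complex structure and the vertical
distribution of `L` to those of `L'`. -/
structure IsCompatible (U U' : Opens (Coord n)) (L L' : Coord n → ℝ) (κ : Coord n → Coord n) :
    Prop where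
  smooth : ContDiffOn ℝ ∞ κ U
  mapsTo : ∀ w ∈ U, κ w ∈ U'
  metric : ∀ w ∈ U, metric L w = (jac κ w)ᵀ * metric L' (κ w) * jac κ w
  acs : ∀ w ∈ U, jac κ w * acs L w = acs L' (κ w) * jac κ w
  vertical : ∀ w ∈ U, ∀ i j : Fin n, jac κ w (Sum.inl i) (Sum.inr j) = 0

/-- The change of data which a compatible map defines. -/
noncomputable def IsCompatible.change {κ : Coord n → Coord n} (h : IsCompatible U U' L L' κ) :
    hL.datum.Change hL'.datum where
  σ := SF.pullback κ h.smooth h.mapsTo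
  P := jacSF κ h.smooth
  pdv_σ α a := SF.ext_ev fun w => by
    have e1 : ev w (hL.datum.pdv α (SF.pullback κ h.smooth h.mapsTo a)) =
        pd α (fun x => extZero a.1 (κ x)) w := ev_pdv α _ (fun w => rfl) w
    rw [e1, pd_comp h.smooth h.mapsTo (SF.smooth a) α w.2, map_sum]
    refine sum_congr rfl fun δ _ => ?_
    rw [map_mul, ev_pullback]
    congr 1
  pdv_P α β γ := SF.ext_ev fun w => by
    have hβ : ContDiffOn ℝ ∞ (fun x => κ x β) U :=
      (contDiff_apply ℝ ℝ β).comp_contDiffOn h.smooth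
    have e : ∀ γ, IsRep (jacSF κ h.smooth β γ) (pd γ fun x => κ x β) := fun γ =>
      (isRepM_jacSF h.smooth β γ).congr fun w hw => pd_apply_coord h.smooth γ β hw
    have e1 := (e γ).pd α w
    have e2 := (e α).pd γ w
    rw [pd_comm hβ α γ w.2, ← e2] at e1
    exact e1
  metric := hL.isRepM_metric.eq (((isRepM_jacSF h.smooth).transpose.mul
    (hL'.isRepM_metric.pullback h.smooth h.mapsTo)).mul (isRepM_jacSF h.smooth)) h.metric
  acs := ((isRepM_jacSF h.smooth).mul hL.isRepM_acs).eq
    ((hL'.isRepM_acs.pullback h.smooth h.mapsTo).mul (isRepM_jacSF h.smooth)) h.acs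
  vertical i j := SF.ext_ev fun w =>
    (congrArg (fun x : ℝ => (x : ℂ)) (h.vertical w w.2 i j)).trans
      (Complex.ofReal_zero.trans (map_zero (ev w)).symm)

/-- The change of fibre coordinates which a compatible map defines, evaluated at a point. -/
theorem IsCompatible.evW_Φ {κ : Coord n → Coord n} (h : IsCompatible U U' L L' κ)
    (a : hL'.fed.W) (w : U) : evW w ((h.change hL hL').toFedosov.Φ a) =
      changeFrame (jac κ w) (evW ⟨κ w, h.mapsTo w w.2⟩ a) := by
  funext r
  change MvPowerSeries.map (ev w).toRingHom (pullM (SF.pullback κ h.smooth h.mapsTo)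
    (jacSF κ h.smooth) (a r)) = MvPowerSeries.subst _ (evW ⟨κ w, h.mapsTo w w.2⟩ a r)
  rw [pullM_apply, MvPowerSeries.map_subst (hasSubst_rowForm _)]
  congr 1
  · funext β
    rw [rowForm, map_sum]
    refine sum_congr rfl fun α _ => ?_
    rw [MvPowerSeries.smul_eq_C_mul, map_mul, MvPowerSeries.map_C, MvPowerSeries.map_X]
    rfl
  · refine MvPowerSeries.ext fun m => ?_
    rw [MvPowerSeries.coeff_map, MvPowerSeries.coeff_map, coeff_evW]
    exact ev_pullback κ h.smooth h.mapsTo _ w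

theorem changeFrame_one (a : Wick n) : changeFrame 1 a = a := by
  funext r
  have e : (fun β => ∑ α, MvPowerSeries.C (((1 : Matrix (Idx n) (Idx n) ℝ) β α : ℝ) : ℂ) *
      MvPowerSeries.X α : Idx n → MvPowerSeries (Idx n) ℂ) = MvPowerSeries.X := by
    funext β
    rw [sum_eq_single β]
    · simp
    · intro b _ hb
      simp [Matrix.one_apply_ne hb.symm]
    · simp
  rw [changeFrame, e, MvPowerSeries.subst_self]
  rfl

theorem jac_of_eq_id {κ : Coord n → Coord n} (h : ∀ w ∈ U, κ w = w) {w : Coord n} (hw : w ∈ U) :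
    jac κ w = 1 := by
  ext l μ
  rw [jac, Matrix.of_apply, pd_congr (g' := id) h μ hw, pd, fderiv_id, ContinuousLinearMap.id_apply,
    Matrix.one_apply, Pi.single_apply]

theorem isCompatible_id (hU : ∀ w ∈ U, w ∈ U') : IsCompatible U U' L L id where
  smooth := contDiff_id.contDiffOn
  mapsTo := hU
  metric w hw := by rw [jac_of_eq_id (κ := id) (fun _ _ => rfl) hw]; simp
  acs w hw := by rw [jac_of_eq_id (κ := id) (fun _ _ => rfl) hw]; simp
  vertical w hw i j := by rw [jac_of_eq_id (κ := id) (fun _ _ => rfl) hw]; simp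

end LagrangeFedosov

namespace LagrangeFedosov

open Finset

open TopologicalSpace (Opens)

/-! ### Flat sections on overlaps of charts -/

section

variable {n : ℕ} {U U₁ U₂ : Opens (Coord n)} {L L₁ L₂ : Coord n → ℝ} (hL : IsRegularOn U L)
  (hL₁ : IsRegularOn U₁ L₁) (hL₂ : IsRegularOn U₂ L₂) {κ₁ κ₂ : Coord n → Coord n}
  (h₁ : IsCompatible U U₁ L L₁ κ₁) (h₂ : IsCompatible U U₂ L L₂ κ₂)

include hL

theorem IsCompatible.constantCoeff_Φ (a : hL₁.fed.W) (w : U) (r : ℕ) :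
    ev w (MvPowerSeries.constantCoeff ((h₁.change hL hL₁).toFedosov.Φ a r)) =
      ev ⟨κ₁ w, h₁.mapsTo w w.2⟩ (MvPowerSeries.constantCoeff (a r)) := by
  rw [← constantCoeff_evW, h₁.evW_Φ, constantCoeff_changeFrame, constantCoeff_evW]

/-- Flat elements with the same part of `deg_s`-degree zero agree on overlaps: their pullbacks to
the overlap are flat for one and the same datum. -/
theorem IsCompatible.Φ_eq_Φ {a : hL₁.fed.W} {b : hL₂.fed.W} (ha : hL₁.fed.IsFlat a)
    (hb : hL₂.fed.IsFlat b)
    (h : ∀ (w : U) r, ev ⟨κ₁ w, h₁.mapsTo w w.2⟩ (MvPowerSeries.constantCoeff (a r)) =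
      ev ⟨κ₂ w, h₂.mapsTo w w.2⟩ (MvPowerSeries.constantCoeff (b r))) :
    (h₁.change hL hL₁).toFedosov.Φ a = (h₂.change hL hL₂).toFedosov.Φ b :=
  ((h₁.change hL hL₁).toFedosov.isFlat_Φ ha).ext hL.fed
    ((h₂.change hL hL₂).toFedosov.isFlat_Φ hb) fun r => SF.ext_ev fun w => by
      rw [h₁.constantCoeff_Φ, h₂.constantCoeff_Φ, h]

end

/-! ### Charts of a Lagrange–Finsler space -/

variable {n : ℕ} {V : Type*} [TopologicalSpace V] [ChartedSpace (Coord n) V]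

/-- The open set of coordinates of a chart. -/
def chartTarget (φ : OpenPartialHomeomorph V (Coord n)) : Opens (Coord n) :=
  ⟨φ.target, φ.open_target⟩

/-- The coordinates of the points of `φ` which also lie in `ψ`. -/
def chartOverlap (φ ψ : OpenPartialHomeomorph V (Coord n)) : Opens (Coord n) :=
  ⟨(φ.symm.trans ψ).source, (φ.symm.trans ψ).open_source⟩

theorem isCompatible_overlap (φ ψ : OpenPartialHomeomorph V (Coord n)) (L : Coord n → ℝ) :
    IsCompatible (chartOverlap φ ψ) (chartTarget φ) L L id :=
  isCompatible_id fun _ h => h.1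

theorem mem_chartOverlap {φ ψ : OpenPartialHomeomorph V (Coord n)} {u : V} (hφ : u ∈ φ.source)
    (hψ : u ∈ ψ.source) : φ u ∈ chartOverlap φ ψ :=
  ⟨φ.map_source hφ, by
    change φ.symm (φ u) ∈ ψ.source
    rwa [φ.left_inv hφ]⟩

/-- The point of `chartTarget φ` which a point in the source of `φ` defines. -/
def chartPt (φ : OpenPartialHomeomorph V (Coord n)) {u : V} (hu : u ∈ φ.source) : chartTarget φ :=
  ⟨φ u, φ.map_source hu⟩

theorem exists_chartPt {φ : OpenPartialHomeomorph V (Coord n)} (w : chartTarget φ) :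
    ∃ (u : V) (hu : u ∈ φ.source), chartPt φ hu = w :=
  ⟨φ.symm w, φ.map_target w.2, Subtype.ext (φ.right_inv w.2)⟩

section

variable [IsManifold 𝓘(ℝ, Coord n) ∞ V] {φ ψ : OpenPartialHomeomorph V (Coord n)}

theorem contDiffOn_transition (hφ : φ ∈ atlas (Coord n) V) (hψ : ψ ∈ atlas (Coord n) V) :
    ContDiffOn ℝ ∞ (ψ ∘ φ.symm) (chartOverlap φ ψ) := by
  have h1 := contMDiffOn_symm_of_mem_maximalAtlas (I := 𝓘(ℝ, Coord n)) (n := ∞)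
    (IsManifold.subset_maximalAtlas hφ)
  have h2 := contMDiffOn_of_mem_maximalAtlas (I := 𝓘(ℝ, Coord n)) (n := ∞)
    (IsManifold.subset_maximalAtlas hψ)
  exact (h2.comp' h1).contDiffOn.mono fun w hw => hw

/-- The algebra of smooth functions on `V` acts on a chart by local representatives. -/
noncomputable def chartFun (hφ : φ ∈ atlas (Coord n) V) :
    smoothFunctions n V →ₐ[ℂ] SF (chartTarget φ) where
  toFun f := SF.mk (fun w => f.1 (φ.symm w)) (ContMDiffOn.contDiffOn (f.2.comp_contMDiffOn
    (contMDiffOn_symm_of_mem_maximalAtlas (IsManifold.subset_maximalAtlas hφ))))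
  map_one' := rfl
  map_zero' := rfl
  map_mul' _ _ := rfl
  map_add' _ _ := rfl
  commutes' _ := rfl

theorem ev_chartFun (hφ : φ ∈ atlas (Coord n) V) (f : smoothFunctions n V)
    (w : chartTarget φ) : ev w (chartFun hφ f) = f.1 (φ.symm w) := rfl

theorem ev_chartPt_chartFun (hφ : φ ∈ atlas (Coord n) V) (f : smoothFunctions n V) {u : V}
    (hu : u ∈ φ.source) : ev (chartPt φ hu) (chartFun hφ f) = f.1 u :=
  congrArg f.1 (φ.left_inv hu)

theorem eq_of_chartFun {f g : smoothFunctions n V}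
    (h : ∀ φ (hφ : φ ∈ atlas (Coord n) V), chartFun hφ f = chartFun hφ g) : f = g :=
  Subtype.ext <| funext fun u => by
    rw [← ev_chartPt_chartFun (chart_mem_atlas _ u) f (mem_chart_source _ u), h,
      ev_chartPt_chartFun]

theorem contMDiff_of_chart {f : V → ℂ}
    (h : ∀ φ ∈ atlas (Coord n) V, ∃ a : SF (chartTarget φ), ∀ (u : V) (hu : u ∈ φ.source),
      f u = ev (chartPt φ hu) a) : ContMDiff 𝓘(ℝ, Coord n) 𝓘(ℝ, ℂ) ∞ f := fun u => by
  obtain ⟨a, ha⟩ := h _ (chart_mem_atlas (Coord n) u)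
  have hc := (SF.smooth a).contMDiffOn.comp
    (contMDiffOn_chart (I := 𝓘(ℝ, Coord n)) (n := ∞) (x := u))
    fun x hx => (chartAt (Coord n) u).map_source hx
  have hs := (chartAt (Coord n) u).open_source.mem_nhds (mem_chart_source (Coord n) u)
  refine (hc.contMDiffAt hs).congr_of_eventuallyEq ?_
  filter_upwards [hs] with x hx
  rw [ha x hx]
  exact (extZero_apply a.1 (chartPt _ hx)).symm

/-- The coefficients of a formal function in a chart. -/
noncomputable def chartSeries (hφ : φ ∈ atlas (Coord n) V) (F : FormalFunctions n V) :
    ℕ → SF (chartTarget φ) := fun r => chartFun hφ (PowerSeries.coeff r F)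

theorem eq_of_chartSeries {F G : FormalFunctions n V}
    (h : ∀ φ (hφ : φ ∈ atlas (Coord n) V), chartSeries hφ F = chartSeries hφ G) : F = G :=
  PowerSeries.ext fun r => eq_of_chartFun fun φ hφ => congrFun (h φ hφ) r

theorem chartSeries_C (hφ : φ ∈ atlas (Coord n) V) (f : smoothFunctions n V) :
    chartSeries hφ (PowerSeries.C f) = single (chartFun hφ f) := by
  funext r
  rw [chartSeries, PowerSeries.coeff_C, single]
  split_ifs
  · rfl
  · exact map_zero _

theorem chartSeries_one (hφ : φ ∈ atlas (Coord n) V) :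
    chartSeries hφ (1 : FormalFunctions n V) = single 1 := by
  rw [← map_one (chartFun hφ), ← chartSeries_C, map_one]

theorem chartSeries_add (hφ : φ ∈ atlas (Coord n) V) (F G : FormalFunctions n V) :
    chartSeries hφ (F + G) = chartSeries hφ F + chartSeries hφ G := by
  funext r
  rw [chartSeries, map_add, map_add]
  rfl

theorem chartSeries_smul (hφ : φ ∈ atlas (Coord n) V) (c : ℂ) (F : FormalFunctions n V) :
    chartSeries hφ (c • F) = c • chartSeries hφ F := by
  funext r
  rw [chartSeries, Pi.smul_apply, chartSeries, ← map_smul]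
  rfl

end

/-! ### Sections of the bundle of Wick algebras -/

theorem rep_apply (φ : OpenPartialHomeomorph V (Coord n)) (a : V → Wick n) {u : V}
    (hu : u ∈ φ.source) :
    rep φ a (φ u) = changeFrame (jac (chartAt (Coord n) u ∘ φ.symm) (φ u)) (a u) := by
  rw [rep, φ.left_inv hu]

/-- The transition map of a chart with itself has the identity as Jacobian, so that a section is
recovered from its local representatives. -/
theorem rep_chartAt (a : V → Wick n) (u : V) :
    rep (chartAt (Coord n) u) a (chartAt (Coord n) u u) = a u := by
  rw [rep_apply _ _ (mem_chart_source _ u)]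
  have h : jac (chartAt (Coord n) u ∘ (chartAt (Coord n) u).symm) (chartAt (Coord n) u u) = 1 :=
    jac_of_eq_id (U := chartTarget (chartAt (Coord n) u))
      (fun w hw => (chartAt (Coord n) u).right_inv hw) (mem_chart_target _ u)
  rw [h, changeFrame_one]

theorem WickSection.ext_rep {a b : WickSection n V}
    (h : ∀ φ ∈ atlas (Coord n) V, ∀ w ∈ φ.target, rep φ a.toFun w = rep φ b.toFun w) : a = b := by
  have e : a.toFun = b.toFun := funext fun u => by
    rw [← rep_chartAt a.toFun, h _ (chart_mem_atlas _ u) _ (mem_chart_target _ u), rep_chartAt]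
  cases a
  cases b
  cases e
  rfl

variable (S : LagrangeFinslerSpace n V) {φ ψ : OpenPartialHomeomorph V (Coord n)}

namespace LagrangeFinslerSpace

theorem isRegularOn (hφ : φ ∈ atlas (Coord n) V) : IsRegularOn (chartTarget φ) (S.lagr φ) :=
  ⟨S.smooth φ hφ, S.regular φ hφ⟩

/-- The Fedosov datum of the Lagrangian in a chart. -/
noncomputable abbrev fed (hφ : φ ∈ atlas (Coord n) V) :
    FedosovDatum (Idx n) (SF (chartTarget φ)) :=
  (S.isRegularOn hφ).fed

/-- A section of the bundle of Wick algebras in a chart, as an element of the Wick algebra over the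
smooth functions. -/
noncomputable def chartSection (hφ : φ ∈ atlas (Coord n) V) (a : WickSection n V) :
    (S.fed hφ).W := fun r =>
  (fun m => SF.mk (fun w => MvPowerSeries.coeff m (rep φ a.toFun w r)) (a.smooth φ hφ r m) :
    (Idx n →₀ ℕ) → SF (chartTarget φ))

theorem evW_chartSection (hφ : φ ∈ atlas (Coord n) V) (a : WickSection n V) (w : chartTarget φ) :
    evW w (S.chartSection hφ a) = rep φ a.toFun w :=
  Wick.ext fun r m => coeff_evW w (S.chartSection hφ a) r m

variable {S} in
theorem IsFlat.chartSection {a : WickSection n V} (h : S.IsFlat a)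
    (hφ : φ ∈ atlas (Coord n) V) : (S.fed hφ).IsFlat (S.chartSection hφ a) := fun α =>
  eq_of_evW fun w => by
    rw [(S.isRegularOn hφ).evW_fD (S.evW_chartSection hφ a), h φ hφ w w.2, evW_zero]

variable [IsManifold 𝓘(ℝ, Coord n) ∞ V]

theorem isCompatible_transition (hφ : φ ∈ atlas (Coord n) V) (hψ : ψ ∈ atlas (Coord n) V) :
    IsCompatible (chartOverlap φ ψ) (chartTarget ψ) (S.lagr φ) (S.lagr ψ) (ψ ∘ φ.symm) := by
  have key : ∀ w ∈ chartOverlap φ ψ, ∃ u ∈ φ.source ∩ ψ.source, φ u = w := fun w hw =>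
    ⟨φ.symm w, ⟨φ.map_target hw.1, hw.2⟩, φ.right_inv hw.1⟩
  refine ⟨contDiffOn_transition hφ hψ, fun w hw => ψ.map_source hw.2, ?_, ?_, ?_⟩ <;>
    intro w hw <;> obtain ⟨u, hu, rfl⟩ := key w hw
  · rw [S.metric_compat φ hφ ψ hψ u hu, Function.comp_apply, φ.left_inv hu.1]
  · rw [S.acs_compat φ hφ ψ hψ u hu, Function.comp_apply, φ.left_inv hu.1]
  · exact S.vertical_compat φ hφ ψ hψ u hu

theorem isRegularOn_overlap (hφ : φ ∈ atlas (Coord n) V) (ψ : OpenPartialHomeomorph V (Coord n)) :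
    IsRegularOn (chartOverlap φ ψ) (S.lagr φ) :=
  ⟨(S.smooth φ hφ).mono fun _ h => h.1, fun w h => S.regular φ hφ w h.1⟩

/-- The flat element over a chart which a formal function defines. -/
noncomputable def chartτ (hφ : φ ∈ atlas (Coord n) V) (F : FormalFunctions n V) : (S.fed hφ).W :=
  (S.fed hφ).τ (chartSeries hφ F)

theorem constantCoeff_chartτ (hφ : φ ∈ atlas (Coord n) V) (F : FormalFunctions n V)
    {u : V} (hu : u ∈ φ.source) (r : ℕ) :
    ev (chartPt φ hu) (MvPowerSeries.constantCoeff (S.chartτ hφ F r)) =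
      (PowerSeries.coeff r F).1 u := by
  rw [chartτ, FedosovDatum.constantCoeff_τ]
  exact ev_chartPt_chartFun hφ _ hu

theorem Φ_chartτ (hφ : φ ∈ atlas (Coord n) V) (hψ : ψ ∈ atlas (Coord n) V)
    (F : FormalFunctions n V) :
    ((isCompatible_overlap φ ψ (S.lagr φ)).change (S.isRegularOn_overlap hφ ψ)
        (S.isRegularOn hφ)).toFedosov.Φ (S.chartτ hφ F) =
      ((S.isCompatible_transition hφ hψ).change (S.isRegularOn_overlap hφ ψ)
        (S.isRegularOn hψ)).toFedosov.Φ (S.chartτ hψ F) :=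
  IsCompatible.Φ_eq_Φ _ _ _ _ _ ((S.fed hφ).isFlat_τ _) ((S.fed hψ).isFlat_τ _) fun w r => by
    have hφ' : φ.symm w ∈ φ.source := φ.map_target w.2.1
    have h1 := S.constantCoeff_chartτ hφ F hφ' r
    have h2 := S.constantCoeff_chartτ hψ F w.2.2 r
    have e : (chartPt φ hφ' : chartTarget φ) = ⟨w, w.2.1⟩ := Subtype.ext (φ.right_inv w.2.1)
    rw [e] at h1
    exact h1.trans h2.symm

/-- The flat elements over two charts which a formal function defines are the same section. -/
theorem evW_chartτ (hφ : φ ∈ atlas (Coord n) V) (hψ : ψ ∈ atlas (Coord n) V)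
    (F : FormalFunctions n V) {u : V} (hu : u ∈ φ.source) (hu' : u ∈ ψ.source) :
    evW (chartPt φ hu) (S.chartτ hφ F) =
      changeFrame (jac (ψ ∘ φ.symm) (φ u)) (evW (chartPt ψ hu') (S.chartτ hψ F)) := by
  have h := congrArg (evW (⟨φ u, mem_chartOverlap hu hu'⟩ : chartOverlap φ ψ))
    (S.Φ_chartτ hφ hψ F)
  rw [IsCompatible.evW_Φ, IsCompatible.evW_Φ, jac_of_eq_id (κ := id) (U := chartOverlap φ ψ)
    (fun _ _ => rfl) (mem_chartOverlap hu hu'), changeFrame_one] at h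
  refine h.trans ?_
  congr 2
  exact Subtype.ext (congrArg ψ (φ.left_inv hu))

/-- The products of flat elements in two charts have the same part of `deg_s`-degree zero. -/
theorem ev_star_chartSeries (hφ : φ ∈ atlas (Coord n) V) (hψ : ψ ∈ atlas (Coord n) V)
    (F G : FormalFunctions n V) {u : V} (hu : u ∈ φ.source) (hu' : u ∈ ψ.source) (r : ℕ) :
    ev (chartPt φ hu) ((S.fed hφ).star (chartSeries hφ F) (chartSeries hφ G) r) =
      ev (chartPt ψ hu') ((S.fed hψ).star (chartSeries hψ F) (chartSeries hψ G) r) := by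
  have h1 : ((isCompatible_overlap φ ψ (S.lagr φ)).change (S.isRegularOn_overlap hφ ψ)
        (S.isRegularOn hφ)).toFedosov.Φ (S.chartτ hφ F * S.chartτ hφ G) =
      ((S.isCompatible_transition hφ hψ).change (S.isRegularOn_overlap hφ ψ)
        (S.isRegularOn hψ)).toFedosov.Φ (S.chartτ hψ F * S.chartτ hψ G) :=
    (FedosovDatum.Change.Φ_mul _ _ _).trans
      ((congrArg₂ (· * ·) (S.Φ_chartτ hφ hψ F) (S.Φ_chartτ hφ hψ G)).trans
        (FedosovDatum.Change.Φ_mul _ _ _).symm)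
  have h := congrArg (fun a : (S.isRegularOn_overlap hφ ψ).fed.W =>
      ev (⟨φ u, mem_chartOverlap hu hu'⟩ : chartOverlap φ ψ)
        (MvPowerSeries.constantCoeff (a r))) h1
  rw [IsCompatible.constantCoeff_Φ, IsCompatible.constantCoeff_Φ] at h
  have e : (⟨(ψ ∘ φ.symm) (φ u), (S.isCompatible_transition hφ hψ).mapsTo _
      (mem_chartOverlap hu hu')⟩ : chartTarget ψ) = chartPt ψ hu' :=
    Subtype.ext (congrArg ψ (φ.left_inv hu))
  rw [e] at h
  exact h

/-- The flat section which a formal function defines. -/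
noncomputable def tauFun (F : FormalFunctions n V) (u : V) : Wick n :=
  evW (chartPt _ (mem_chart_source (Coord n) u)) (S.chartτ (chart_mem_atlas _ u) F)

theorem rep_tauFun (hφ : φ ∈ atlas (Coord n) V) (F : FormalFunctions n V) (w : chartTarget φ) :
    rep φ (S.tauFun F) w = evW w (S.chartτ hφ F) := by
  obtain ⟨u, hu, rfl⟩ := exists_chartPt w
  rw [S.evW_chartτ hφ (chart_mem_atlas _ u) F hu (mem_chart_source _ u)]
  exact rep_apply φ _ hu

/-- The flat section which a formal function defines, as a smooth section. -/
noncomputable def tauSection (F : FormalFunctions n V) : WickSection n V where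
  toFun := S.tauFun F
  smooth φ hφ r m := (SF.smooth (MvPowerSeries.coeff m (S.chartτ hφ F r))).congr fun w hw => by
    rw [S.rep_tauFun hφ F ⟨w, hw⟩, coeff_evW]
    exact (extZero_apply (U := chartTarget φ) _ ⟨w, hw⟩).symm

/-- The map `τ`, the inverse of the projection `σ`. -/
noncomputable def tau (F : FormalFunctions n V) : S.FlatSection :=
  ⟨S.tauSection F, fun φ hφ w hw α => by
    have h := (S.isRegularOn hφ).evW_fD (fun w => (S.rep_tauFun hφ F w).symm) α ⟨w, hw⟩
    rw [chartτ, (S.fed hφ).isFlat_τ, evW_zero] at h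
    exact h.symm⟩

theorem sigma_tau (F : FormalFunctions n V) : sigma (S.tau F).1 = F :=
  PowerSeries.ext fun r => Subtype.ext <| funext fun u => by
    rw [sigma, PowerSeries.coeff_mk]
    exact (constantCoeff_evW _ _ _).trans (S.constantCoeff_chartτ _ F _ r)

theorem constantCoeff_chartSection (hφ : φ ∈ atlas (Coord n) V) (a : WickSection n V) (r : ℕ) :
    MvPowerSeries.constantCoeff (S.chartSection hφ a r) = chartSeries hφ (sigma a) r :=
  SF.ext_ev fun w => by
    rw [← constantCoeff_evW, evW_chartSection, rep, constantCoeff_changeFrame, chartSeries, sigma,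
      PowerSeries.coeff_mk, ev_chartFun]

theorem sigma_injective : Function.Injective fun a : S.FlatSection => sigma a.1 := fun a b h =>
  Subtype.ext <| WickSection.ext_rep fun φ hφ w hw => by
    have e : S.chartSection hφ a.1 = S.chartSection hφ b.1 :=
      (a.2.chartSection hφ).ext (S.fed hφ) (b.2.chartSection hφ) fun r => by
        rw [constantCoeff_chartSection, constantCoeff_chartSection]
        exact congrFun (congrArg (chartSeries hφ) h) r
    exact ((S.evW_chartSection hφ a.1 ⟨w, hw⟩).symm.trans (congrArg _ e)).trans
      (S.evW_chartSection hφ b.1 ⟨w, hw⟩)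

end LagrangeFinslerSpace

end LagrangeFedosov

namespace LagrangeFedosov

open Finset WickAlg

/-! ### The star product on the manifold -/

namespace LagrangeFinslerSpace

variable {n : ℕ} {V : Type*} [TopologicalSpace V] [ChartedSpace (Coord n) V]
  [IsManifold 𝓘(ℝ, Coord n) ∞ V] (S : LagrangeFinslerSpace n V)
  {φ : OpenPartialHomeomorph V (Coord n)}

/-- The star product, computed at each point in the preferred chart. -/
noncomputable def star (F G : FormalFunctions n V) : FormalFunctions n V :=
  PowerSeries.mk fun r =>
    ⟨fun u => ev (chartPt _ (mem_chart_source (Coord n) u)) ((S.fed (chart_mem_atlas _ u)).star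
      (chartSeries (chart_mem_atlas _ u) F) (chartSeries (chart_mem_atlas _ u) G) r),
    contMDiff_of_chart fun _ hφ => ⟨_, fun _ hu => S.ev_star_chartSeries _ hφ F G _ hu r⟩⟩

theorem chartSeries_star (hφ : φ ∈ atlas (Coord n) V) (F G : FormalFunctions n V) :
    chartSeries hφ (S.star F G) = (S.fed hφ).star (chartSeries hφ F) (chartSeries hφ G) := by
  funext r
  refine SF.ext_ev fun w => ?_
  obtain ⟨u, hu, rfl⟩ := exists_chartPt w
  rw [chartSeries, ev_chartPt_chartFun, star, PowerSeries.coeff_mk]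
  exact S.ev_star_chartSeries _ hφ F G _ hu r

theorem star_assoc (F G H : FormalFunctions n V) :
    S.star (S.star F G) H = S.star F (S.star G H) :=
  eq_of_chartSeries fun φ hφ => by
    simp only [chartSeries_star, FedosovDatum.star_assoc]

theorem one_star (F : FormalFunctions n V) : S.star 1 F = F :=
  eq_of_chartSeries fun φ hφ => by
    rw [chartSeries_star, chartSeries_one, FedosovDatum.one_star]

theorem star_one (F : FormalFunctions n V) : S.star F 1 = F :=
  eq_of_chartSeries fun φ hφ => by
    rw [chartSeries_star, chartSeries_one, FedosovDatum.star_one]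

/-- The bilinear operator `B_r`: the coefficient of `v^r` in the star product of two functions. -/
noncomputable def starCoeff (r : ℕ) :
    smoothFunctions n V →ₗ[ℂ] smoothFunctions n V →ₗ[ℂ] smoothFunctions n V :=
  have hC : ∀ (c : ℂ) (f : smoothFunctions n V),
      (PowerSeries.C (c • f) : FormalFunctions n V) = c • PowerSeries.C f := fun c f =>
    PowerSeries.ext fun k => by
      change _ = c • PowerSeries.coeff k (PowerSeries.C f : FormalFunctions n V)
      rw [PowerSeries.coeff_C, PowerSeries.coeff_C]
      split_ifs <;> simp
  have add_star : ∀ F F' G : FormalFunctions n V, S.star (F + F') G = S.star F G + S.star F' G :=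
    fun F F' G => eq_of_chartSeries fun φ hφ => by
      simp only [chartSeries_star, chartSeries_add, FedosovDatum.add_star]
  have star_add : ∀ F G G' : FormalFunctions n V, S.star F (G + G') = S.star F G + S.star F G' :=
    fun F G G' => eq_of_chartSeries fun φ hφ => by
      simp only [chartSeries_star, chartSeries_add, FedosovDatum.star_add]
  have smul_star : ∀ (c : ℂ) (F G : FormalFunctions n V), S.star (c • F) G = c • S.star F G :=
    fun c F G => eq_of_chartSeries fun φ hφ => by
      simp only [chartSeries_star, chartSeries_smul, FedosovDatum.csmul_star]
  have star_smul : ∀ (c : ℂ) (F G : FormalFunctions n V), S.star F (c • G) = c • S.star F G :=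
    fun c F G => eq_of_chartSeries fun φ hφ => by
      simp only [chartSeries_star, chartSeries_smul, FedosovDatum.star_csmul]
  LinearMap.mk₂ ℂ (fun f g => PowerSeries.coeff r (S.star (PowerSeries.C f) (PowerSeries.C g)))
    (fun f f' g => by rw [map_add, add_star, map_add])
    (fun c f g => by rw [hC, smul_star]; rfl)
    (fun f g g' => by rw [map_add, star_add, map_add])
    (fun c f g => by rw [hC, star_smul]; rfl)

theorem chartFun_starCoeff (hφ : φ ∈ atlas (Coord n) V) (r : ℕ) (f g : smoothFunctions n V) :
    chartFun hφ (S.starCoeff r f g) =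
      (S.fed hφ).star (single (chartFun hφ f)) (single (chartFun hφ g)) r := by
  rw [← chartSeries_C, ← chartSeries_C, ← chartSeries_star]
  rfl

theorem coeff_star (F G : FormalFunctions n V) (k : ℕ) :
    PowerSeries.coeff k (S.star F G) = ∑ r ∈ range (k + 1), ∑ p ∈ antidiagonal (k - r),
      S.starCoeff r (PowerSeries.coeff p.1 F) (PowerSeries.coeff p.2 G) :=
  eq_of_chartFun fun φ hφ => by
    simp only [map_sum, chartFun_starCoeff]
    exact (congrFun (S.chartSeries_star hφ F G) k).trans (FedosovDatum.star_apply _ _ _ k)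

theorem starCoeff_zero (f g : smoothFunctions n V) : S.starCoeff 0 f g = f * g :=
  eq_of_chartFun fun φ hφ => by
    rw [chartFun_starCoeff, FedosovDatum.star_apply_zero, map_mul]
    rfl

theorem starCoeff_one_sub (f g : smoothFunctions n V) (hφ : φ ∈ atlas (Coord n) V) {w : Coord n}
    (hw : w ∈ φ.target) :
    (S.starCoeff 1 f g - S.starCoeff 1 g f : smoothFunctions n V).1 (φ.symm w) =
      Complex.I * S.poisson φ f.1 g.1 w := by
  have h := congrArg (ev (⟨w, hw⟩ : chartTarget φ))
    ((S.fed hφ).star_sub_star (chartFun hφ f) (chartFun hφ g))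
  rw [← chartFun_starCoeff, ← chartFun_starCoeff, ← map_sub, ev_chartFun, map_smul] at h
  refine h.trans ?_
  rw [smul_eq_mul, poisson, map_sum]
  congr 1
  refine sum_congr rfl fun α _ => ?_
  rw [map_sum]
  refine sum_congr rfl fun β _ => ?_
  have hp : ∀ (f : smoothFunctions n V) μ, ev (⟨w, hw⟩ : chartTarget φ)
      ((S.fed hφ).pdv μ (chartFun hφ f)) = pd μ (fun u => f.1 (φ.symm u)) w := fun f μ =>
    ev_pdv μ _ (fun w => ev_chartFun hφ f w) _
  rw [map_mul, map_mul, hp, hp, mul_assoc]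
  congr 1
  exact (S.isRegularOn hφ).isRepM_θup α β ⟨w, hw⟩

theorem isStarProduct_star : S.IsStarProduct S.star where
  assoc := S.star_assoc
  one_star := S.one_star
  star_one := S.star_one
  expansion := ⟨S.starCoeff, S.coeff_star, S.starCoeff_zero,
    fun f g _ hφ _ hw => S.starCoeff_one_sub f g hφ hw⟩

/-- In every chart, the star product is the part of `deg_s`-degree zero of the Wick product of the
flat sections. -/
theorem coeff_star_apply (F G : FormalFunctions n V) (hφ : φ ∈ atlas (Coord n) V) {w : Coord n}
    (hw : w ∈ φ.target) (r : ℕ) : (PowerSeries.coeff r (S.star F G)).1 (φ.symm w) =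
      MvPowerSeries.constantCoeff (wickMul (wickTensor (S.lagr φ) w)
        (rep φ (S.tau F).1.toFun w) (rep φ (S.tau G).1.toFun w) r) := by
  have h := congrArg (ev (⟨w, hw⟩ : chartTarget φ)) (congrFun (S.chartSeries_star hφ F G) r)
  refine h.trans ?_
  rw [FedosovDatum.star, ← constantCoeff_evW,
    evW_mul _ ((S.isRegularOn hφ).Λ_map ⟨w, hw⟩)]
  exact congrArg₂ (fun a b => MvPowerSeries.constantCoeff
    (wickMul (wickTensor (S.lagr φ) w) a b r)) (S.rep_tauFun hφ F ⟨w, hw⟩).symm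
    (S.rep_tauFun hφ G ⟨w, hw⟩).symm

/-! ### The recursion for flat sections -/

theorem evW_dp_con_single (hφ : φ ∈ atlas (Coord n) V) (c : SF (chartTarget φ)) (k : ℕ)
    (w : chartTarget φ) :
    evW w (dp k ((S.fed hφ).con (single c))) = if k = 0 then constW (ev w c) else 0 := by
  refine Wick.ext fun r m => ?_
  rw [coeff_evW, coeff_dp, FedosovDatum.con, single]
  rcases Nat.eq_zero_or_pos r with rfl | hr
  · rw [if_pos rfl, MvPowerSeries.coeff_C]
    by_cases hm : m = 0
    · subst hm
      rcases Nat.eq_zero_or_pos k with rfl | hk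
      · simp [constW]
      · rw [if_neg (by simp; omega), if_neg hk.ne', map_zero]
        exact (map_zero (MvPowerSeries.coeff (R := ℂ) (0 : Idx n →₀ ℕ))).symm
    · rw [if_neg hm, ite_self, map_zero]
      split_ifs
      · simp [constW, MvPowerSeries.coeff_C, hm]
      · exact (map_zero (MvPowerSeries.coeff (R := ℂ) m)).symm
  · rw [if_neg hr.ne', map_zero, map_zero, ite_self, map_zero]
    split_ifs
    · rw [constW, if_neg hr.ne', map_zero]
    · exact (map_zero (MvPowerSeries.coeff (R := ℂ) m)).symm

theorem chartτ_C (hφ : φ ∈ atlas (Coord n) V) (f : smoothFunctions n V) :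
    (fun r => MvPowerSeries.constantCoeff (S.chartτ hφ (PowerSeries.C f) r)) =
      single (chartFun hφ f) := by
  funext r
  rw [chartτ, FedosovDatum.constantCoeff_τ, chartSeries_C]

theorem degPart_zero_tau (f : smoothFunctions n V) (hφ : φ ∈ atlas (Coord n) V) {w : Coord n}
    (hw : w ∈ φ.target) : degPart 0 (rep φ (S.tau (PowerSeries.C f)).1.toFun w) =
      constW (f.1 (φ.symm w)) := by
  have h := (S.rep_tauFun hφ (PowerSeries.C f) ⟨w, hw⟩)
  refine (congrArg (degPart 0) h).trans ?_
  have hflat : (S.fed hφ).IsFlat (S.chartτ hφ (PowerSeries.C f)) := (S.fed hφ).isFlat_τ _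
  rw [← evW_dp, hflat.dp_zero, chartτ_C, evW_dp_con_single, if_pos rfl, ev_chartFun]

theorem degPart_succ_tau (f : smoothFunctions n V) (hφ : φ ∈ atlas (Coord n) V) {w : Coord n}
    (hw : w ∈ φ.target) (k : ℕ) :
    degPart (k + 1) (rep φ (S.tau (PowerSeries.C f)).1.toFun w) =
      tauStep (S.lagr φ) (rep φ (S.tau (PowerSeries.C f)).1.toFun) k w := by
  refine (congrArg (degPart (k + 1)) (S.rep_tauFun hφ (PowerSeries.C f) ⟨w, hw⟩)).trans ?_
  have hflat : (S.fed hφ).IsFlat (S.chartτ hφ (PowerSeries.C f)) := (S.fed hφ).isFlat_τ _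
  rw [← evW_dp, hflat.dp_succ, chartτ_C, evW_add, evW_dp_con_single, if_neg (Nat.succ_ne_zero k),
    zero_add]
  exact (S.isRegularOn hφ).evW_tauStep (fun w => (S.rep_tauFun hφ (PowerSeries.C f) w).symm) k
    ⟨w, hw⟩

theorem tau_apply (F : FormalFunctions n V) (u : V) (r : ℕ) :
    (S.tau F).1.toFun u r = ∑ p ∈ antidiagonal r,
      (S.tau (PowerSeries.C (PowerSeries.coeff p.1 F))).1.toFun u p.2 := by
  have h := (S.fed (chart_mem_atlas (Coord n) u)).τ_apply
    (chartSeries (chart_mem_atlas (Coord n) u) F) r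
  have h' := congrArg (MvPowerSeries.map
    (ev (chartPt _ (mem_chart_source (Coord n) u))).toRingHom) h
  rw [map_sum] at h'
  refine h'.trans (sum_congr rfl fun p _ => ?_)
  rw [chartSeries, ← chartSeries_C]
  rfl

end LagrangeFinslerSpace

end LagrangeFedosov

theorem mainTheorem8 {n : ℕ} {V : Type*} [TopologicalSpace V]
    [ChartedSpace (LagrangeFedosov.Coord n) V]
    [IsManifold 𝓘(ℝ, LagrangeFedosov.Coord n) ∞ V]
    (S : LagrangeFedosov.LagrangeFinslerSpace n V) :
    Function.Bijective (fun a : S.FlatSection => LagrangeFedosov.sigma a.1) ∧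
    ∃ τ : LagrangeFedosov.FormalFunctions n V → S.FlatSection,
      Function.LeftInverse τ (fun a : S.FlatSection => LagrangeFedosov.sigma a.1) ∧
      Function.RightInverse τ (fun a : S.FlatSection => LagrangeFedosov.sigma a.1) ∧
      (∀ f : LagrangeFedosov.smoothFunctions n V,
        ∀ φ ∈ atlas (LagrangeFedosov.Coord n) V, ∀ w ∈ φ.target,
          LagrangeFedosov.degPart 0
              (LagrangeFedosov.rep φ (τ (PowerSeries.C f)).1.toFun w) =
            LagrangeFedosov.constW (f.1 (φ.symm w)) ∧
          ∀ k : ℕ,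
            LagrangeFedosov.degPart (k + 1)
                (LagrangeFedosov.rep φ (τ (PowerSeries.C f)).1.toFun w) =
              LagrangeFedosov.tauStep (S.lagr φ)
                (LagrangeFedosov.rep φ (τ (PowerSeries.C f)).1.toFun) k w) ∧
      (∀ (F : LagrangeFedosov.FormalFunctions n V) (u : V) (r : ℕ),
        (τ F).1.toFun u r = ∑ p ∈ Finset.HasAntidiagonal.antidiagonal r,
          (τ (PowerSeries.C (PowerSeries.coeff p.1 F))).1.toFun u p.2) ∧
      ∃ star : LagrangeFedosov.FormalFunctions n V → LagrangeFedosov.FormalFunctions n V →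
          LagrangeFedosov.FormalFunctions n V,
        S.IsStarProduct star ∧
        ∀ F G : LagrangeFedosov.FormalFunctions n V,
          ∀ φ ∈ atlas (LagrangeFedosov.Coord n) V, ∀ w ∈ φ.target, ∀ r : ℕ,
            (PowerSeries.coeff r (star F G)).1 (φ.symm w) =
              MvPowerSeries.constantCoeff
                (LagrangeFedosov.wickMul (LagrangeFedosov.wickTensor (S.lagr φ) w)
                  (LagrangeFedosov.rep φ (τ F).1.toFun w)
                  (LagrangeFedosov.rep φ (τ G).1.toFun w) r) := by
  have hR : Function.RightInverse S.tau (fun a : S.FlatSection => LagrangeFedosov.sigma a.1) :=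
    S.sigma_tau
  exact ⟨⟨S.sigma_injective, hR.surjective⟩, S.tau, hR.leftInverse_of_injective S.sigma_injective,
    hR, fun f φ hφ w hw => ⟨S.degPart_zero_tau f hφ hw, S.degPart_succ_tau f hφ hw⟩, S.tau_apply,
    S.star, S.isStarProduct_star, fun F G φ hφ w hw => S.coeff_star_apply F G hφ hw⟩
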